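/- Let $n\ge 1$ and $s\in(0,1)$. For $v$ on $\mathbb R^{n+1}\ni (t,x')$ let $\hat v(\rho,\xi)=\int e^{-i(t,x')\cdot(\rho,\xi)}v\,dx'\,dt$ (extended to tempered distributions), $\|v\|_{\mathcal H^a}^2=\int_{\mathbb R^{n+1}}(1+|i\rho+|\xi|^2|)^a|\hat v(\rho,\xi)|^2\,d\rho\,d\xi$ for $a\in\mathbb R$, and $\mathcal H^s(\mathbb R^{n+1})=\{u\in L^2(\mathbb R^{n+1}):\|u\|_{\mathcal H^s}<\infty\}$. Let $(\partial_t-\Delta)^s u$ be the tempered distribution with Fourier transform $(i\rho+|\xi|^2)^s\hat u$ (principal branch). Write $\mathbb R^{n+1}_+=\{(x',x_{n+1}):x'\in\mathbb R^n,\ x_{n+1}>0\}$, $\nabla=(\partial_1,\dots,\partial_{n+1})$, and let $\mathcal W$ be the space of all $F\in L^2_{loc}(\mathbb R\times\mathbb R^{n+1}_+,x_{n+1}^{1-2s})$ whose weak derivatives $\partial_1F,\dots,\partial_{n+1}F$ lie in $L^2(\mathbb R\times\mathbb R^{n+1}_+,x_{n+1}^{1-2s})$. Then there are a linear operator $E_s:\mathcal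 H^s(\mathbb R^{n+1})\to\mathcal W$, a constant $C$ and, for every $M\in(0,\infty)$, a constant $C(M)$, such that for every $u\in\mathcal H^s(\mathbb R^{n+1})$ the function $\tilde u=E_su$ is a weak solution of $$x_{n+1}^{1-2s}\partial_t\tilde u-\nabla\cdot(x_{n+1}^{1-2s}\nabla\tilde u)=0\quad\text{in }\mathbb R\times\mathbb R^{n+1}_+,$$ that is, $-\int x_{n+1}^{1-2s}\tilde u\,\partial_t\varphi+\int x_{n+1}^{1-2s}\nabla\tilde u\cdot\nabla\varphi=0$ for all $\varphi\in C_c^\infty(\mathbb R\times\mathbb R^{n+1}_+)$; the maps $x_{n+1}\mapsto\tilde u(\cdot,x_{n+1})$ and $x_{n+1}\mapsto\partial_{n+1}\tilde u(\cdot,x_{n+1})$ are (after modification on a null set) continuous from $(0,\infty)$ to $L^2(\mathbb R^{n+1})$; $\tilde u$ is real-valued if $u$ is; and $$\|\tilde u(\cdot,x_{n+1})-u\|_{\mathcal H^s}\to0\quad\text{as }x_{n+1}\to0,$$ $$\lim_{x_{n+1}\to0}\|x_{n+1}^{1-2s}\partial_{n+1}\tilde u(\cdot,x_{n+1})\|_{\mathcal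 H^{-s}}\ \text{ exists and is }\le C\|u\|_{\mathcal H^s},$$ $$\|x_{n+1}^{1-2s}\partial_{n+1}\tilde u(\cdot,x_{n+1})-d_s(\partial_t-\Delta)^su\|_{\mathcal H^{-s}}\to0\quad\text{as }x_{n+1}\to0,\qquad d_s=\frac{2s\,\Gamma(-s)}{4^s\,\Gamma(s)},$$ $$\|x_{n+1}^{\frac{1-2s}2}\nabla\tilde u\|_{L^2(\mathbb R\times\mathbb R^{n+1}_+)}\le C\|u\|_{\mathcal H^s},$$ $$\|x_{n+1}^{\frac{1-2s}2}\tilde u\|_{L^2(\mathbb R\times\mathbb R^n\times(0,M))}\le C(M)\|u\|_{L^2(\mathbb R^{n+1})}\quad\text{for all }M\in(0,\infty).$$ -/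

import Mathlib

open MeasureTheory Set Filter Topology FourierTransform
open scoped ENNReal NNReal SchwartzMap ContDiff

noncomputable section

namespace ParabolicExtension

/-- The space `ℝ^{n+1}` of space-time points `(t, x')`, or of frequencies `(ρ, ξ)`. The coordinate
`0` is the time `t` (frequency `ρ`); the coordinates `j.succ` are the space variables `x_j`
(frequencies `ξ_j`). -/
abbrev SpaceTime (n : ℕ) : Type := EuclideanSpace ℝ (Fin (n + 1))

/-- The symbol `iρ + |ξ|²` of `∂_t - Δ`, at the frequency `ζ = (ρ, ξ)`. -/
def heatSymbol {n : ℕ} (ζ : SpaceTime n) : ℂ :=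
  Complex.I * (ζ 0 : ℂ) + ((∑ j : Fin n, (ζ j.succ) ^ 2 : ℝ) : ℂ)

/-- The Fourier transform of the tempered distribution `T` is the function `g`, in the convention
`ĝ(ζ) = ∫ exp(-i y·ζ) g(y) dy`. Mathlib's `𝓕` uses the kernel `exp(-2πi y·η)` instead, so `g(ζ)`
is the value of `𝓕 T` at `η = ζ / 2π`. -/
def IsFourierTransform {n : ℕ} (T : 𝓢'(SpaceTime n, ℂ)) (g : SpaceTime n → ℂ) : Prop :=
  AEStronglyMeasurable g volume ∧
    ∀ ψ : 𝓢(SpaceTime n, ℂ),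
      Integrable (fun η => ψ η * g ((2 * Real.pi) • η)) volume ∧
        (𝓕 T) ψ = ∫ η, ψ η * g ((2 * Real.pi) • η)

/-- The tempered distribution given by a square integrable function. -/
abbrev toDist {n : ℕ} (u : Lp ℂ 2 (volume : Measure (SpaceTime n))) : 𝓢'(SpaceTime n, ℂ) :=
  Lp.toTemperedDistributionCLM ℂ volume 2 u

/-- The Fourier transform `û` of a square integrable `u`, in the convention with the kernel
`exp(-i y·ζ)`. -/
def l2Fourier {n : ℕ} (u : Lp ℂ 2 (volume : Measure (SpaceTime n))) (ζ : SpaceTime n) : ℂ :=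
  (𝓕 u : Lp ℂ 2 (volume : Measure (SpaceTime n))) ((2 * Real.pi)⁻¹ • ζ)

/-- The parabolic Sobolev norm of order `a`,
`(∫ (1 + |iρ + |ξ|²|)^a |T̂(ρ, ξ)|² dρ dξ)^{1/2}`,
of a tempered distribution. It is `∞` if `T̂` is not a function. (The function `T̂` is unique up to
null sets, so that the infimum is taken over equal values.) -/
def hNorm {n : ℕ} (a : ℝ) (T : 𝓢'(SpaceTime n, ℂ)) : ℝ≥0∞ :=
  ⨅ (g : SpaceTime n → ℂ) (_ : IsFourierTransform T g),
    eLpNorm (fun ζ => (1 + ‖heatSymbol ζ‖) ^ (a / 2) • g ζ) 2 volume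

theorem IsFourierTransform.add {n : ℕ} {T S : 𝓢'(SpaceTime n, ℂ)} {g h : SpaceTime n → ℂ}
    (hT : IsFourierTransform T g) (hS : IsFourierTransform S h) :
    IsFourierTransform (T + S) (fun ζ => g ζ + h ζ) := by
  refine ⟨hT.1.add hS.1, fun ψ => ?_⟩
  obtain ⟨h1, e1⟩ := hT.2 ψ
  obtain ⟨h2, e2⟩ := hS.2 ψ
  simp only [mul_add]
  refine ⟨h1.add h2, ?_⟩
  rw [integral_add h1 h2, ← e1, ← e2, FourierTransform.fourier_add]
  rfl

theorem IsFourierTransform.smul {n : ℕ} {T : 𝓢'(SpaceTime n, ℂ)} {g : SpaceTime n → ℂ}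
    (c : ℂ) (hT : IsFourierTransform T g) :
    IsFourierTransform (c • T) (fun ζ => c * g ζ) := by
  refine ⟨hT.1.const_mul c, fun ψ => ?_⟩
  obtain ⟨h1, e1⟩ := hT.2 ψ
  simp only [mul_left_comm _ c]
  refine ⟨h1.const_mul c, ?_⟩
  rw [integral_const_mul, ← e1, FourierTransform.fourier_smul]
  rfl

theorem continuous_heatSymbol {n : ℕ} : Continuous (heatSymbol (n := n)) := by
  unfold heatSymbol
  fun_prop

theorem hNorm_lt_top {n : ℕ} {a : ℝ} {T : 𝓢'(SpaceTime n, ℂ)} :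
    hNorm a T < ⊤ ↔ ∃ g, IsFourierTransform T g ∧
      MemLp (fun ζ => (1 + ‖heatSymbol ζ‖) ^ (a / 2) • g ζ) 2 volume := by
  simp only [hNorm, iInf_lt_iff, exists_prop]
  refine exists_congr fun g => and_congr_right fun hg => ?_
  refine ⟨fun h => ⟨?_, h⟩, fun h => h.2⟩
  have hc : Measurable fun ζ : SpaceTime n => (1 + ‖heatSymbol ζ‖) ^ (a / 2) :=
    (measurable_const.add continuous_heatSymbol.norm.measurable).pow_const _
  exact hc.aestronglyMeasurable.smul hg.1

theorem isFourierTransform_zero {n : ℕ} :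
    IsFourierTransform (0 : 𝓢'(SpaceTime n, ℂ)) (fun _ => 0) := by
  refine ⟨aestronglyMeasurable_const, fun ψ => ?_⟩
  simp only [mul_zero, integral_zero]
  exact ⟨integrable_zero _ _ _, rfl⟩

/-- The parabolic Sobolev space `ℋ^a(ℝ^{n+1}) = {u ∈ L² : ‖u‖_{ℋ^a} < ∞}`. -/
def HSpace (n : ℕ) (a : ℝ) : Submodule ℂ (Lp ℂ 2 (volume : Measure (SpaceTime n))) where
  carrier := {u | hNorm a (toDist u) < ⊤}
  zero_mem' := by
    rw [mem_ofPred_eq, toDist, map_zero, hNorm_lt_top]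
    exact ⟨_, isFourierTransform_zero, by simp⟩
  add_mem' := by
    intro u v hu hv
    rw [mem_ofPred_eq, hNorm_lt_top] at hu hv ⊢
    obtain ⟨g, hg, hg'⟩ := hu
    obtain ⟨h, hh, hh'⟩ := hv
    rw [toDist, map_add]
    refine ⟨_, hg.add hh, ?_⟩
    simp only [smul_add]
    exact hg'.add hh'
  smul_mem' := by
    intro c u hu
    rw [mem_ofPred_eq, hNorm_lt_top] at hu ⊢
    obtain ⟨g, hg, hg'⟩ := hu
    rw [toDist, map_smul]
    refine ⟨_, hg.smul c, ?_⟩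
    convert hg'.const_mul c using 2 with ζ
    simp only [Complex.real_smul]
    ring

theorem norm_heatSymbol_cpow_le {n : ℕ} {s : ℝ} (hs : s ∈ Ioo (0 : ℝ) 1) (ζ : SpaceTime n) :
    ‖heatSymbol ζ ^ (s : ℂ)‖ ≤ 2 * (1 + ‖ζ‖ ^ 2) := by
  have h0 : ‖heatSymbol ζ‖ ≤ ‖ζ‖ + ‖ζ‖ ^ 2 := by
    refine (norm_add_le _ _).trans ?_
    have h1 : ‖Complex.I * (ζ 0 : ℂ)‖ ≤ ‖ζ‖ := by
      simpa using EuclideanSpace.norm_eq ζ ▸ PiLp.norm_apply_le ζ 0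
    have h2 : ‖((∑ j : Fin n, (ζ j.succ) ^ 2 : ℝ) : ℂ)‖ ≤ ‖ζ‖ ^ 2 := by
      rw [Complex.norm_real, Real.norm_of_nonneg (Finset.sum_nonneg fun j _ => sq_nonneg _),
        EuclideanSpace.real_norm_sq_eq, Fin.sum_univ_succ]
      nlinarith [sq_nonneg (ζ 0)]
    exact add_le_add h1 h2
  rw [Complex.norm_cpow_real]
  have h3 : ‖heatSymbol ζ‖ ^ s ≤ (1 + ‖heatSymbol ζ‖) ^ s :=
    Real.rpow_le_rpow (norm_nonneg _) (by linarith) hs.1.le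
  have h4 : (1 + ‖heatSymbol ζ‖) ^ s ≤ 1 + ‖heatSymbol ζ‖ := by
    simpa using Real.rpow_le_rpow_of_exponent_le
      (by linarith [norm_nonneg (heatSymbol ζ)] : 1 ≤ 1 + ‖heatSymbol ζ‖) hs.2.le
  nlinarith [sq_nonneg (‖ζ‖ - 1)]

theorem exists_fracHeat {n : ℕ} {s : ℝ} (hs : s ∈ Ioo (0 : ℝ) 1)
    (u : Lp ℂ 2 (volume : Measure (SpaceTime n))) :
    ∃ T : 𝓢'(SpaceTime n, ℂ),
      IsFourierTransform T (fun ζ => heatSymbol ζ ^ (s : ℂ) * l2Fourier u ζ) := by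
  set v : Lp ℂ 2 (volume : Measure (SpaceTime n)) := 𝓕 u
  set m : SpaceTime n → ℂ := fun η => heatSymbol ((2 * Real.pi) • η) ^ (s : ℂ)
  have hpi : (0 : ℝ) < 2 * Real.pi := by positivity
  have hm : Measurable m := by
    have h1 : Measurable fun η : SpaceTime n => heatSymbol ((2 * Real.pi) • η) :=
      (continuous_heatSymbol.comp (continuous_const_smul (2 * Real.pi))).measurable
    exact h1.pow_const _
  set q : SpaceTime n → ℂ := fun η => ((1 + ‖η‖ ^ 2 : ℝ) : ℂ)
  have hq0 : ∀ η, q η ≠ 0 := fun η => by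
    have : (1 + ‖η‖ ^ 2 : ℝ) ≠ 0 := by positivity
    exact Complex.ofReal_ne_zero.mpr this
  have hq : q.HasTemperateGrowth := by
    fun_prop
  have hqm : Measurable q := by
    fun_prop
  have hw : MemLp (fun η => m η / q η * v η) 2 volume := by
    refine MemLp.of_le_mul (c := 2 * (1 + (2 * Real.pi) ^ 2)) (Lp.memLp v)
      ((hm.div hqm).aestronglyMeasurable.mul (Lp.aestronglyMeasurable v))
      (Eventually.of_forall fun η => ?_)
    rw [norm_mul]
    refine mul_le_mul_of_nonneg_right ?_ (norm_nonneg _)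
    have h2 : ‖q η‖ = 1 + ‖η‖ ^ 2 := by
      rw [Complex.norm_real, Real.norm_of_nonneg (by positivity)]
    rw [norm_div, h2, div_le_iff₀ (by positivity)]
    refine (norm_heatSymbol_cpow_le hs _).trans ?_
    rw [norm_smul, Real.norm_of_nonneg hpi.le]
    nlinarith [sq_nonneg (2 * Real.pi), sq_nonneg ‖η‖]
  refine ⟨𝓕⁻ (TemperedDistribution.smulLeftCLM ℂ q (hw.toLp _ : 𝓢'(SpaceTime n, ℂ))), ?_, ?_⟩
  · refine AEStronglyMeasurable.mul ?_ ?_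
    · exact (continuous_heatSymbol.measurable.pow_const _).aestronglyMeasurable
    · refine (Lp.aestronglyMeasurable v).comp_quasiMeasurePreserving ?_
      refine ⟨measurable_const_smul _, ?_⟩
      rw [Measure.map_addHaar_smul _ (inv_ne_zero hpi.ne')]
      exact Measure.smul_absolutelyContinuous
  · intro ψ
    have key : ∀ η, ψ η * (heatSymbol ((2 * Real.pi) • η) ^ (s : ℂ)
        * l2Fourier u ((2 * Real.pi) • η))
        = (SchwartzMap.smulLeftCLM ℂ q ψ) η * (m η / q η * v η) := by
      intro η
      rw [SchwartzMap.smulLeftCLM_apply_apply hq, smul_eq_mul, l2Fourier, smul_smul,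
        inv_mul_cancel₀ hpi.ne', one_smul]
      have := hq0 η
      field_simp
      rfl
    simp only [key]
    constructor
    · exact MemLp.integrable_mul (p := 2) (q := 2) (SchwartzMap.memLp _ 2 volume) hw
    · rw [FourierTransform.fourier_fourierInv_eq, TemperedDistribution.smulLeftCLM_apply_apply,
        Lp.toTemperedDistribution_apply]
      refine integral_congr_ae ?_
      filter_upwards [hw.coeFn_toLp] with η hη
      rw [hη, smul_eq_mul]

/-- The fractional heat operator `ℒ^s = (∂_t - Δ)^s`, `0 < s < 1`, on `u ∈ L²(ℝ^{n+1})`: the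
tempered distribution whose Fourier transform is `(iρ + |ξ|²)^s û` (principal branch). -/
def fracHeat {n : ℕ} {s : ℝ} (hs : s ∈ Ioo (0 : ℝ) 1)
    (u : Lp ℂ 2 (volume : Measure (SpaceTime n))) : 𝓢'(SpaceTime n, ℂ) :=
  Classical.choose (exists_fracHeat hs u)

/-- The open set `ℝ × ℝ^{n+1}_+` of the points `((t, x'), x_{n+1})` with `x_{n+1} > 0`. -/
def halfSpace (n : ℕ) : Set (SpaceTime n × ℝ) := {p | 0 < p.2}

/-- The direction of `∂_t`. -/
def timeDir (n : ℕ) : SpaceTime n × ℝ := (EuclideanSpace.single 0 1, 0)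

/-- The directions of the space derivatives `∂_1, …, ∂_n, ∂_{n+1}`; the last one is normal to the
boundary. -/
def spaceDir (n : ℕ) : Fin (n + 1) → SpaceTime n × ℝ :=
  Fin.snoc (fun j : Fin n => (EuclideanSpace.single j.succ 1, 0)) (0, 1)

/-- Test functions: smooth with compact support in the open set `ℝ × ℝ^{n+1}_+`. -/
def IsTestFun {n : ℕ} (φ : SpaceTime n × ℝ → ℂ) : Prop :=
  ContDiff ℝ ∞ φ ∧ HasCompactSupport φ ∧ tsupport φ ⊆ halfSpace n

/-- `G` is the weak derivative of `F` in `ℝ × ℝ^{n+1}_+` in the direction `v`. -/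
def IsWeakDeriv {n : ℕ} (v : SpaceTime n × ℝ) (F G : SpaceTime n × ℝ → ℂ) : Prop :=
  LocallyIntegrableOn F (halfSpace n) ∧ LocallyIntegrableOn G (halfSpace n) ∧
    ∀ φ : SpaceTime n × ℝ → ℂ, IsTestFun φ →
      ∫ p in halfSpace n, F p * fderiv ℝ φ p v = -∫ p in halfSpace n, G p * φ p

/-- The function `x_{n+1}^{(1-2s)/2} F`. Thus `F ∈ L²(O, x_{n+1}^{1-2s})` means
`weighted s F ∈ L²(O)`, with the same norm. -/
def weighted {n : ℕ} {V : Type*} [SMul ℝ V] (s : ℝ) (F : SpaceTime n × ℝ → V) :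
    SpaceTime n × ℝ → V :=
  fun p => p.2 ^ ((1 - 2 * s) / 2) • F p

/-- `D = (D_1, …, D_{n+1})` is the weak space gradient `∇F = (∂_1 F, …, ∂_{n+1} F)` of `F`, and
it lies in `L²(ℝ × ℝ^{n+1}_+, x_{n+1}^{1-2s})`. -/
def IsWeightedGradient {n : ℕ} (s : ℝ) (F : SpaceTime n × ℝ → ℂ)
    (D : SpaceTime n × ℝ → EuclideanSpace ℂ (Fin (n + 1))) : Prop :=
  (∀ i, IsWeakDeriv (spaceDir n i) F (fun p => D p i)) ∧
    MemLp (weighted s D) 2 (volume.restrict (halfSpace n))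

theorem isOpen_halfSpace (n : ℕ) : IsOpen (halfSpace n) :=
  isOpen_lt continuous_const continuous_snd

theorem integrable_mul_test {n : ℕ} {F φ : SpaceTime n × ℝ → ℂ}
    (hF : LocallyIntegrableOn F (halfSpace n)) (hc : Continuous φ) (hφ : HasCompactSupport φ)
    (hs : tsupport φ ⊆ halfSpace n) :
    IntegrableOn (fun p => F p * φ p) (halfSpace n) := by
  have h1 : IntegrableOn F (tsupport φ) := hF.integrableOn_compact_subset hs hφ
  have h2 : IntegrableOn (fun p => F p * φ p) (tsupport φ) :=
    h1.mul_continuousOn hc.continuousOn hφ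
  refine IntegrableOn.of_forall_sdiff_eq_zero h2 (isOpen_halfSpace n).measurableSet ?_
  intro p hp
  rw [image_eq_zero_of_notMem_tsupport hp.2, mul_zero]

theorem IsTestFun.fderiv_apply {n : ℕ} {φ : SpaceTime n × ℝ → ℂ} (hφ : IsTestFun φ)
    (v : SpaceTime n × ℝ) :
    Continuous (fun p => fderiv ℝ φ p v) ∧ HasCompactSupport (fun p => fderiv ℝ φ p v) ∧
      tsupport (fun p => fderiv ℝ φ p v) ⊆ halfSpace n := by
  refine ⟨(hφ.1.continuous_fderiv (by simp)).clm_apply continuous_const,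
    hφ.2.1.fderiv_apply ℝ v, (tsupport_fderiv_apply_subset ℝ v).trans hφ.2.2⟩

theorem IsWeakDeriv.congr {n : ℕ} {v : SpaceTime n × ℝ} {F F' G : SpaceTime n × ℝ → ℂ}
    (h : IsWeakDeriv v F G) (hF : F' =ᵐ[volume.restrict (halfSpace n)] F) :
    IsWeakDeriv v F' G := by
  refine ⟨?_, h.2.1, fun φ hφ => ?_⟩
  · exact h.1.congr hF.symm
  · rw [← h.2.2 φ hφ]
    refine integral_congr_ae ?_
    filter_upwards [hF] with p hp
    rw [hp]

theorem IsWeakDeriv.add {n : ℕ} {v : SpaceTime n × ℝ} {F G F' G' : SpaceTime n × ℝ → ℂ}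
    (h : IsWeakDeriv v F G) (h' : IsWeakDeriv v F' G') :
    IsWeakDeriv v (F + F') (G + G') := by
  refine ⟨h.1.add h'.1, h.2.1.add h'.2.1, fun φ hφ => ?_⟩
  obtain ⟨c1, c2, c3⟩ := hφ.fderiv_apply v
  simp only [Pi.add_apply, add_mul]
  rw [integral_add (integrable_mul_test h.1 c1 c2 c3) (integrable_mul_test h'.1 c1 c2 c3),
    integral_add (integrable_mul_test h.2.1 hφ.1.continuous hφ.2.1 hφ.2.2)
      (integrable_mul_test h'.2.1 hφ.1.continuous hφ.2.1 hφ.2.2),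
    h.2.2 φ hφ, h'.2.2 φ hφ, neg_add]

theorem IsWeakDeriv.smul {n : ℕ} {v : SpaceTime n × ℝ} {F G : SpaceTime n × ℝ → ℂ}
    (c : ℂ) (h : IsWeakDeriv v F G) :
    IsWeakDeriv v (c • F) (c • G) := by
  refine ⟨h.1.smul c, h.2.1.smul c, fun φ hφ => ?_⟩
  simp only [Pi.smul_apply, smul_eq_mul, mul_assoc]
  rw [integral_const_mul, integral_const_mul, h.2.2 φ hφ, mul_neg]

/-- The space `𝒲(ℝ × ℝ^{n+1}_+)` of the `F ∈ L²_loc(ℝ × ℝ^{n+1}_+, x_{n+1}^{1-2s})` (functions up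
to null sets) whose weak derivatives `∂_1 F, …, ∂_{n+1} F` are in
`L²(ℝ × ℝ^{n+1}_+, x_{n+1}^{1-2s})`. -/
def WSpace (n : ℕ) (s : ℝ) :
    Submodule ℂ ((SpaceTime n × ℝ) →ₘ[volume.restrict (halfSpace n)] ℂ) where
  carrier := {F | (∀ K ⊆ halfSpace n, IsCompact K → MemLp (weighted s F) 2 (volume.restrict K)) ∧
    ∃ D, IsWeightedGradient s F D}
  zero_mem' := by
    have h0 : (((0 : (SpaceTime n × ℝ) →ₘ[volume.restrict (halfSpace n)] ℂ)) :
        SpaceTime n × ℝ → ℂ) =ᵐ[volume.restrict (halfSpace n)] 0 := AEEqFun.coeFn_zero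
    refine ⟨fun K hK _ => ?_, 0, fun i => ?_, ?_⟩
    · refine (memLp_congr_ae ?_).mpr (MemLp.zero (ε := ℂ))
      filter_upwards [ae_restrict_of_ae_restrict_of_subset hK h0] with p hp
      simp [weighted, hp]
    · refine IsWeakDeriv.congr ?_ h0
      exact ⟨locallyIntegrableOn_zero, locallyIntegrableOn_zero, fun φ _ => by simp⟩
    · have : weighted s (0 : SpaceTime n × ℝ → EuclideanSpace ℂ (Fin (n + 1))) = fun _ => 0 := by
        ext p
        simp [weighted]
      rw [this]
      exact MemLp.zero'
  add_mem' := by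
    rintro F F' ⟨hF, D, hD, hD'⟩ ⟨hG, D', hE, hE'⟩
    have h0 := AEEqFun.coeFn_add F F'
    refine ⟨fun K hK hc => ?_, D + D', fun i => ?_, ?_⟩
    · refine (memLp_congr_ae ?_).mpr ((hF K hK hc).add (hG K hK hc))
      filter_upwards [ae_restrict_of_ae_restrict_of_subset hK h0] with p hp
      simp [weighted, hp]
    · exact ((hD i).add (hE i)).congr h0
    · have e : weighted s (D + D') = weighted s D + weighted s D' := by
        funext p
        simp only [weighted, Pi.add_apply, smul_add]
      rw [e]
      exact hD'.add hE'
  smul_mem' := by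
    rintro c F ⟨hF, D, hD, hD'⟩
    have h0 := AEEqFun.coeFn_smul c F
    refine ⟨fun K hK hc => ?_, c • D, fun i => ?_, ?_⟩
    · refine (memLp_congr_ae ?_).mpr ((hF K hK hc).const_smul c)
      filter_upwards [ae_restrict_of_ae_restrict_of_subset hK h0] with p hp
      simp [weighted, hp]
      ring
    · exact ((hD i).smul c).congr h0
    · have e : weighted s (c • D) = c • weighted s D := by
        funext p
        simp only [weighted, Pi.smul_apply]
        exact smul_comm _ _ _
      rw [e]
      exact hD'.const_smul c

/-- `F` is a weak solution of `x_{n+1}^{1-2s} ∂_t F - ∇·(x_{n+1}^{1-2s} ∇F) = 0` in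
`ℝ × ℝ^{n+1}_+`, where `D = ∇F`. -/
def IsWeakSolution {n : ℕ} (s : ℝ) (F : SpaceTime n × ℝ → ℂ)
    (D : SpaceTime n × ℝ → EuclideanSpace ℂ (Fin (n + 1))) : Prop :=
  ∀ φ : SpaceTime n × ℝ → ℂ, IsTestFun φ →
    -(∫ p in halfSpace n, p.2 ^ (1 - 2 * s) • (F p * fderiv ℝ φ p (timeDir n)))
      + ∫ p in halfSpace n, p.2 ^ (1 - 2 * s) • ∑ i, D p i * fderiv ℝ φ p (spaceDir n i) = 0

/-- `G` is the family of slices `G x = F(·, x)`, `x > 0`, of `F`. For a function that is only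
defined up to null sets the slice at every single `x > 0` makes sense as the value of the version
of `F` that is continuous in `x > 0` with values in `L²(ℝ^{n+1})`. -/
def IsSliceFamily {n : ℕ} (F : SpaceTime n × ℝ → ℂ)
    (G : ℝ → Lp ℂ 2 (volume : Measure (SpaceTime n))) : Prop :=
  ContinuousOn G (Ioi 0) ∧
    ∀ᵐ x ∂(volume.restrict (Ioi (0 : ℝ))), G x =ᵐ[volume] fun y => F (y, x)

/-- The constant `d_s = 2 s Γ(-s) / (4^s Γ(s))`. -/
def extensionConst (s : ℝ) : ℝ := 2 * s * Real.Gamma (-s) / (4 ^ s * Real.Gamma s)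

end ParabolicExtension

end

/-!
Fourier transformation in `(t, x')` turns the equation into a family of ordinary differential
equations in `x = x_{n+1}`, one for each frequency: with `σ = (iρ + |ξ|²)^{1/2}` it becomes the
Bessel equation `(x^{1-2s} m')' = x^{1-2s} σ² m`. Its solution with `m(0) = 1` that decays at
infinity is
`m(x) = σ^s Γ(s)⁻¹ ∫₀^∞ exp(-σ (t + x²/(4t))) t^{s-1} dt` (`profile`), and the extension of `u` is
the function with partial Fourier transform `m(x) û`.

The integral `besselInt a σ x` converges because `σ` lies in the sector `|arg σ| ≤ π/4`, where
`‖σ‖ ≤ 2 Re σ`. Differentiation under the integral sign gives an integral of the same kind with `s`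
replaced by `1 - s` (after the substitution `t ↦ x²/(4t)`), so that the conormal derivative
`x^{1-2s} m'` is again explicit (`conormal`). Letting `x → 0`, with `∫₀^∞ exp(-σt) t^{a-1} dt =
σ^{-a} Γ(a)`, one reads off `m(x) → 1` and `x^{1-2s} m'(x) → d_s σ^{2s}`. By `t + x²/(4t) ≥ x` both
`m` and `|σ|^{-2s} x^{1-2s} m'` are bounded by multiples of `exp(-x|σ|/4)` (`norm_profile_le`,
`norm_conormal_le`).

All claims about the extension follow by Plancherel's theorem in `(t, x')`: the boundary limits by
dominated convergence (`tendsto_boundary`, `tendsto_conormal_boundary`), the energy bound from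
`∫₀^∞ x^{1-2s} (|ξ|² |m|² + |m'|²) dx ≤ C |σ|^{2s}` (`exists_lintegral_gradSymbol_le`), the bound in
strips from `|m| ≤ 4` (`exists_eLpNorm_strip_le`), and reality from the symmetry of `m` under
`(ρ, ξ) ↦ -(ρ, ξ)` (`IsVersion.im_eq_zero`).

To speak of functions on the half space, a continuous curve in `L²(ℝ^{n+1})` is given a jointly
measurable version (`exists_jointVersion`, `IsVersion`). Weak derivatives are computed on the
Fourier side with Parseval's formula, the normal one by an integration by parts in `x` at each
fixed frequency (`IsVersion.isWeakDeriv_tangential`, `IsVersion.isWeakDeriv_normal`), and the weak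
form of the equation is the Bessel equation together with `σ² = iρ + |ξ|²`
(`isWeakSolution_of_isVersion`).
-/

namespace ParabolicExtension

/-! ### A Bessel-type integral -/

section Bessel

/-- The Bessel-type integral `∫₀^∞ exp(-σ (t + x²/(4t))) t^{a-1} dt`. It equals
`2 (x/2)^a K_a(σx)`, with `K_a` the modified Bessel function of the second kind. -/
noncomputable def besselInt (a : ℝ) (σ : ℂ) (x : ℝ) : ℂ :=
  ∫ t in Ioi (0 : ℝ),
    Complex.exp (-(σ * ((t + x ^ 2 / (4 * t) : ℝ) : ℂ))) * ((t ^ (a - 1) : ℝ) : ℂ)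

theorem norm_besselInt_integrand (a : ℝ) (σ : ℂ) (x : ℝ) {t : ℝ} (ht : 0 < t) :
    ‖Complex.exp (-(σ * ((t + x ^ 2 / (4 * t) : ℝ) : ℂ))) * ((t ^ (a - 1) : ℝ) : ℂ)‖
      = Real.exp (-(σ.re * (t + x ^ 2 / (4 * t)))) * t ^ (a - 1) := by
  rw [norm_mul, Complex.norm_exp, Complex.norm_real, Real.norm_of_nonneg (by positivity),
    Complex.neg_re, Complex.re_mul_ofReal]

theorem integrableOn_exp_mul_rpow {a c : ℝ} (ha : 0 < a) (hc : 0 < c) :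
    IntegrableOn (fun t : ℝ => Real.exp (-(c * t)) * t ^ (a - 1)) (Ioi 0) := by
  have := integrableOn_rpow_mul_exp_neg_mul_rpow (p := 1) (s := a - 1) (by linarith) one_pos hc
  refine this.congr_fun (fun t _ => ?_) measurableSet_Ioi
  simp [mul_comm]

theorem measurable_besselInt_integrand (a : ℝ) :
    Measurable fun p : (ℂ × ℝ) × ℝ =>
      Complex.exp (-(p.1.1 * ((p.2 + p.1.2 ^ 2 / (4 * p.2) : ℝ) : ℂ))) *
        ((p.2 ^ (a - 1) : ℝ) : ℂ) := by
  fun_prop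

theorem measurable_besselInt (a : ℝ) : Measurable fun p : ℂ × ℝ => besselInt a p.1 p.2 :=
  ((measurable_besselInt_integrand a).stronglyMeasurable.integral_prod_right'
    (ν := volume.restrict (Ioi 0))).measurable

theorem aestronglyMeasurable_besselInt_integrand (a : ℝ) (σ : ℂ) (x : ℝ) (μ : Measure ℝ) :
    AEStronglyMeasurable (fun t : ℝ =>
      Complex.exp (-(σ * ((t + x ^ 2 / (4 * t) : ℝ) : ℂ))) * ((t ^ (a - 1) : ℝ) : ℂ)) μ :=
  ((measurable_besselInt_integrand a).comp (measurable_const.prodMk measurable_id :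
    Measurable fun t : ℝ => ((σ, x), t))).aestronglyMeasurable

theorem integrableOn_besselInt_integrand {a : ℝ} (ha : 0 < a) {σ : ℂ} (hσ : 0 < σ.re) (x : ℝ) :
    IntegrableOn (fun t : ℝ =>
      Complex.exp (-(σ * ((t + x ^ 2 / (4 * t) : ℝ) : ℂ))) * ((t ^ (a - 1) : ℝ) : ℂ)) (Ioi 0) := by
  refine Integrable.mono' (integrableOn_exp_mul_rpow ha hσ)
    (aestronglyMeasurable_besselInt_integrand _ _ _ _) ?_
  filter_upwards [self_mem_ae_restrict measurableSet_Ioi] with t ht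
  have ht : 0 < t := ht
  rw [norm_besselInt_integrand _ _ _ ht]
  gcongr
  have : 0 ≤ x ^ 2 / (4 * t) := by positivity
  linarith

/-- Substituting `t ↦ x² / (4t)`. -/
theorem besselInt_neg {a : ℝ} (σ : ℂ) {x : ℝ} (hx : 0 < x) :
    besselInt (-a) σ x = (((x / 2) ^ (-2 * a) : ℝ) : ℂ) * besselInt a σ x := by
  unfold besselInt
  have hx4 : 0 < x ^ 2 / 4 := by positivity
  rw [← integral_const_mul, ← integral_comp_rpow_Ioi _ (by norm_num : (-1 : ℝ) ≠ 0)]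
  have h := integral_comp_mul_left_Ioi
    (fun u : ℝ => (|(-1 : ℝ)| * u ^ ((-1 : ℝ) - 1)) •
      (Complex.exp (-(σ * ((u ^ (-1 : ℝ) + x ^ 2 / (4 * u ^ (-1 : ℝ)) : ℝ) : ℂ))) *
        (((u ^ (-1 : ℝ)) ^ (-a - 1) : ℝ) : ℂ))) 0 (b := (x ^ 2 / 4)⁻¹) (by positivity)
  rw [mul_zero, eq_comm, inv_smul_eq_iff₀ (by positivity)] at h
  rw [h, ← integral_smul]
  refine setIntegral_congr_fun measurableSet_Ioi fun t ht => ?_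
  have ht : 0 < t := ht
  have e1 : ((x ^ 2 / 4)⁻¹ * t) ^ (-1 : ℝ) = x ^ 2 / (4 * t) := by
    rw [Real.rpow_neg_one]; field_simp
  have e2 : x ^ 2 / (4 * (x ^ 2 / (4 * t))) = t := by field_simp
  simp only [e1, e2]
  have e3 : (x ^ 2 / 4)⁻¹ * ((|(-1 : ℝ)| * ((x ^ 2 / 4)⁻¹ * t) ^ ((-1 : ℝ) - 1)) *
      (x ^ 2 / (4 * t)) ^ (-a - 1)) = (x / 2) ^ (-2 * a) * t ^ (a - 1) := by
    have h4 : x ^ 2 / 4 = (x / 2) ^ (2 : ℝ) := by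
      rw [Real.rpow_two]; ring
    have h5 : x ^ 2 / (4 * t) = (x / 2) ^ (2 : ℝ) * t⁻¹ := by
      rw [Real.rpow_two]; field_simp; norm_num
    rw [h5, h4, abs_neg, abs_one, one_mul, Real.mul_rpow (by positivity) ht.le,
      Real.mul_rpow (by positivity) (by positivity), ← Real.rpow_neg_one t,
      ← Real.rpow_neg (by positivity), ← Real.rpow_mul (by positivity),
      ← Real.rpow_mul (by positivity), ← Real.rpow_mul (by positivity)]
    rw [show ∀ p q r u v : ℝ, p * ((q * r) * (u * v)) = (p * q * u) * (r * v) by intros; ring,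
      ← Real.rpow_add (by positivity), ← Real.rpow_add (by positivity),
      ← Real.rpow_add (by positivity)]
    congr 2 <;> ring
  rw [add_comm (x ^ 2 / (4 * t)) t]
  simp only [Complex.real_smul]
  have e4 := congrArg (fun r : ℝ => (r : ℂ)) e3
  simp only [Complex.ofReal_mul] at e4
  rw [Complex.ofReal_mul]
  linear_combination
    Complex.exp (-(σ * ((t + x ^ 2 / (4 * t) : ℝ) : ℂ))) * e4

/-- The derivative in `x`; the substitution `besselInt_neg` turns the index `a - 1` of the
differentiated integral into `1 - a > 0` when `a < 1`. -/
theorem hasDerivAt_besselInt {a : ℝ} (ha : 0 < a) {σ : ℂ} (hσ : 0 < σ.re) {x : ℝ} (hx : 0 < x) :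
    HasDerivAt (besselInt a σ)
      (-(σ * (((x / 2) ^ (2 * a - 1) : ℝ) : ℂ) * besselInt (1 - a) σ x)) x := by
  have key := (hasDerivAt_integral_of_dominated_loc_of_deriv_le (μ := volume.restrict (Ioi 0))
    (F := fun (y : ℝ) (t : ℝ) =>
      Complex.exp (-(σ * ((t + y ^ 2 / (4 * t) : ℝ) : ℂ))) * ((t ^ (a - 1) : ℝ) : ℂ))
    (F' := fun (y : ℝ) (t : ℝ) => -(σ * ((y / (2 * t) : ℝ) : ℂ)) *
      (Complex.exp (-(σ * ((t + y ^ 2 / (4 * t) : ℝ) : ℂ))) * ((t ^ (a - 1) : ℝ) : ℂ)))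
    (bound := fun t => ‖σ‖ * (16 / (σ.re * x)) * (Real.exp (-(σ.re * t)) * t ^ (a - 1)))
    (x₀ := x) (s := Ioo (x / 2) (2 * x)) (Ioo_mem_nhds (by linarith) (by linarith))
    (Eventually.of_forall fun y => aestronglyMeasurable_besselInt_integrand _ _ _ _)
    (integrableOn_besselInt_integrand ha hσ x) ?_ ?_
    ((integrableOn_exp_mul_rpow ha hσ).const_mul _) ?_).2
  · refine HasDerivAt.congr_deriv (f := besselInt a σ) key ?_
    have h1 : besselInt (1 - a) σ x
        = (((x / 2) ^ (2 - 2 * a) : ℝ) : ℂ) * besselInt (a - 1) σ x := by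
      rw [show 1 - a = -(a - 1) by ring, besselInt_neg σ hx]
      congr 3; ring
    have h2 : (x / 2) ^ (2 * a - 1) * (x / 2) ^ (2 - 2 * a) = x / 2 := by
      rw [← Real.rpow_add (by positivity)]
      ring_nf
      exact Real.rpow_one _
    rw [h1, show ∀ p q r u : ℂ, -(p * q * (r * u)) = -(p * (q * r)) * u by intros; ring,
      ← Complex.ofReal_mul, h2]
    unfold besselInt
    rw [← integral_const_mul]
    symm
    refine setIntegral_congr_fun measurableSet_Ioi fun t ht => ?_
    have ht : 0 < t := ht
    have h3 : t ^ (a - 1) = t * t ^ (a - 1 - 1) := by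
      rw [Real.rpow_sub_one ht.ne' (a - 1)]
      exact (mul_div_cancel₀ _ ht.ne').symm
    simp only [h3]
    have h4 : x / 2 = x / (2 * t) * t := by field_simp
    rw [h4]
    push_cast
    ring
  · refine AEStronglyMeasurable.mul ?_ (aestronglyMeasurable_besselInt_integrand _ _ _ _)
    have : Measurable fun t : ℝ => -(σ * ((x / (2 * t) : ℝ) : ℂ)) := by fun_prop
    exact this.aestronglyMeasurable
  · filter_upwards [self_mem_ae_restrict measurableSet_Ioi] with t ht y hy
    have ht : 0 < t := ht
    have hy0 : 0 < y := by linarith [hy.1]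
    -- the factor `1/t` of the derivative is absorbed by `exp(-Re σ y²/(4t))`
    have h5 : σ.re * (y ^ 2 / (4 * t)) * Real.exp (-(σ.re * (y ^ 2 / (4 * t)))) ≤ 1 := by
      have := Real.add_one_le_exp (σ.re * (y ^ 2 / (4 * t)))
      rw [Real.exp_neg, ← div_eq_mul_inv, div_le_one (Real.exp_pos _)]
      linarith
    have h6 : y / (2 * t) * Real.exp (-(σ.re * (y ^ 2 / (4 * t))))
        = 2 / (σ.re * y) *
          (σ.re * (y ^ 2 / (4 * t)) * Real.exp (-(σ.re * (y ^ 2 / (4 * t))))) := by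
      field_simp
      norm_num
    have h8 : y / (2 * t) * Real.exp (-(σ.re * (y ^ 2 / (4 * t)))) ≤ 16 / (σ.re * x) := by
      rw [h6]
      calc _ ≤ 2 / (σ.re * y) * 1 := by gcongr
        _ ≤ 16 / (σ.re * x) := by
          rw [mul_one, div_le_div_iff₀ (by positivity) (by positivity)]
          nlinarith [mul_pos hσ hx, mul_lt_mul_of_pos_left hy.1 hσ]
    rw [norm_mul, norm_besselInt_integrand _ _ _ ht, norm_neg, norm_mul, Complex.norm_real,
      Real.norm_of_nonneg (by positivity)]
    calc _ = ‖σ‖ * (y / (2 * t) * Real.exp (-(σ.re * (y ^ 2 / (4 * t))))) *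
          (Real.exp (-(σ.re * t)) * t ^ (a - 1)) := by
          rw [mul_add, neg_add, Real.exp_add]; ring
      _ ≤ _ := by gcongr
  · filter_upwards [self_mem_ae_restrict measurableSet_Ioi] with t ht y hy
    have ht : 0 < t := ht
    have h7 : HasDerivAt (fun y : ℝ => t + y ^ 2 / (4 * t)) (y / (2 * t)) y := by
      refine (((hasDerivAt_pow 2 y).div_const (4 * t)).const_add t).congr_deriv ?_
      field_simp; norm_num; ring
    have h9 : HasDerivAt (fun y : ℝ => -(σ * ((t + y ^ 2 / (4 * t) : ℝ) : ℂ)))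
        (-(σ * ((y / (2 * t) : ℝ) : ℂ))) y := (h7.ofReal_comp.const_mul σ).neg
    refine (h9.cexp.mul_const ((t ^ (a - 1) : ℝ) : ℂ)).congr_deriv ?_
    ring

/-- `∫₀^∞ exp(-σt) t^{a-1} dt = σ^{-a} Γ(a)` for complex `σ`, by analytic continuation from the
positive reals. -/
theorem besselInt_zero {a : ℝ} (ha : 0 < a) {σ : ℂ} (hσ : 0 < σ.re) :
    besselInt a σ 0 = σ ^ (-a : ℂ) * (Real.Gamma a : ℂ) := by
  have hopen : IsOpen {z : ℂ | 0 < z.re} := isOpen_lt continuous_const Complex.continuous_re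
  have hd1 : DifferentiableOn ℂ (fun z => besselInt a z 0) {z : ℂ | 0 < z.re} := by
    intro z hz
    have hz : 0 < z.re := hz
    refine DifferentiableAt.differentiableWithinAt ?_
    refine HasDerivAt.differentiableAt (f := fun z => besselInt a z 0)
      (hasDerivAt_integral_of_dominated_loc_of_deriv_le
      (μ := volume.restrict (Ioi (0 : ℝ)))
      (F := fun (w : ℂ) (t : ℝ) =>
        Complex.exp (-(w * ((t + (0 : ℝ) ^ 2 / (4 * t) : ℝ) : ℂ))) * ((t ^ (a - 1) : ℝ) : ℂ))
      (F' := fun (w : ℂ) (t : ℝ) => -(t : ℂ) *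
        (Complex.exp (-(w * ((t + 0 ^ 2 / (4 * t) : ℝ) : ℂ))) * ((t ^ (a - 1) : ℝ) : ℂ)))
      (bound := fun t => Real.exp (-(z.re / 2 * t)) * t ^ (a + 1 - 1))
      (s := {w : ℂ | z.re / 2 < w.re})
      ((isOpen_lt continuous_const Complex.continuous_re).mem_nhds
        (show z.re / 2 < z.re by linarith))
      (Eventually.of_forall fun y => aestronglyMeasurable_besselInt_integrand _ _ _ _)
      (integrableOn_besselInt_integrand ha hz 0) ?_ ?_
      (integrableOn_exp_mul_rpow (by linarith) (by linarith)) ?_).2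
    · refine AEStronglyMeasurable.mul ?_ (aestronglyMeasurable_besselInt_integrand _ _ _ _)
      have : Measurable fun t : ℝ => -(t : ℂ) := by fun_prop
      exact this.aestronglyMeasurable
    · filter_upwards [self_mem_ae_restrict measurableSet_Ioi] with t ht w hw
      have ht : 0 < t := ht
      have hw : z.re / 2 < w.re := hw
      rw [norm_mul, norm_besselInt_integrand _ _ _ ht, norm_neg, Complex.norm_real,
        Real.norm_of_nonneg ht.le]
      have e1 : t ^ (a + 1 - 1) = t * t ^ (a - 1) := by
        rw [Real.rpow_sub_one ht.ne', Real.rpow_sub_one ht.ne', Real.rpow_add_one ht.ne']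
        field_simp
      have e2 : t + 0 ^ 2 / (4 * t) = t := by simp
      rw [e1, mul_left_comm, e2]
      gcongr
    · filter_upwards [self_mem_ae_restrict measurableSet_Ioi] with t ht w hw
      convert! ((hasDerivAt_mul_const ((t + 0 ^ 2 / (4 * t) : ℝ) : ℂ)).neg.cexp.mul_const
        ((t ^ (a - 1) : ℝ) : ℂ)) using 1
      simp
      ring
  have hd2 : DifferentiableOn ℂ (fun z : ℂ => z ^ (-a : ℂ) * (Real.Gamma a : ℂ))
      {z : ℂ | 0 < z.re} := by
    intro z hz
    exact ((differentiableAt_id.cpow_const (Or.inl hz)).mul_const _).differentiableWithinAt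
  have hreal : ∀ r : ℝ, 0 < r → besselInt a r 0 = (r : ℂ) ^ (-a : ℂ) * (Real.Gamma a : ℂ) := by
    intro r hr
    have h := Real.integral_rpow_mul_exp_neg_mul_Ioi ha hr
    have e : (r : ℂ) ^ (-a : ℂ) * (Real.Gamma a : ℂ)
        = (((1 / r) ^ a * Real.Gamma a : ℝ) : ℂ) := by
      rw [one_div, ← Real.rpow_neg_eq_inv_rpow]
      push_cast [Complex.ofReal_cpow hr.le]
      rfl
    rw [e, ← h, ← integral_complex_ofReal]
    unfold besselInt
    refine setIntegral_congr_fun measurableSet_Ioi fun t ht => ?_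
    push_cast
    simp
    ring
  have hconn : IsPreconnected {z : ℂ | 0 < z.re} :=
    (convex_halfSpace_re_gt 0).isPreconnected
  refine (hd1.analyticOnNhd hopen).eqOn_of_preconnected_of_frequently_eq
    (hd2.analyticOnNhd hopen) hconn (z₀ := 1) (by simp) ?_ hσ
  -- the two sides agree at the points `1 + ε` with `ε > 0` real
  have ht : Tendsto (fun ε : ℝ => ((1 + ε : ℝ) : ℂ)) (𝓝[>] 0) (𝓝[≠] 1) := by
    refine tendsto_nhdsWithin_iff.mpr ⟨?_, ?_⟩
    · have : Continuous fun ε : ℝ => ((1 + ε : ℝ) : ℂ) := by fun_prop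
      simpa using (this.tendsto 0).mono_left nhdsWithin_le_nhds
    · filter_upwards [self_mem_nhdsWithin] with ε hε
      have hε : 0 < ε := hε
      simp only [mem_compl_iff, mem_singleton_iff]
      norm_cast
      linarith
  refine ht.frequently (Eventually.frequently ?_)
  filter_upwards [self_mem_nhdsWithin] with ε hε
  have hε : 0 < ε := hε
  exact hreal _ (by linarith)

theorem tendsto_besselInt {a : ℝ} (ha : 0 < a) {σ : ℂ} (hσ : 0 < σ.re) :
    Tendsto (besselInt a σ) (𝓝[>] 0) (𝓝 (σ ^ (-a : ℂ) * (Real.Gamma a : ℂ))) := by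
  rw [← besselInt_zero ha hσ]
  refine tendsto_integral_filter_of_dominated_convergence
    (fun t => Real.exp (-(σ.re * t)) * t ^ (a - 1))
    (Eventually.of_forall fun y => aestronglyMeasurable_besselInt_integrand _ _ _ _)
    (Eventually.of_forall fun y => ?_) (integrableOn_exp_mul_rpow ha hσ) ?_
  · filter_upwards [self_mem_ae_restrict measurableSet_Ioi] with t ht
    have ht : 0 < t := ht
    rw [norm_besselInt_integrand _ _ _ ht]
    gcongr
    have : 0 ≤ y ^ 2 / (4 * t) := by positivity
    linarith
  · refine Eventually.of_forall fun t => ?_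
    have : Continuous fun x : ℝ =>
        Complex.exp (-(σ * ((t + x ^ 2 / (4 * t) : ℝ) : ℂ))) * ((t ^ (a - 1) : ℝ) : ℂ) := by
      fun_prop
    exact (this.tendsto 0).mono_left nhdsWithin_le_nhds

/-- Exponential decay in the sector `‖σ‖ ≤ 2 Re σ`. -/
theorem norm_besselInt_le {a : ℝ} (ha : 0 < a) {σ : ℂ} (hσ : ‖σ‖ ≤ 2 * σ.re) (h0 : σ ≠ 0)
    (x : ℝ) :
    ‖besselInt a σ x‖ ≤ Real.exp (-(x * ‖σ‖ / 4)) * ((‖σ‖ / 4) ^ (-a) * Real.Gamma a) := by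
  have hr : 0 < ‖σ‖ := norm_pos_iff.mpr h0
  have h := Real.integral_rpow_mul_exp_neg_mul_Ioi ha (r := ‖σ‖ / 4) (by positivity)
  rw [one_div, ← Real.rpow_neg_eq_inv_rpow] at h
  rw [← h, ← integral_const_mul]
  refine norm_integral_le_of_norm_le ?_ ?_
  · refine ((integrableOn_exp_mul_rpow ha (c := ‖σ‖ / 4) (by positivity)).const_mul
      (Real.exp (-(x * ‖σ‖ / 4)))).congr ?_
    exact Eventually.of_forall fun t => by simp only []; ring
  · filter_upwards [self_mem_ae_restrict measurableSet_Ioi] with t ht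
    have ht : 0 < t := ht
    rw [norm_besselInt_integrand _ _ _ ht, mul_comm (t ^ (a - 1)), ← mul_assoc, ← Real.exp_add]
    refine mul_le_mul_of_nonneg_right (Real.exp_le_exp.mpr ?_) (by positivity)
    -- by the arithmetic-geometric mean inequality `t + x²/(4t) ≥ x`
    have h1 : x ≤ t + x ^ 2 / (4 * t) := by
      have : t + x ^ 2 / (4 * t) - x = (2 * t - x) ^ 2 / (4 * t) := by
        field_simp; ring
      have : 0 ≤ (2 * t - x) ^ 2 / (4 * t) := by positivity
      linarith
    have h2 : 0 ≤ x ^ 2 / (4 * t) := by positivity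
    have h3 : ‖σ‖ / 2 * (t + x ^ 2 / (4 * t)) ≤ σ.re * (t + x ^ 2 / (4 * t)) := by
      gcongr; linarith
    nlinarith [mul_le_mul_of_nonneg_left h1 hr.le, mul_le_mul_of_nonneg_left h2 hr.le]

theorem besselInt_conj (a : ℝ) (σ : ℂ) (x : ℝ) :
    besselInt a (starRingEnd ℂ σ) x = starRingEnd ℂ (besselInt a σ x) := by
  unfold besselInt
  rw [← integral_conj]
  refine integral_congr_ae (Eventually.of_forall fun t => ?_)
  simp only [map_mul, ← Complex.exp_conj, map_neg, Complex.conj_ofReal]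

end Bessel

/-! ### The decaying solution of the Bessel equation -/

section Profile

/-- The solution `m(x)` of the Bessel equation `(x^{1-2s} m')' = x^{1-2s} σ² m` on `(0, ∞)` that
decays at infinity and satisfies `m(0) = 1`. At `σ = 0`, where the integral diverges, the value
is `0`. -/
noncomputable def profile (s : ℝ) (σ : ℂ) (x : ℝ) : ℂ :=
  σ ^ (s : ℂ) / (Real.Gamma s : ℂ) * besselInt s σ x

/-- The conormal derivative `x^{1-2s} m'(x)` of `m = profile s σ`. -/
noncomputable def conormal (s : ℝ) (σ : ℂ) (x : ℝ) : ℂ :=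
  -((2 ^ (1 - 2 * s) / Real.Gamma s : ℝ) : ℂ) * σ ^ ((1 + s : ℝ) : ℂ) * besselInt (1 - s) σ x

theorem measurable_profile (s : ℝ) : Measurable fun p : ℂ × ℝ => profile s p.1 p.2 := by
  unfold profile
  exact ((measurable_fst.pow_const _).div_const _).mul (measurable_besselInt s)

theorem measurable_conormal (s : ℝ) : Measurable fun p : ℂ × ℝ => conormal s p.1 p.2 := by
  unfold conormal
  exact (measurable_const.mul (measurable_fst.pow_const _)).mul (measurable_besselInt (1 - s))

theorem profile_zero {s : ℝ} (hs : s ∈ Ioo (0 : ℝ) 1) (x : ℝ) : profile s 0 x = 0 := by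
  rw [profile, Complex.zero_cpow (Complex.ofReal_ne_zero.mpr hs.1.ne'), zero_div, zero_mul]

theorem conormal_zero {s : ℝ} (hs : s ∈ Ioo (0 : ℝ) 1) (x : ℝ) : conormal s 0 x = 0 := by
  rw [conormal, Complex.zero_cpow (Complex.ofReal_ne_zero.mpr (by linarith [hs.1])), mul_zero,
    zero_mul]

theorem re_pos_of_sector {σ : ℂ} (hσ : ‖σ‖ ≤ 2 * σ.re) (h0 : σ ≠ 0) : 0 < σ.re := by
  have := norm_pos_iff.mpr h0
  linarith

variable {s : ℝ} {σ : ℂ}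

theorem hasDerivAt_profile (hs : s ∈ Ioo (0 : ℝ) 1) (hσ : ‖σ‖ ≤ 2 * σ.re) {x : ℝ} (hx : 0 < x) :
    HasDerivAt (profile s σ) (((x ^ (2 * s - 1) : ℝ) : ℂ) * conormal s σ x) x := by
  rcases eq_or_ne σ 0 with rfl | h0
  · rw [conormal_zero hs, mul_zero]
    have : profile s 0 = fun _ => 0 := funext (profile_zero hs)
    rw [this]
    exact hasDerivAt_const _ _
  have hre := re_pos_of_sector hσ h0
  refine ((hasDerivAt_besselInt hs.1 hre hx).const_mul
    (σ ^ (s : ℂ) / (Real.Gamma s : ℂ))).congr_deriv ?_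
  have h1 : (x / 2) ^ (2 * s - 1) = x ^ (2 * s - 1) * 2 ^ (1 - 2 * s) := by
    rw [Real.div_rpow hx.le (by norm_num), div_eq_mul_inv, ← Real.rpow_neg (by norm_num)]
    congr 2; ring
  have h2 : σ ^ ((1 + s : ℝ) : ℂ) = σ * σ ^ (s : ℂ) := by
    push_cast
    rw [Complex.cpow_add _ _ h0, Complex.cpow_one]
  rw [conormal, h1, h2]
  push_cast
  ring

/-- Together with `hasDerivAt_profile` this is the Bessel equation. -/
theorem hasDerivAt_conormal (hs : s ∈ Ioo (0 : ℝ) 1) (hσ : ‖σ‖ ≤ 2 * σ.re) {x : ℝ} (hx : 0 < x) :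
    HasDerivAt (conormal s σ) (((x ^ (1 - 2 * s) : ℝ) : ℂ) * (σ ^ 2 * profile s σ x)) x := by
  rcases eq_or_ne σ 0 with rfl | h0
  · rw [profile_zero hs, mul_zero, mul_zero]
    have : conormal s 0 = fun _ => 0 := funext (conormal_zero hs)
    rw [this]
    exact hasDerivAt_const _ _
  have hre := re_pos_of_sector hσ h0
  refine ((hasDerivAt_besselInt (a := 1 - s) (by linarith [hs.2]) hre hx).const_mul
    (-((2 ^ (1 - 2 * s) / Real.Gamma s : ℝ) : ℂ) * σ ^ ((1 + s : ℝ) : ℂ))).congr_deriv ?_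
  have h1 : 2 ^ (1 - 2 * s) * (x / 2) ^ (2 * (1 - s) - 1) = x ^ (1 - 2 * s) := by
    rw [show 2 * (1 - s) - 1 = 1 - 2 * s by ring, ← Real.mul_rpow (by norm_num) (by positivity)]
    congr 1; ring
  have h1' : ((2 ^ (1 - 2 * s) : ℝ) : ℂ) * (((x / 2) ^ (2 * (1 - s) - 1) : ℝ) : ℂ)
      = ((x ^ (1 - 2 * s) : ℝ) : ℂ) := by
    rw [← h1, Complex.ofReal_mul]
  have h2 : σ ^ ((1 + s : ℝ) : ℂ) = σ * σ ^ (s : ℂ) := by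
    push_cast
    rw [Complex.cpow_add _ _ h0, Complex.cpow_one]
  rw [profile, h2, ← h1', sub_sub_cancel, Complex.ofReal_div]
  ring

theorem tendsto_profile (hs : s ∈ Ioo (0 : ℝ) 1) (hσ : ‖σ‖ ≤ 2 * σ.re) (h0 : σ ≠ 0) :
    Tendsto (profile s σ) (𝓝[>] 0) (𝓝 1) := by
  have h := (tendsto_besselInt hs.1 (re_pos_of_sector hσ h0)).const_mul
    (σ ^ (s : ℂ) / (Real.Gamma s : ℂ))
  have hG : (Real.Gamma s : ℂ) ≠ 0 := Complex.ofReal_ne_zero.mpr (Real.Gamma_pos_of_pos hs.1).ne'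
  have e : σ ^ (s : ℂ) / (Real.Gamma s : ℂ) * (σ ^ (-s : ℂ) * (Real.Gamma s : ℂ)) = 1 := by
    have : σ ^ (s : ℂ) * σ ^ (-s : ℂ) = 1 := by
      rw [← Complex.cpow_add _ _ h0, add_neg_cancel, Complex.cpow_zero]
    field_simp
    exact this
  rw [e] at h
  exact h

theorem extensionConst_eq (hs : s ∈ Ioo (0 : ℝ) 1) :
    extensionConst s = -(2 ^ (1 - 2 * s) * Real.Gamma (1 - s) / Real.Gamma s) := by
  have h1 : Real.Gamma (1 - s) = -s * Real.Gamma (-s) := by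
    rw [← Real.Gamma_add_one (neg_ne_zero.mpr hs.1.ne')]
    congr 1; ring
  have h2 : (2 : ℝ) ^ (1 - 2 * s) = 2 / 4 ^ s := by
    rw [Real.rpow_sub (by norm_num), Real.rpow_one, Real.rpow_mul (by norm_num)]
    norm_num
  have hG := (Real.Gamma_pos_of_pos hs.1).ne'
  have h4 : (4 : ℝ) ^ s ≠ 0 := by positivity
  rw [extensionConst, h1, h2]
  field_simp

/-- The limit of the conormal derivative, which gives the constant `d_s`. -/
theorem tendsto_conormal (hs : s ∈ Ioo (0 : ℝ) 1) (hσ : ‖σ‖ ≤ 2 * σ.re) (h0 : σ ≠ 0) :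
    Tendsto (conormal s σ) (𝓝[>] 0) (𝓝 (extensionConst s * σ ^ ((2 * s : ℝ) : ℂ))) := by
  have h := (tendsto_besselInt (a := 1 - s) (by linarith [hs.2])
    (re_pos_of_sector hσ h0)).const_mul
    (-((2 ^ (1 - 2 * s) / Real.Gamma s : ℝ) : ℂ) * σ ^ ((1 + s : ℝ) : ℂ))
  have e : σ ^ ((1 + s : ℝ) : ℂ) * σ ^ (-((1 - s : ℝ) : ℂ)) = σ ^ ((2 * s : ℝ) : ℂ) := by
    rw [← Complex.cpow_add _ _ h0]
    congr 1
    push_cast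
    ring
  rw [mul_assoc, ← mul_assoc (σ ^ ((1 + s : ℝ) : ℂ)), e] at h
  rw [extensionConst_eq hs]
  convert! h using 2
  push_cast
  ring

theorem norm_profile_le (hs : s ∈ Ioo (0 : ℝ) 1) (hσ : ‖σ‖ ≤ 2 * σ.re) (x : ℝ) :
    ‖profile s σ x‖ ≤ 4 * Real.exp (-(x * ‖σ‖ / 4)) := by
  rcases eq_or_ne σ 0 with rfl | h0
  · rw [profile_zero hs, norm_zero]; positivity
  have hr : 0 < ‖σ‖ := norm_pos_iff.mpr h0
  have hG := Real.Gamma_pos_of_pos hs.1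
  rw [profile, norm_mul, norm_div, Complex.norm_cpow_real, Complex.norm_real,
    Real.norm_of_nonneg hG.le]
  calc _ ≤ ‖σ‖ ^ s / Real.Gamma s *
        (Real.exp (-(x * ‖σ‖ / 4)) * ((‖σ‖ / 4) ^ (-s) * Real.Gamma s)) := by
        gcongr
        exact norm_besselInt_le hs.1 hσ h0 x
    _ = 4 ^ s * Real.exp (-(x * ‖σ‖ / 4)) := by
        rw [Real.rpow_neg (by positivity), Real.div_rpow (by positivity) (by norm_num)]
        field_simp
    _ ≤ _ := by
        gcongr
        simpa using Real.rpow_le_rpow_of_exponent_le (by norm_num : (1 : ℝ) ≤ 4) hs.2.le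

/-- The constant in the bound for the conormal derivative. -/
noncomputable def conormalConst (s : ℝ) : ℝ :=
  2 ^ (1 - 2 * s) / Real.Gamma s * (4 ^ (1 - s) * Real.Gamma (1 - s))

theorem conormalConst_pos (hs : s ∈ Ioo (0 : ℝ) 1) : 0 < conormalConst s := by
  have h1 := Real.Gamma_pos_of_pos hs.1
  have h2 := Real.Gamma_pos_of_pos (s := 1 - s) (by linarith [hs.2])
  unfold conormalConst
  positivity

theorem norm_conormal_le (hs : s ∈ Ioo (0 : ℝ) 1) (hσ : ‖σ‖ ≤ 2 * σ.re) (x : ℝ) :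
    ‖conormal s σ x‖ ≤ conormalConst s * ‖σ‖ ^ (2 * s) * Real.exp (-(x * ‖σ‖ / 4)) := by
  rcases eq_or_ne σ 0 with rfl | h0
  · rw [conormal_zero hs, norm_zero]
    have := (conormalConst_pos hs).le
    positivity
  have hr : 0 < ‖σ‖ := norm_pos_iff.mpr h0
  have hG := Real.Gamma_pos_of_pos hs.1
  rw [conormal, norm_mul, norm_mul, norm_neg, Complex.norm_cpow_real, Complex.norm_real,
    Real.norm_of_nonneg (by positivity)]
  calc _ ≤ 2 ^ (1 - 2 * s) / Real.Gamma s * ‖σ‖ ^ (1 + s) * (Real.exp (-(x * ‖σ‖ / 4)) *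
        ((‖σ‖ / 4) ^ (-(1 - s)) * Real.Gamma (1 - s))) := by
        gcongr
        exact norm_besselInt_le (by linarith [hs.2]) hσ h0 x
    _ = _ := by
        have e : ‖σ‖ ^ (2 * s) = ‖σ‖ ^ (1 + s) * ‖σ‖ ^ (-(1 - s)) := by
          rw [← Real.rpow_add hr]; congr 1; ring
        have e2 : (‖σ‖ / 4) ^ (-(1 - s)) = ‖σ‖ ^ (-(1 - s)) * 4 ^ (1 - s) := by
          rw [Real.div_rpow hr.le (by norm_num), Real.rpow_neg (x := 4) (by norm_num),
            div_inv_eq_mul]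
        rw [conormalConst, e, e2]
        ring

theorem arg_ne_pi_of_sector (hσ : ‖σ‖ ≤ 2 * σ.re) : σ.arg ≠ Real.pi := by
  rw [Ne, Complex.arg_eq_pi_iff]
  intro h
  have := norm_nonneg σ
  linarith [h.1]

theorem profile_conj (hσ : ‖σ‖ ≤ 2 * σ.re) (x : ℝ) :
    profile s (starRingEnd ℂ σ) x = starRingEnd ℂ (profile s σ x) := by
  rw [profile, profile, besselInt_conj, Complex.conj_cpow _ _ (arg_ne_pi_of_sector hσ)]
  simp

end Profile

/-! ### Jointly measurable versions of curves in `L²` -/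

section JointVersion

/-- A measurable curve in `L²` has a jointly measurable version. -/
theorem exists_jointVersion {α : Type*} [MeasurableSpace α] [MeasurableSpace.CountablyGenerated α]
    {μ : Measure α} [SigmaFinite μ] {G : ℝ → Lp ℂ 2 μ} (hG : StronglyMeasurable G) :
    ∃ F : α × ℝ → ℂ, Measurable F ∧ ∀ x, G x =ᵐ[μ] fun y => F (y, x) := by
  classical
  have : Fact ((2 : ℝ≥0∞) ≠ ⊤) := ⟨by norm_num⟩
  let d : ℕ → Lp ℂ 2 μ := TopologicalSpace.denseSeq _
  have hd : DenseRange d := TopologicalSpace.denseRange_denseSeq _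
  -- `d (k N x)` is a countably valued approximation of `G x`, with an error below `4^{-N}`
  have hex : ∀ (N : ℕ) (x : ℝ), ∃ k, ‖G x - d k‖ < (1 / 4 : ℝ) ^ N := fun N x => by
    obtain ⟨k, hk⟩ := hd.exists_dist_lt (G x) (show (0 : ℝ) < (1 / 4) ^ N by positivity)
    exact ⟨k, by rwa [← dist_eq_norm]⟩
  let k : ℕ → ℝ → ℕ := fun N x => Nat.find (hex N x)
  have hk : ∀ N x, ‖G x - d (k N x)‖ < (1 / 4 : ℝ) ^ N := fun N x => Nat.find_spec (hex N x)
  have hkm : ∀ N, Measurable (k N) := fun N => by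
    refine measurable_find (hex N) fun j => ?_
    exact measurableSet_lt (hG.sub stronglyMeasurable_const).norm.measurable measurable_const
  have hdm : ∀ j, StronglyMeasurable (d j) := fun j => Lp.stronglyMeasurable _
  let f : ℕ → α × ℝ → ℂ := fun N p => d (k N p.2) p.1
  have hf : ∀ N, Measurable (f N) := fun N => by
    have h1 : Measurable fun q : α × ℕ => d q.2 q.1 :=
      measurable_from_prod_countable_left fun j => (hdm j).measurable
    exact h1.comp (measurable_fst.prodMk ((hkm N).comp measurable_snd))
  have hlim : ∀ x, ∀ᵐ y ∂μ, Tendsto (fun N => f N (y, x)) atTop (𝓝 (G x y)) := by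
    intro x
    have hc : Tendsto (fun N => eLpNorm ((d (k N x) : α → ℂ) - (G x : α → ℂ)) 2 μ) atTop
        (𝓝 0) := by
      have h2 : ∀ N, eLpNorm ((d (k N x) : α → ℂ) - (G x : α → ℂ)) 2 μ
          ≤ ENNReal.ofReal ((1 / 4 : ℝ) ^ N) := by
        intro N
        rw [← eLpNorm_congr_ae (Lp.coeFn_sub _ _), ← Lp.enorm_def, ← ofReal_norm, norm_sub_rev]
        exact ENNReal.ofReal_le_ofReal (hk N x).le
      refine tendsto_of_tendsto_of_tendsto_of_le_of_le tendsto_const_nhds ?_ (fun _ => zero_le) h2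
      have := tendsto_pow_atTop_nhds_zero_of_lt_one (r := (1 / 4 : ℝ)) (by norm_num) (by norm_num)
      have h3 := (ENNReal.continuous_ofReal.tendsto 0).comp this
      rwa [ENNReal.ofReal_zero] at h3
    have hcau : ∀ N n m : ℕ, N ≤ n → N ≤ m →
        eLpNorm ((d (k n x) : α → ℂ) - (d (k m x) : α → ℂ)) 2 μ
          < ENNReal.ofReal (3 * (1 / 4 : ℝ) ^ N) := by
      intro N n m hn hm
      rw [← eLpNorm_congr_ae (Lp.coeFn_sub _ _), ← Lp.enorm_def, ← ofReal_norm]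
      refine (ENNReal.ofReal_lt_ofReal_iff (by positivity)).mpr ?_
      have e : d (k n x) - d (k m x) = (G x - d (k m x)) - (G x - d (k n x)) := by abel
      have hp : ∀ j, N ≤ j → (1 / 4 : ℝ) ^ j ≤ (1 / 4) ^ N := fun j hj =>
        pow_le_pow_of_le_one (by norm_num) (by norm_num) hj
      have hpos : (0 : ℝ) < (1 / 4) ^ N := by positivity
      rw [e]
      linarith [norm_sub_le (G x - d (k m x)) (G x - d (k n x)), hk n x, hk m x, hp n hn, hp m hm]
    have hsum : ∑' N : ℕ, ENNReal.ofReal (3 * (1 / 4 : ℝ) ^ N) ≠ ⊤ := by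
      have : Summable fun N : ℕ => 3 * (1 / 4 : ℝ) ^ N :=
        (summable_geometric_of_lt_one (by norm_num) (by norm_num)).mul_left 3
      rw [← ENNReal.ofReal_tsum_of_nonneg (fun N => by positivity) this]
      exact ENNReal.ofReal_ne_top
    have hae := Lp.ae_tendsto_of_cauchy_eLpNorm (f := fun N => (d (k N x) : α → ℂ))
      (fun N => (hdm _).aestronglyMeasurable) (by norm_num) hsum hcau
    -- the pointwise limit agrees with the limit in measure
    obtain ⟨ns, hns, hns'⟩ := (tendstoInMeasure_of_tendsto_eLpNorm (by norm_num)
      (fun N => (hdm _).aestronglyMeasurable) (Lp.aestronglyMeasurable _)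
      hc).exists_seq_tendsto_ae
    filter_upwards [hae, hns'] with y ⟨l, hl⟩ hy
    have := tendsto_nhds_unique (hl.comp hns.tendsto_atTop) hy
    rwa [this] at hl
  refine ⟨fun p => limUnder atTop fun N => f N p,
    (StronglyMeasurable.limUnder fun N => (hf N).stronglyMeasurable).measurable, fun x => ?_⟩
  filter_upwards [hlim x] with y hy
  exact hy.limUnder_eq.symm

end JointVersion

/-! ### Fourier transforms of square integrable functions -/

section FourierTransform

/-- The Hilbert space `L²(ℝ^{n+1})`. -/
abbrev L2 (n : ℕ) : Type := Lp ℂ 2 (volume : Measure (SpaceTime n))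

variable {n : ℕ}

/-- The inverse Fourier transform is symmetric for the bilinear pairing. -/
theorem integral_fourierInv_mul (f : L2 n) (ψ : 𝓢(SpaceTime n, ℂ)) :
    ∫ y, (𝓕⁻ f : L2 n) y * ψ y = ∫ η, f η * (𝓕⁻ ψ) η := by
  have h := DFunLike.congr_fun (Lp.fourierInv_toTemperedDistribution_eq f) ψ
  rw [TemperedDistribution.fourierInv_apply, Lp.toTemperedDistribution_apply,
    Lp.toTemperedDistribution_apply] at h
  simp only [smul_eq_mul] at h
  simp only [mul_comm _ (ψ _), mul_comm _ ((𝓕⁻ ψ) _)]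
  exact h.symm

/-- A function that is integrable against all Schwartz functions is locally integrable. -/
theorem locallyIntegrable_of_schwartz {f : SpaceTime n → ℂ}
    (hf : ∀ ψ : 𝓢(SpaceTime n, ℂ), Integrable (fun y => ψ y * f y)) : LocallyIntegrable f := by
  rw [locallyIntegrable_iff]
  intro K hK
  obtain ⟨R, hR, hKR⟩ := hK.isBounded.subset_closedBall_lt 0 (0 : SpaceTime n)
  let b : ContDiffBump (0 : SpaceTime n) := ⟨R, R + 1, hR, by linarith⟩
  have h1 : HasCompactSupport (Complex.ofRealCLM ∘ b) := b.hasCompactSupport.comp_left rfl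
  have h2 : ContDiff ℝ ∞ (Complex.ofRealCLM ∘ b) := Complex.ofRealCLM.contDiff.comp b.contDiff
  refine (hf (h1.toSchwartzMap h2)).integrableOn.congr_fun (fun y hy => ?_) hK.measurableSet
  simp [b.one_of_mem_closedBall (hKR hy)]

/-- Functions are determined almost everywhere by their integrals against Schwartz functions. -/
theorem ae_eq_of_schwartz {f g : SpaceTime n → ℂ}
    (hf : ∀ ψ : 𝓢(SpaceTime n, ℂ), Integrable (fun y => ψ y * f y))
    (hg : ∀ ψ : 𝓢(SpaceTime n, ℂ), Integrable (fun y => ψ y * g y))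
    (h : ∀ ψ : 𝓢(SpaceTime n, ℂ), ∫ y, ψ y * f y = ∫ y, ψ y * g y) : f =ᵐ[volume] g := by
  refine ae_eq_of_integral_contDiff_smul_eq (locallyIntegrable_of_schwartz hf)
    (locallyIntegrable_of_schwartz hg) fun φ hφ hc => ?_
  have h1 : HasCompactSupport (Complex.ofRealCLM ∘ φ) := hc.comp_left rfl
  have h2 : ContDiff ℝ ∞ (Complex.ofRealCLM ∘ φ) := by fun_prop
  simpa using h (h1.toSchwartzMap h2)

theorem two_pi_ne_zero : (2 * Real.pi : ℝ) ≠ 0 := by positivity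

theorem quasiMeasurePreserving_smul {c : ℝ} (hc : c ≠ 0) :
    Measure.QuasiMeasurePreserving (fun ζ : SpaceTime n => c • ζ) volume volume := by
  refine ⟨measurable_const_smul _, ?_⟩
  rw [Measure.map_addHaar_smul _ hc]
  exact Measure.smul_absolutelyContinuous

/-- The function representing the Fourier transform is unique almost everywhere. -/
theorem IsFourierTransform.ae_eq {T : 𝓢'(SpaceTime n, ℂ)} {g h : SpaceTime n → ℂ}
    (hg : IsFourierTransform T g) (hh : IsFourierTransform T h) : g =ᵐ[volume] h := by
  have h1 : (fun η => g ((2 * Real.pi) • η)) =ᵐ[volume] fun η => h ((2 * Real.pi) • η) :=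
    ae_eq_of_schwartz (fun ψ => (hg.2 ψ).1) (fun ψ => (hh.2 ψ).1)
      fun ψ => (hg.2 ψ).2.symm.trans (hh.2 ψ).2
  have h2 := (quasiMeasurePreserving_smul (n := n) (inv_ne_zero two_pi_ne_zero)).ae h1
  filter_upwards [h2] with ζ hζ
  rwa [smul_smul, mul_inv_cancel₀ two_pi_ne_zero, one_smul] at hζ

/-- Hence the infimum in `hNorm` is attained at every representative. -/
theorem hNorm_eq {a : ℝ} {T : 𝓢'(SpaceTime n, ℂ)} {g : SpaceTime n → ℂ}
    (hg : IsFourierTransform T g) :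
    hNorm a T = eLpNorm (fun ζ => (1 + ‖heatSymbol ζ‖) ^ (a / 2) • g ζ) 2 volume := by
  refine le_antisymm (iInf₂_le g hg) (le_iInf₂ fun h hh => le_of_eq (eLpNorm_congr_ae ?_))
  filter_upwards [hg.ae_eq hh] with ζ hζ
  rw [hζ]

theorem l2Fourier_two_pi (u : L2 n) (η : SpaceTime n) :
    l2Fourier u ((2 * Real.pi) • η) = (𝓕 u : L2 n) η := by
  rw [l2Fourier, smul_smul, inv_mul_cancel₀ two_pi_ne_zero, one_smul]

theorem isFourierTransform_toDist (u : L2 n) : IsFourierTransform (toDist u) (l2Fourier u) := by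
  refine ⟨?_, fun ψ => ?_⟩
  · exact (Lp.aestronglyMeasurable _).comp_quasiMeasurePreserving
      (quasiMeasurePreserving_smul (inv_ne_zero two_pi_ne_zero))
  · simp only [l2Fourier_two_pi]
    refine ⟨MemLp.integrable_mul (p := 2) (q := 2) (SchwartzMap.memLp _ 2 volume) (Lp.memLp _), ?_⟩
    rw [toDist, Lp.toTemperedDistributionCLM_apply, Lp.fourier_toTemperedDistribution_eq,
      Lp.toTemperedDistribution_apply]
    rfl

/-- The dilation by the factor `2π ≥ 1` does not increase `L²` norms. -/
theorem eLpNorm_comp_two_pi_smul (f : SpaceTime n → ℂ) (hf : AEStronglyMeasurable f volume) :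
    eLpNorm (fun η => f ((2 * Real.pi) • η)) 2 volume ≤ eLpNorm f 2 volume := by
  have hpi : (1 : ℝ) ≤ 2 * Real.pi := by linarith [Real.two_le_pi]
  have h1 : Measure.map (fun η : SpaceTime n => (2 * Real.pi) • η) volume ≤ volume := by
    rw [Measure.map_addHaar_smul _ two_pi_ne_zero]
    refine Measure.le_iff.mpr fun A _ => ?_
    rw [Measure.smul_apply, smul_eq_mul]
    refine mul_le_of_le_one_left' ?_
    rw [ENNReal.ofReal_le_one, abs_of_pos (by positivity)]
    exact inv_le_one_of_one_le₀ (one_le_pow₀ hpi)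
  refine le_trans (le_of_eq ?_) (eLpNorm_mono_measure f h1)
  exact (eLpNorm_map_measure (hf.mono_measure h1) (measurable_const_smul _).aemeasurable).symm

/-- The inverse Fourier transform intertwines `f ↦ conj f(-·)` with complex conjugation. -/
theorem fourierInv_ae_eq_conj {f g : L2 n} (h : ∀ᵐ η, g η = starRingEnd ℂ (f (-η))) :
    ∀ᵐ y, (𝓕⁻ g : L2 n) y = starRingEnd ℂ ((𝓕⁻ f : L2 n) y) := by
  have hloc : LocallyIntegrable (fun y => starRingEnd ℂ ((𝓕⁻ f : L2 n) y)) volume :=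
    (Lp.memLp (𝓕⁻ f : L2 n)).star.locallyIntegrable (by norm_num)
  refine ae_eq_of_integral_contDiff_smul_eq ((Lp.memLp (𝓕⁻ g : L2 n)).locallyIntegrable
    (by norm_num)) hloc fun φ hφ hc => ?_
  have h1 : HasCompactSupport (Complex.ofRealCLM ∘ φ) := hc.comp_left rfl
  have h2 : ContDiff ℝ ∞ (Complex.ofRealCLM ∘ φ) := by fun_prop
  set Ψ : 𝓢(SpaceTime n, ℂ) := h1.toSchwartzMap h2
  have hΨ : ∀ y, Ψ y = (φ y : ℂ) := fun y => rfl
  have hsymm : ∀ η, (𝓕⁻ Ψ) (-η) = starRingEnd ℂ ((𝓕⁻ Ψ) η) := by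
    intro η
    rw [SchwartzMap.fourierInv_coe, Real.fourierInv_eq', Real.fourierInv_eq', ← integral_conj]
    refine integral_congr_ae (Eventually.of_forall fun y => ?_)
    simp only [smul_eq_mul, map_mul, ← Complex.exp_conj, Complex.conj_ofReal, Complex.conj_I, hΨ,
      inner_neg_right]
    congr 2
    push_cast
    ring
  calc ∫ y, φ y • (𝓕⁻ g : L2 n) y = ∫ y, (𝓕⁻ g : L2 n) y * Ψ y := by
        refine integral_congr_ae (Eventually.of_forall fun y => ?_)
        simp only [hΨ, Complex.real_smul, mul_comm]
    _ = ∫ η, g η * (𝓕⁻ Ψ) η := integral_fourierInv_mul g Ψ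
    _ = ∫ η, starRingEnd ℂ (f (-η)) * (𝓕⁻ Ψ) η := by
        refine integral_congr_ae ?_
        filter_upwards [h] with η hη
        rw [hη]
    _ = ∫ η, starRingEnd ℂ (f η) * (𝓕⁻ Ψ) (-η) := by
        rw [← integral_neg_eq_self]
        simp only [neg_neg]
    _ = starRingEnd ℂ (∫ η, f η * (𝓕⁻ Ψ) η) := by
        rw [← integral_conj]
        simp only [hsymm, map_mul]
    _ = starRingEnd ℂ (∫ y, (𝓕⁻ f : L2 n) y * Ψ y) := by rw [integral_fourierInv_mul f Ψ]
    _ = _ := by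
        rw [← integral_conj]
        refine integral_congr_ae (Eventually.of_forall fun y => ?_)
        simp only [hΨ, Complex.real_smul, map_mul, Complex.conj_ofReal, mul_comm]

end FourierTransform

/-! ### Fourier multipliers depending on the normal variable -/

section Multipliers

variable {n : ℕ}

/-- A family `k(·, x)`, `x > 0`, of Fourier multipliers on `L²(ℝ^{n+1})`: measurable, continuous in
`x`, and bounded uniformly in the frequency for `x` in compact subsets of `(0, ∞)`. No bound is
asked for as `x → 0`. -/
structure IsSymbol (k : SpaceTime n → ℝ → ℂ) : Prop where
  measurable : Measurable fun p : SpaceTime n × ℝ => k p.1 p.2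
  continuousOn : ∀ η, ContinuousOn (k η) (Ioi 0)
  bounded : ∀ a b : ℝ, 0 < a → ∃ C, ∀ η, ∀ x ∈ Icc a b, ‖k η x‖ ≤ C

open Classical in
/-- The function `η ↦ k(η, x) v(η)` in `L²`; it is `0` where the product is not in `L²`. -/
noncomputable def freqSlice (k : SpaceTime n → ℝ → ℂ) (v : L2 n) (x : ℝ) : L2 n :=
  if h : MemLp (fun η => k η x * v η) 2 volume then h.toLp _ else 0

/-- The function with Fourier transform `k(·, x) v`, in the convention of Mathlib's `𝓕`. With
`v = 𝓕 u` this is the multiplier `k(·, x)` applied to `u`. -/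
noncomputable def evolve (k : SpaceTime n → ℝ → ℂ) (v : L2 n) (x : ℝ) : L2 n :=
  𝓕⁻ (freqSlice k v x)

theorem IsSymbol.measurable_slice {k : SpaceTime n → ℝ → ℂ} (hk : IsSymbol k) (x : ℝ) :
    Measurable fun η => k η x :=
  hk.measurable.comp (measurable_id.prodMk measurable_const)

theorem IsSymbol.memLp {k : SpaceTime n → ℝ → ℂ} (hk : IsSymbol k) (v : L2 n) {x : ℝ}
    (hx : 0 < x) : MemLp (fun η => k η x * v η) 2 volume := by
  obtain ⟨C, hC⟩ := hk.bounded x x hx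
  refine MemLp.of_le_mul (c := C) (Lp.memLp v)
    ((hk.measurable_slice x).aestronglyMeasurable.mul (Lp.aestronglyMeasurable v))
    (Eventually.of_forall fun η => ?_)
  rw [norm_mul]
  exact mul_le_mul_of_nonneg_right (hC η x ⟨le_rfl, le_rfl⟩) (norm_nonneg _)

theorem IsSymbol.coeFn_freqSlice {k : SpaceTime n → ℝ → ℂ} (hk : IsSymbol k) (v : L2 n) {x : ℝ}
    (hx : 0 < x) : freqSlice k v x =ᵐ[volume] fun η => k η x * v η := by
  rw [freqSlice, dif_pos (hk.memLp v hx)]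
  exact MemLp.coeFn_toLp _

theorem IsSymbol.enorm_evolve {k : SpaceTime n → ℝ → ℂ} (hk : IsSymbol k) (v : L2 n) {x : ℝ}
    (hx : 0 < x) : ‖evolve k v x‖ₑ = eLpNorm (fun η => k η x * v η) 2 volume := by
  rw [evolve, ← ofReal_norm]
  have : ‖(𝓕⁻ (freqSlice k v x) : L2 n)‖ = ‖freqSlice k v x‖ := by
    rw [← Lp.norm_fourier_eq, fourier_fourierInv_eq]
  rw [this, ofReal_norm, Lp.enorm_def, eLpNorm_congr_ae (hk.coeFn_freqSlice v hx)]

/-- Dominated convergence in `L²`. -/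
theorem tendsto_eLpNorm_two {α ι : Type*} [MeasurableSpace α] {μ : Measure α} {l : Filter ι}
    [l.IsCountablyGenerated] {f : ι → α → ℂ} {g : α → ℂ}
    (hf : ∀ᶠ i in l, AEStronglyMeasurable (f i) μ)
    (hg : MemLp g 2 μ) (hb : ∀ᶠ i in l, ∀ᵐ x ∂μ, ‖f i x‖ ≤ ‖g x‖)
    (hlim : ∀ᵐ x ∂μ, Tendsto (fun i => f i x) l (𝓝 0)) :
    Tendsto (fun i => eLpNorm (f i) 2 μ) l (𝓝 0) := by
  have h2 : ∀ h : α → ℂ, eLpNorm h 2 μ = (∫⁻ x, ‖h x‖ₑ ^ (2 : ℝ) ∂μ) ^ (1 / (2 : ℝ)) := fun h => by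
    rw [eLpNorm_eq_lintegral_rpow_enorm_toReal (by norm_num) (by norm_num)]
    norm_num
  simp only [h2]
  have h3 : Tendsto (fun i => ∫⁻ x, ‖f i x‖ₑ ^ (2 : ℝ) ∂μ) l (𝓝 (∫⁻ x, 0 ∂μ)) := by
    refine tendsto_lintegral_filter_of_dominated_convergence' (fun x => ‖g x‖ₑ ^ (2 : ℝ))
      ?_ ?_ ?_ ?_
    · filter_upwards [hf] with i hi using hi.enorm.pow_const _
    · filter_upwards [hb] with i hi
      filter_upwards [hi] with x hx
      gcongr
      exact enorm_le_iff_norm_le.mpr hx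
    · have := lintegral_rpow_enorm_lt_top_of_eLpNorm_lt_top (by norm_num) (by norm_num) hg.2
      simpa using this.ne
    · filter_upwards [hlim] with x hx
      have h4 := (ENNReal.continuous_rpow_const (y := 2)).tendsto 0 |>.comp
        (by simpa using hx.enorm)
      rw [ENNReal.zero_rpow_of_pos (by norm_num)] at h4
      exact h4
  rw [lintegral_zero] at h3
  have h5 := (ENNReal.continuous_rpow_const (y := 1 / 2)).tendsto 0 |>.comp h3
  rw [ENNReal.zero_rpow_of_pos (by norm_num)] at h5
  exact h5

theorem IsSymbol.evolve_sub {k : SpaceTime n → ℝ → ℂ} (hk : IsSymbol k) (v : L2 n) {x x' : ℝ}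
    (hx : 0 < x) (hx' : 0 < x') :
    ‖evolve k v x - evolve k v x'‖ₑ
      = eLpNorm (fun η => (k η x - k η x') * v η) 2 volume := by
  have e : evolve k v x - evolve k v x' = 𝓕⁻ (freqSlice k v x - freqSlice k v x') := by
    rw [evolve, evolve, sub_eq_add_neg, sub_eq_add_neg, FourierTransform.fourierInv_add,
      ← neg_one_smul ℂ (freqSlice k v x'), FourierTransform.fourierInv_smul, neg_one_smul]
  have : ‖(𝓕⁻ (freqSlice k v x - freqSlice k v x') : L2 n)‖
      = ‖freqSlice k v x - freqSlice k v x'‖ := by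
    rw [← Lp.norm_fourier_eq, fourier_fourierInv_eq]
  rw [e, ← ofReal_norm, this, ofReal_norm, Lp.enorm_def, eLpNorm_congr_ae (Lp.coeFn_sub _ _)]
  refine eLpNorm_congr_ae ?_
  filter_upwards [hk.coeFn_freqSlice v hx, hk.coeFn_freqSlice v hx'] with η h1 h2
  rw [Pi.sub_apply, h1, h2, sub_mul]

theorem IsSymbol.continuousOn_evolve {k : SpaceTime n → ℝ → ℂ} (hk : IsSymbol k) (v : L2 n) :
    ContinuousOn (evolve k v) (Ioi 0) := by
  intro x hx
  have hx : 0 < x := hx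
  refine ContinuousAt.continuousWithinAt ?_
  obtain ⟨C, hC⟩ := hk.bounded (x / 2) (2 * x) (by positivity)
  have hnhds : Ioo (x / 2) (2 * x) ∈ 𝓝 x := Ioo_mem_nhds (by linarith) (by linarith)
  rw [ContinuousAt, tendsto_iff_edist_tendsto_0]
  have h := tendsto_eLpNorm_two (μ := (volume : Measure (SpaceTime n))) (l := 𝓝 x)
    (f := fun x' η => (k η x' - k η x) * v η) (g := fun η => (2 * C) • v η) ?_
    ((Lp.memLp v).const_smul (2 * C)) ?_ ?_
  · refine h.congr' ?_
    filter_upwards [hnhds] with x' hx'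
    rw [edist_eq_enorm_sub, hk.evolve_sub v (by linarith [hx'.1]) hx]
  · refine Eventually.of_forall fun x' => ?_
    exact ((hk.measurable_slice x').sub (hk.measurable_slice x)).aestronglyMeasurable.mul
      (Lp.aestronglyMeasurable v)
  · filter_upwards [hnhds] with x' hx'
    refine Eventually.of_forall fun η => ?_
    have h1 := hC η x' ⟨hx'.1.le, hx'.2.le⟩
    have h2 := hC η x ⟨by linarith, by linarith⟩
    rw [norm_mul, norm_smul]
    refine mul_le_mul_of_nonneg_right ?_ (norm_nonneg _)
    refine (norm_sub_le _ _).trans ?_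
    refine le_trans ?_ (le_abs_self _)
    linarith
  · refine Eventually.of_forall fun η => ?_
    have h1 := ((hk.continuousOn η).continuousAt (Ioi_mem_nhds hx)).tendsto
    simpa using (h1.sub_const (k η x)).mul_const (v η)

end Multipliers

/-! ### Functions on the half space with a given partial Fourier transform -/

section Versions

variable {n : ℕ} {k k' : SpaceTime n → ℝ → ℂ} {v v' : L2 n} {F F' : SpaceTime n × ℝ → ℂ}

theorem eLpNorm_two_sq {α V : Type*} [MeasurableSpace α] [NormedAddCommGroup V] {μ : Measure α}
    (f : α → V) : eLpNorm f 2 μ ^ 2 = ∫⁻ x, ‖f x‖ₑ ^ 2 ∂μ := by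
  have h := eLpNorm_nnreal_pow_eq_lintegral (p := 2) (f := f) (μ := μ) (by norm_num)
  simpa only [NNReal.coe_ofNat, ENNReal.coe_ofNat, ENNReal.rpow_ofNat] using h

theorem halfSpace_eq_prod (n : ℕ) : halfSpace n = univ ×ˢ Ioi (0 : ℝ) := by
  ext p
  simp [halfSpace]

theorem volume_restrict_univ_prod (S : Set ℝ) :
    (volume : Measure (SpaceTime n × ℝ)).restrict (univ ×ˢ S)
      = (volume : Measure (SpaceTime n)).prod (volume.restrict S) := by
  rw [Measure.volume_eq_prod, ← Measure.prod_restrict, Measure.restrict_univ]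

theorem volume_restrict_halfSpace :
    (volume : Measure (SpaceTime n × ℝ)).restrict (halfSpace n)
      = (volume : Measure (SpaceTime n)).prod (volume.restrict (Ioi 0)) := by
  rw [halfSpace_eq_prod, volume_restrict_univ_prod]

/-- Functions on a product with almost everywhere equal slices are almost everywhere equal. -/
theorem ae_eq_of_ae_slice {ν : Measure ℝ} [SFinite ν]
    (hF : AEStronglyMeasurable F ((volume : Measure (SpaceTime n)).prod ν))
    (hF' : AEStronglyMeasurable F' ((volume : Measure (SpaceTime n)).prod ν))
    (h : ∀ᵐ x ∂ν, (fun y => F (y, x)) =ᵐ[volume] fun y => F' (y, x)) :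
    F =ᵐ[(volume : Measure (SpaceTime n)).prod ν] F' := by
  have h0 : ∫⁻ p, ‖(F - F') p‖ₑ ∂((volume : Measure (SpaceTime n)).prod ν) = 0 := by
    rw [lintegral_prod_symm _ (hF.sub hF').enorm]
    refine (lintegral_congr_ae (g := fun _ => 0) ?_).trans lintegral_zero
    filter_upwards [h] with x hx
    refine (lintegral_congr_ae (g := fun _ => 0) ?_).trans lintegral_zero
    filter_upwards [hx] with y hy
    simp [hy]
  rw [lintegral_eq_zero_iff' (hF.sub hF').enorm] at h0
  filter_upwards [h0] with p hp
  simpa [sub_eq_zero] using hp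

/-- `F` is a jointly measurable function on the half space whose slices `F(·, x)` are the functions
`evolve k v x`, that is, whose partial Fourier transform is `k(η, x) v(η)`. -/
structure IsVersion (k : SpaceTime n → ℝ → ℂ) (v : L2 n) (F : SpaceTime n × ℝ → ℂ) : Prop where
  aestronglyMeasurable : AEStronglyMeasurable F (volume.restrict (halfSpace n))
  slice : ∀ᵐ x ∂(volume.restrict (Ioi (0 : ℝ))), evolve k v x =ᵐ[volume] fun y => F (y, x)

theorem IsSymbol.exists_isVersion (hk : IsSymbol k) (v : L2 n) : ∃ F, IsVersion k v F := by
  have h : StronglyMeasurable ((Ioi (0 : ℝ)).indicator (evolve k v)) := by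
    have : Fact ((2 : ℝ≥0∞) ≠ ⊤) := ⟨by norm_num⟩
    borelize (L2 n)
    classical
    refine Measurable.stronglyMeasurable ?_
    rw [← piecewise_eq_indicator]
    exact (hk.continuousOn_evolve v).measurable_piecewise continuousOn_const measurableSet_Ioi
  obtain ⟨F, hF, hs⟩ := exists_jointVersion h
  refine ⟨F, hF.aestronglyMeasurable, ?_⟩
  filter_upwards [self_mem_ae_restrict measurableSet_Ioi] with x hx
  have := hs x
  rwa [indicator_of_mem hx] at this

theorem IsVersion.ae_eq (hF : IsVersion k v F) (hF' : IsVersion k v F') :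
    F =ᵐ[volume.restrict (halfSpace n)] F' := by
  have h1 := hF.1
  have h2 := hF'.1
  rw [volume_restrict_halfSpace] at h1 h2 ⊢
  refine ae_eq_of_ae_slice h1 h2 ?_
  filter_upwards [hF.2, hF'.2] with x hx hx'
  exact hx.symm.trans hx'

theorem IsVersion.congr (hF : IsVersion k v F) (h : F' =ᵐ[volume.restrict (halfSpace n)] F) :
    IsVersion k v F' := by
  refine ⟨hF.1.congr h.symm, ?_⟩
  rw [volume_restrict_halfSpace] at h
  have h' := Measure.ae_ae_of_ae_prod
    ((Measure.measurePreserving_swap (μ := volume.restrict (Ioi (0 : ℝ)))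
      (ν := (volume : Measure (SpaceTime n)))).quasiMeasurePreserving.ae h)
  filter_upwards [hF.2, h'] with x hx hx'
  filter_upwards [hx, hx'] with y hy hy'
  rw [hy]
  exact hy'.symm

theorem IsSymbol.evolve_add_smul (hk : IsSymbol k) {x : ℝ} (hx : 0 < x) (c : ℂ) (v v' : L2 n) :
    evolve k (v + c • v') x = evolve k v x + c • evolve k v' x := by
  rw [evolve, evolve, evolve, ← FourierTransform.fourierInv_smul,
    ← FourierTransform.fourierInv_add]
  congr 1
  refine Lp.ext ?_
  filter_upwards [hk.coeFn_freqSlice v hx, hk.coeFn_freqSlice v' hx,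
    hk.coeFn_freqSlice (v + c • v') hx, Lp.coeFn_add v (c • v'), Lp.coeFn_smul c v',
    Lp.coeFn_add (freqSlice k v x) (c • freqSlice k v' x), Lp.coeFn_smul c (freqSlice k v' x)]
    with η h1 h2 h3 h4 h5 h6 h7
  rw [h6, Pi.add_apply, h7, Pi.smul_apply, h1, h2, h3, h4, Pi.add_apply, h5, Pi.smul_apply,
    smul_eq_mul, smul_eq_mul]
  ring

theorem IsVersion.add_smul (hk : IsSymbol k) (hF : IsVersion k v F) (hF' : IsVersion k v' F')
    (c : ℂ) : IsVersion k (v + c • v') (F + c • F') := by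
  refine ⟨hF.1.add (hF'.1.const_smul c), ?_⟩
  filter_upwards [hF.2, hF'.2, self_mem_ae_restrict measurableSet_Ioi] with x h1 h2 hx
  rw [hk.evolve_add_smul hx]
  filter_upwards [h1, h2, Lp.coeFn_add (evolve k v x) (c • evolve k v' x),
    Lp.coeFn_smul c (evolve k v' x)] with y h1 h2 h3 h4
  rw [h3, Pi.add_apply, h4, Pi.smul_apply, h1, h2, Pi.add_apply, Pi.smul_apply]

/-- Multiplication by a function of `x` acts on symbols and on their versions alike. -/
theorem IsVersion.mul_left (hk : IsSymbol k) (hk' : IsSymbol k') (hF : IsVersion k v F)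
    {c : ℝ → ℝ} (hc : Measurable c) (h : ∀ x, 0 < x → ∀ η, k' η x = (c x : ℂ) * k η x) :
    IsVersion k' v (fun p => c p.2 • F p) := by
  refine ⟨(hc.comp measurable_snd).aestronglyMeasurable.smul hF.1, ?_⟩
  filter_upwards [hF.2, self_mem_ae_restrict measurableSet_Ioi] with x h1 hx
  have h2 : evolve k' v x = (c x : ℂ) • evolve k v x := by
    rw [evolve, evolve, ← FourierTransform.fourierInv_smul]
    congr 1
    refine Lp.ext ?_
    filter_upwards [hk.coeFn_freqSlice v hx, hk'.coeFn_freqSlice v hx,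
      Lp.coeFn_smul (c x : ℂ) (freqSlice k v x)] with η h1 h2 h3
    rw [h2, h3, Pi.smul_apply, h1, h x hx, smul_eq_mul, mul_assoc]
  rw [h2]
  filter_upwards [h1, Lp.coeFn_smul (c x : ℂ) (evolve k v x)] with y h1 h3
  rw [h3, Pi.smul_apply, h1, smul_eq_mul, Complex.real_smul]

/-- Plancherel's formula in the tangential variables. -/
theorem IsVersion.lintegral_enorm_sq (hk : IsSymbol k) (hF : IsVersion k v F) {S : Set ℝ}
    (hS : S ⊆ Ioi 0) :
    ∫⁻ p in univ ×ˢ S, ‖F p‖ₑ ^ 2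
      = ∫⁻ x in S, ∫⁻ η, ‖k η x‖ₑ ^ 2 * ‖v η‖ₑ ^ 2 := by
  have hm : AEStronglyMeasurable F (volume.restrict ((univ : Set (SpaceTime n)) ×ˢ S)) := by
    refine hF.1.mono_measure (Measure.restrict_mono ?_ le_rfl)
    rw [halfSpace_eq_prod]
    exact prod_mono_right hS
  rw [volume_restrict_univ_prod] at hm ⊢
  rw [lintegral_prod_symm _ (hm.enorm.pow_const 2)]
  refine lintegral_congr_ae ?_
  have hpos : ∀ᵐ x ∂(volume.restrict S), x ∈ Ioi (0 : ℝ) :=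
    ae_restrict_of_ae_restrict_of_subset hS (self_mem_ae_restrict measurableSet_Ioi)
  filter_upwards [ae_restrict_of_ae_restrict_of_subset hS hF.2, hpos] with x hx hx0
  rw [← eLpNorm_two_sq, ← eLpNorm_congr_ae hx, ← Lp.enorm_def, hk.enorm_evolve v hx0,
    eLpNorm_two_sq]
  simp only [enorm_mul, mul_pow]

theorem IsVersion.memLp_Icc (hk : IsSymbol k) (hF : IsVersion k v F) {a b : ℝ} (ha : 0 < a) :
    MemLp F 2 (volume.restrict ((univ : Set (SpaceTime n)) ×ˢ Icc a b)) := by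
  have hS : Icc a b ⊆ Ioi 0 := fun x hx => ha.trans_le hx.1
  have hm : AEStronglyMeasurable F (volume.restrict ((univ : Set (SpaceTime n)) ×ˢ Icc a b)) := by
    refine hF.1.mono_measure (Measure.restrict_mono ?_ le_rfl)
    rw [halfSpace_eq_prod]
    exact prod_mono_right hS
  refine ⟨hm, ?_⟩
  have : eLpNorm F 2 (volume.restrict ((univ : Set (SpaceTime n)) ×ˢ Icc a b)) ^ 2 < ⊤ := by
    rw [eLpNorm_two_sq, hF.lintegral_enorm_sq hk hS]
    obtain ⟨C, hC⟩ := hk.bounded a b ha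
    calc _ ≤ ∫⁻ x in Icc a b, ∫⁻ η, ENNReal.ofReal C ^ 2 * ‖v η‖ₑ ^ 2 := by
          refine setLIntegral_mono_ae' measurableSet_Icc (Eventually.of_forall fun x hx => ?_)
          refine lintegral_mono fun η => ?_
          gcongr
          rw [← ofReal_norm]
          exact ENNReal.ofReal_le_ofReal (hC η x hx)
      _ < ⊤ := by
          rw [lintegral_const_mul' _ _ (by finiteness), ← eLpNorm_two_sq, setLIntegral_const]
          have := (Lp.memLp v).2
          simp only [Real.volume_Icc]
          finiteness
  exact (ENNReal.pow_lt_top_iff.mp this).resolve_right (by norm_num)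

theorem exists_subset_slab {K : Set (SpaceTime n × ℝ)} (hK : IsCompact K) (hs : K ⊆ halfSpace n) :
    ∃ a b, 0 < a ∧ a < b ∧ K ⊆ univ ×ˢ Ioo a b := by
  have hK2 : IsCompact (Prod.snd '' K) := hK.image continuous_snd
  rcases K.eq_empty_or_nonempty with rfl | hne
  · exact ⟨1, 2, by norm_num, by norm_num, empty_subset _⟩
  obtain ⟨a, haK, ha⟩ := hK2.exists_isLeast (hne.image _)
  obtain ⟨b, hbK, hb⟩ := hK2.exists_isGreatest (hne.image _)
  have ha0 : 0 < a := by
    obtain ⟨p, hp, rfl⟩ := haK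
    exact hs hp
  refine ⟨a / 2, b + 1, by positivity, by linarith [ha hbK], fun p hp => ⟨mem_univ _, ?_⟩⟩
  have h1 := ha (mem_image_of_mem _ hp)
  have h2 := hb (mem_image_of_mem _ hp)
  exact ⟨by linarith, by linarith⟩

theorem IsVersion.memLp_compact (hk : IsSymbol k) (hF : IsVersion k v F)
    {K : Set (SpaceTime n × ℝ)} (hK : IsCompact K) (hs : K ⊆ halfSpace n) :
    MemLp F 2 (volume.restrict K) := by
  obtain ⟨a, b, ha, -, hab⟩ := exists_subset_slab hK hs
  exact (hF.memLp_Icc hk ha).mono_measure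
    (Measure.restrict_mono (hab.trans (prod_mono_right Ioo_subset_Icc_self)) le_rfl)

theorem IsVersion.locallyIntegrableOn (hk : IsSymbol k) (hF : IsVersion k v F) :
    LocallyIntegrableOn F (halfSpace n) := by
  rw [locallyIntegrableOn_iff (isOpen_halfSpace n).isLocallyClosed]
  intro K hs hK
  have : IsFiniteMeasure (volume.restrict K) := ⟨by
    rw [Measure.restrict_apply_univ]; exact hK.measure_lt_top⟩
  exact (hF.memLp_compact hk hK hs).integrable (by norm_num)

end Versions

/-! ### Weak derivatives through the partial Fourier transform -/

section WeakDerivatives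

variable {n : ℕ} {k k' : SpaceTime n → ℝ → ℂ} {v : L2 n} {F G : SpaceTime n × ℝ → ℂ}
  {φ : SpaceTime n × ℝ → ℂ}

theorem IsTestFun.fderiv (hφ : IsTestFun φ) (w : SpaceTime n × ℝ) :
    IsTestFun fun p => fderiv ℝ φ p w := by
  refine ⟨?_, (hφ.fderiv_apply w).2.1, (hφ.fderiv_apply w).2.2⟩
  exact (hφ.1.fderiv_right (m := ∞) (by simp)).clm_apply contDiff_const

theorem IsTestFun.hasCompactSupport_slice (hφ : IsTestFun φ) (x : ℝ) :
    HasCompactSupport fun y => φ (y, x) := by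
  refine HasCompactSupport.intro (hφ.2.1.image continuous_fst) fun y hy => ?_
  by_contra h
  exact hy ⟨(y, x), subset_tsupport _ h, rfl⟩

/-- The slice `φ(·, x)` of a test function. -/
noncomputable def IsTestFun.slice (hφ : IsTestFun φ) (x : ℝ) : 𝓢(SpaceTime n, ℂ) :=
  (hφ.hasCompactSupport_slice x).toSchwartzMap
    (hφ.1.comp (contDiff_id.prodMk contDiff_const))

theorem IsTestFun.slice_apply (hφ : IsTestFun φ) (x : ℝ) (y : SpaceTime n) :
    hφ.slice x y = φ (y, x) := rfl

/-- The support of a test function lies in a slab `a < x < b` with `a > 0`. -/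
theorem IsTestFun.exists_slab (hφ : IsTestFun φ) :
    ∃ a b, 0 < a ∧ a < b ∧ ∀ x ∉ Ioo a b, ∀ y, (y, x) ∉ tsupport φ := by
  obtain ⟨a, b, ha, hab, h⟩ := exists_subset_slab hφ.2.1 hφ.2.2
  exact ⟨a, b, ha, hab, fun x hx y h0 => hx (h h0).2⟩

/-- The partial inverse Fourier transform `∫ exp(2πi y·η) φ(y, x) dy` of a test function. -/
noncomputable def IsTestFun.partialFourier (hφ : IsTestFun φ) (p : SpaceTime n × ℝ) : ℂ :=
  (𝓕⁻ (hφ.slice p.2)) p.1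

theorem IsTestFun.partialFourier_eq (hφ : IsTestFun φ) (η : SpaceTime n) (x : ℝ) :
    hφ.partialFourier (η, x)
      = ∫ y, Complex.exp (((2 * Real.pi * inner ℝ y η : ℝ) : ℂ) * Complex.I) * φ (y, x) := by
  rw [partialFourier, SchwartzMap.fourierInv_coe, Real.fourierInv_eq']
  rfl

theorem IsTestFun.measurable_partialFourier (hφ : IsTestFun φ) : Measurable hφ.partialFourier := by
  have h : Continuous fun q : (SpaceTime n × ℝ) × SpaceTime n =>
      Complex.exp (((2 * Real.pi * inner ℝ q.2 q.1.1 : ℝ) : ℂ) * Complex.I) * φ (q.2, q.1.2) := by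
    have := hφ.1.continuous
    fun_prop
  have e : hφ.partialFourier = fun p => ∫ y,
      Complex.exp (((2 * Real.pi * inner ℝ y p.1 : ℝ) : ℂ) * Complex.I) * φ (y, p.2) :=
    funext fun p => hφ.partialFourier_eq p.1 p.2
  rw [e]
  exact h.stronglyMeasurable.integral_prod_right'.measurable

theorem IsTestFun.partialFourier_eq_zero (hφ : IsTestFun φ) {x : ℝ} (h : ∀ y, (y, x) ∉ tsupport φ)
    (η : SpaceTime n) : hφ.partialFourier (η, x) = 0 := by
  simp [hφ.partialFourier_eq, fun y => image_eq_zero_of_notMem_tsupport (h y)]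

theorem IsTestFun.integrable_slice_bound (hφ : IsTestFun φ) :
    ∃ B : SpaceTime n → ℝ, Integrable B ∧ ∀ y x, ‖φ (y, x)‖ ≤ B y := by
  obtain ⟨C, hC⟩ := hφ.1.continuous.bounded_above_of_compact_support hφ.2.1
  have hK : IsCompact (Prod.fst '' tsupport φ) := hφ.2.1.image continuous_fst
  refine ⟨(Prod.fst '' tsupport φ).indicator fun _ => C, ?_, fun y x => ?_⟩
  · rw [integrable_indicator_iff hK.measurableSet]
    exact integrableOn_const hK.measure_lt_top.ne
  · by_cases h : y ∈ Prod.fst '' tsupport φ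
    · rw [indicator_of_mem h]
      exact hC _
    · rw [indicator_of_notMem h]
      have : φ (y, x) = 0 := by
        by_contra h0
        exact h ⟨(y, x), subset_tsupport _ h0, rfl⟩
      rw [this, norm_zero]

theorem IsTestFun.hasDerivAt_partialFourier (hφ : IsTestFun φ) (η : SpaceTime n) (x : ℝ) :
    HasDerivAt (fun x => hφ.partialFourier (η, x))
      ((hφ.fderiv (0, 1)).partialFourier (η, x)) x := by
  obtain ⟨B, hB, hB'⟩ := (hφ.fderiv (0, 1)).integrable_slice_bound
  obtain ⟨B₀, hB₀, hB₀'⟩ := hφ.integrable_slice_bound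
  have hcont : Continuous φ := hφ.1.continuous
  have hcont' : Continuous fun p => _root_.fderiv ℝ φ p (0, 1) := (hφ.fderiv (0, 1)).1.continuous
  have hn : ∀ y : SpaceTime n,
      ‖Complex.exp (((2 * Real.pi * inner ℝ y η : ℝ) : ℂ) * Complex.I)‖ = 1 := fun y =>
    Complex.norm_exp_ofReal_mul_I _
  have key := (hasDerivAt_integral_of_dominated_loc_of_deriv_le
    (μ := (volume : Measure (SpaceTime n))) (s := univ) (x₀ := x)
    (F := fun x y =>
      Complex.exp (((2 * Real.pi * inner ℝ y η : ℝ) : ℂ) * Complex.I) * φ (y, x))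
    (F' := fun x y => Complex.exp (((2 * Real.pi * inner ℝ y η : ℝ) : ℂ) * Complex.I) *
      _root_.fderiv ℝ φ (y, x) (0, 1))
    (bound := B) Filter.univ_mem (Eventually.of_forall fun x => ?_) ?_ ?_ ?_ hB ?_).2
  · rw [hφ.fderiv (0, 1) |>.partialFourier_eq]
    simpa only [hφ.partialFourier_eq] using key
  · exact Continuous.aestronglyMeasurable (by fun_prop)
  · refine hB₀.mono' (Continuous.aestronglyMeasurable (by fun_prop))
      (Eventually.of_forall fun y => ?_)
    rw [norm_mul, hn, one_mul]
    exact hB₀' y x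
  · exact Continuous.aestronglyMeasurable (by fun_prop)
  · refine Eventually.of_forall fun y x _ => ?_
    rw [norm_mul, hn, one_mul]
    exact hB' y x
  · refine Eventually.of_forall fun y x _ => HasDerivAt.const_mul _ ?_
    have h1 : HasFDerivAt φ (_root_.fderiv ℝ φ (y, x)) (y, x) :=
      (hφ.1.differentiable (by simp)).differentiableAt.hasFDerivAt
    exact h1.comp_hasDerivAt x ((hasDerivAt_const x y).prodMk (hasDerivAt_id x))

theorem eLpNorm_fourierInv_schwartz (ψ : 𝓢(SpaceTime n, ℂ)) :
    eLpNorm (𝓕⁻ ψ : 𝓢(SpaceTime n, ℂ)) 2 volume = eLpNorm ψ 2 volume := by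
  have h : ‖(𝓕⁻ ψ).toLp 2‖ = ‖ψ.toLp 2‖ := by
    rw [← SchwartzMap.toLp_fourierInv_eq, ← Lp.norm_fourier_eq, fourier_fourierInv_eq]
  have h2 : ‖(𝓕⁻ ψ).toLp 2‖ₑ = ‖ψ.toLp 2‖ₑ := by
    rw [← ofReal_norm, h, ofReal_norm]
  rwa [Lp.enorm_def, Lp.enorm_def, eLpNorm_congr_ae (SchwartzMap.coeFn_toLp _ _ _),
    eLpNorm_congr_ae (SchwartzMap.coeFn_toLp _ _ _)] at h2

theorem IsTestFun.memLp_partialFourier (hφ : IsTestFun φ) :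
    MemLp hφ.partialFourier 2 ((volume : Measure (SpaceTime n)).prod (volume : Measure ℝ)) := by
  refine ⟨hφ.measurable_partialFourier.aestronglyMeasurable, ?_⟩
  have h1 : eLpNorm hφ.partialFourier 2
      ((volume : Measure (SpaceTime n)).prod (volume : Measure ℝ)) ^ 2
      = eLpNorm φ 2 ((volume : Measure (SpaceTime n)).prod (volume : Measure ℝ)) ^ 2 := by
    rw [eLpNorm_two_sq, eLpNorm_two_sq,
      lintegral_prod_symm' _ (hφ.measurable_partialFourier.enorm.pow_const 2),
      lintegral_prod_symm' _ (hφ.1.continuous.measurable.enorm.pow_const 2)]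
    refine lintegral_congr fun x => ?_
    have := eLpNorm_fourierInv_schwartz (hφ.slice x)
    have h2 := congrArg (fun r => r ^ 2) this
    simp only [eLpNorm_two_sq] at h2
    exact h2
  have h3 : MemLp φ 2 ((volume : Measure (SpaceTime n)).prod (volume : Measure ℝ)) :=
    hφ.1.continuous.memLp_of_hasCompactSupport hφ.2.1
  have h4 := h3.2
  rcases lt_or_ge (eLpNorm hφ.partialFourier 2
    ((volume : Measure (SpaceTime n)).prod (volume : Measure ℝ))) ⊤ with h | h
  · exact h
  · rw [top_le_iff.mp h, ENNReal.top_pow (by norm_num)] at h1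
    exact absurd h1.symm (ENNReal.pow_ne_top h4.ne)

/-- Both factors are square integrable in a slab `a < x < b` that contains the support. -/
theorem IsTestFun.integrable_symbol_mul (hφ : IsTestFun φ) (hk : IsSymbol k) (v : L2 n) :
    Integrable (fun p : SpaceTime n × ℝ => k p.1 p.2 * v p.1 * hφ.partialFourier p)
      ((volume : Measure (SpaceTime n)).prod (volume.restrict (Ioi 0))) := by
  obtain ⟨a, b, ha, hab, hsupp⟩ := hφ.exists_slab
  obtain ⟨C, hC⟩ := hk.bounded a b ha
  have hv : MemLp (fun p : SpaceTime n × ℝ => v p.1) 2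
      ((volume : Measure (SpaceTime n)).prod (volume.restrict (Icc a b))) :=
    (Lp.memLp v).comp_fst _
  have hkv : MemLp (fun p : SpaceTime n × ℝ => k p.1 p.2 * v p.1) 2
      ((volume : Measure (SpaceTime n)).prod (volume.restrict (Icc a b))) := by
    refine MemLp.of_le_mul (c := C) hv (hk.measurable.aestronglyMeasurable.mul hv.1) ?_
    have h1 : ∀ᵐ p ∂((volume : Measure (SpaceTime n)).prod (volume.restrict (Icc a b))),
        p.2 ∈ Icc a b :=
      Measure.quasiMeasurePreserving_snd.ae (self_mem_ae_restrict measurableSet_Icc)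
    filter_upwards [h1] with p hp
    rw [norm_mul]
    exact mul_le_mul_of_nonneg_right (hC _ _ hp) (norm_nonneg _)
  have hp : MemLp hφ.partialFourier 2
      ((volume : Measure (SpaceTime n)).prod (volume.restrict (Icc a b))) :=
    hφ.memLp_partialFourier.mono_measure (by
      rw [← volume_restrict_univ_prod, Measure.volume_eq_prod]
      exact Measure.restrict_le_self)
  have h : Integrable (fun p : SpaceTime n × ℝ => k p.1 p.2 * v p.1 * hφ.partialFourier p)
      ((volume : Measure (SpaceTime n)).prod (volume.restrict (Icc a b))) :=
    MemLp.integrable_mul (p := 2) (q := 2) hkv hp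
  rw [← volume_restrict_univ_prod] at h ⊢
  refine IntegrableOn.of_forall_sdiff_eq_zero h (MeasurableSet.univ.prod measurableSet_Ioi) ?_
  rintro ⟨η, x⟩ ⟨-, hx⟩
  have hx : x ∉ Ioo a b := fun h => hx ⟨mem_univ _, Ioo_subset_Icc_self h⟩
  rw [hφ.partialFourier_eq_zero (hsupp x hx), mul_zero]

/-- Parseval's formula in the tangential variables. -/
theorem IsVersion.integral_mul (hk : IsSymbol k) (hF : IsVersion k v F) (hφ : IsTestFun φ) :
    ∫ p in halfSpace n, F p * φ p
      = ∫ p, k p.1 p.2 * v p.1 * hφ.partialFourier p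
        ∂((volume : Measure (SpaceTime n)).prod (volume.restrict (Ioi 0))) := by
  rw [integral_prod_symm _ (hφ.integrable_symbol_mul hk v), volume_restrict_halfSpace,
    integral_prod_symm]
  · refine integral_congr_ae ?_
    filter_upwards [hF.2, self_mem_ae_restrict measurableSet_Ioi] with x hx hx0
    calc ∫ y, F (y, x) * φ (y, x) = ∫ y, evolve k v x y * hφ.slice x y := by
          refine integral_congr_ae ?_
          filter_upwards [hx] with y hy
          rw [hy, hφ.slice_apply]
      _ = ∫ η, freqSlice k v x η * (𝓕⁻ (hφ.slice x)) η := integral_fourierInv_mul _ _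
      _ = _ := by
          refine integral_congr_ae ?_
          filter_upwards [hk.coeFn_freqSlice v hx0] with η hη
          rw [hη]
          rfl
  · rw [← volume_restrict_halfSpace]
    exact integrable_mul_test (hF.locallyIntegrableOn hk) hφ.1.continuous hφ.2.1 hφ.2.2

theorem IsTestFun.partialFourier_fderiv (hφ : IsTestFun φ) (w : SpaceTime n)
    (η : SpaceTime n) (x : ℝ) :
    (hφ.fderiv (w, 0)).partialFourier (η, x)
      = -(2 * Real.pi * Complex.I * (inner ℝ η w : ℝ)) * hφ.partialFourier (η, x) := by
  have h1 : (hφ.fderiv (w, 0)).slice x = LineDeriv.lineDerivOp w (hφ.slice x) := by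
    ext y
    rw [SchwartzMap.lineDerivOp_apply_eq_fderiv, slice_apply]
    have h2 : HasFDerivAt φ (_root_.fderiv ℝ φ (y, x)) (y, x) :=
      (hφ.1.differentiable (by simp)).differentiableAt.hasFDerivAt
    have h3 : HasFDerivAt (fun y => φ (y, x))
        ((_root_.fderiv ℝ φ (y, x)).comp (ContinuousLinearMap.inl ℝ (SpaceTime n) ℝ)) y :=
      h2.comp y (hasFDerivAt_prodMk_left y x)
    have h4 : (hφ.slice x : SpaceTime n → ℂ) = fun y => φ (y, x) := rfl
    rw [h4, h3.fderiv]
    rfl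
  have hg : (fun y : SpaceTime n => inner ℝ y w).HasTemperateGrowth := by fun_prop
  rw [partialFourier, h1, SchwartzMap.fourierInv_lineDerivOp_eq, _root_.smul_apply,
    SchwartzMap.smulLeftCLM_apply_apply hg, partialFourier]
  simp only [smul_eq_mul, Complex.real_smul]
  ring

/-- Tangential derivatives of `F` correspond to the multiplication of its symbol by `2πi η·w`. -/
theorem IsVersion.isWeakDeriv_tangential (hk : IsSymbol k) (hk' : IsSymbol k')
    (hF : IsVersion k v F) (hG : IsVersion k' v G) {w : SpaceTime n}
    (h : ∀ x, 0 < x → ∀ η, k' η x = 2 * Real.pi * Complex.I * (inner ℝ η w : ℝ) * k η x) :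
    IsWeakDeriv (w, 0) F G := by
  refine ⟨hF.locallyIntegrableOn hk, hG.locallyIntegrableOn hk', fun φ hφ => ?_⟩
  rw [hF.integral_mul hk (hφ.fderiv (w, 0)), hG.integral_mul hk' hφ, ← integral_neg]
  refine integral_congr_ae ?_
  have h1 : ∀ᵐ p ∂((volume : Measure (SpaceTime n)).prod (volume.restrict (Ioi (0 : ℝ)))),
      p.2 ∈ Ioi (0 : ℝ) :=
    Measure.quasiMeasurePreserving_snd.ae (self_mem_ae_restrict measurableSet_Ioi)
  filter_upwards [h1] with p hp
  rw [show p = (p.1, p.2) from rfl, hφ.partialFourier_fderiv, h _ hp]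
  ring

/-- The normal derivative of `F` corresponds to the derivative of its symbol in `x`. -/
theorem IsVersion.isWeakDeriv_normal (hk : IsSymbol k) (hk' : IsSymbol k')
    (hF : IsVersion k v F) (hG : IsVersion k' v G)
    (h : ∀ x, 0 < x → ∀ η, HasDerivAt (k η) (k' η x) x) :
    IsWeakDeriv (0, 1) F G := by
  refine ⟨hF.locallyIntegrableOn hk, hG.locallyIntegrableOn hk', fun φ hφ => ?_⟩
  have hi := (hφ.fderiv (0, 1)).integrable_symbol_mul hk v
  have hi' := hφ.integrable_symbol_mul hk' v
  rw [hF.integral_mul hk (hφ.fderiv (0, 1)), hG.integral_mul hk' hφ, eq_neg_iff_add_eq_zero,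
    ← integral_add hi hi', integral_prod _ (by exact hi.add hi')]
  refine (integral_congr_ae (g := fun _ => 0) (Eventually.of_forall fun η => ?_)).trans
    (integral_zero _ _)
  obtain ⟨a, b, ha, hab, hsupp⟩ := hφ.exists_slab
  have h0 : ∀ x ∉ Ioo a b, hφ.partialFourier (η, x) = 0 := fun x hx =>
    hφ.partialFourier_eq_zero (hsupp x hx) η
  have h0' : ∀ x ∉ Ioo a b, (hφ.fderiv (0, 1)).partialFourier (η, x) = 0 := fun x hx =>
    (hφ.fderiv (0, 1)).partialFourier_eq_zero
      (fun y hy => hsupp x hx y (tsupport_fderiv_apply_subset ℝ _ hy)) η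
  have hpos : ∀ x ∈ Icc a b, 0 < x := fun x hx => ha.trans_le hx.1
  have hp := hφ.hasDerivAt_partialFourier η
  have hq := (hφ.fderiv (0, 1)).hasDerivAt_partialFourier η
  have hd : ∀ x ∈ Icc a b, HasDerivAt (fun x => k η x * v η * hφ.partialFourier (η, x))
      (k η x * v η * (hφ.fderiv (0, 1)).partialFourier (η, x)
        + k' η x * v η * hφ.partialFourier (η, x)) x := fun x hx =>
    (((h x (hpos x hx) η).mul_const (v η)).mul (hp x)).congr_deriv (add_comm _ _)
  have hcont : ContinuousOn (fun x => k η x * v η * (hφ.fderiv (0, 1)).partialFourier (η, x)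
        + k' η x * v η * hφ.partialFourier (η, x)) (Icc a b) := by
    have hkc := (hk.continuousOn η).mono fun x hx => hpos x hx
    have hkc' := (hk'.continuousOn η).mono fun x hx => hpos x hx
    have hpc : Continuous fun x => hφ.partialFourier (η, x) :=
      continuous_iff_continuousAt.mpr fun x => (hp x).continuousAt
    have hqc : Continuous fun x => (hφ.fderiv (0, 1)).partialFourier (η, x) :=
      continuous_iff_continuousAt.mpr fun x => (hq x).continuousAt
    exact ((hkc.mul continuousOn_const).mul hqc.continuousOn).add
      ((hkc'.mul continuousOn_const).mul hpc.continuousOn)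
  have hzero : ∫ x in a..b, (k η x * v η * (hφ.fderiv (0, 1)).partialFourier (η, x)
        + k' η x * v η * hφ.partialFourier (η, x)) = 0 := by
    rw [intervalIntegral.integral_eq_sub_of_hasDerivAt (fun x hx => hd x (by
      rwa [uIcc_of_le hab.le] at hx)) (ContinuousOn.intervalIntegrable (by
      rwa [uIcc_of_le hab.le])), h0 a (by simp), h0 b (by simp)]
    simp
  rw [intervalIntegral.integral_of_le hab.le] at hzero
  rw [← hzero]
  refine (setIntegral_eq_of_subset_of_forall_sdiff_eq_zero measurableSet_Ioi
    (fun x hx => hpos x (Ioc_subset_Icc_self hx)) ?_)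
  rintro x ⟨-, hx⟩
  have hx : x ∉ Ioo a b := fun h => hx (Ioo_subset_Ioc_self h)
  simp only [h0 x hx, h0' x hx, mul_zero, add_zero]

end WeakDerivatives

/-! ### The symbols of the extension and of its gradient -/

section Symbols

variable {n : ℕ} {s : ℝ} {k : SpaceTime n → ℝ → ℂ}

/-- The principal square root `(iρ + |ξ|²)^{1/2}` of the heat symbol. -/
noncomputable def heatRoot (ζ : SpaceTime n) : ℂ := heatSymbol ζ ^ ((1 / 2 : ℝ) : ℂ)

theorem measurable_heatRoot : Measurable (heatRoot (n := n)) :=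
  continuous_heatSymbol.measurable.pow_const _

theorem re_heatSymbol (ζ : SpaceTime n) : (heatSymbol ζ).re = ∑ j : Fin n, (ζ j.succ) ^ 2 := by
  rw [heatSymbol, Complex.add_re, Complex.ofReal_re, Complex.I_mul_re, Complex.ofReal_im]
  simp

theorem im_heatSymbol (ζ : SpaceTime n) : (heatSymbol ζ).im = ζ 0 := by
  rw [heatSymbol, Complex.add_im, Complex.ofReal_im, Complex.I_mul_im, Complex.ofReal_re, add_zero]

theorem re_heatSymbol_nonneg (ζ : SpaceTime n) : 0 ≤ (heatSymbol ζ).re := by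
  rw [re_heatSymbol]
  positivity

theorem heatRoot_sq (ζ : SpaceTime n) : heatRoot ζ ^ 2 = heatSymbol ζ := by
  have := Complex.cpow_nat_inv_pow (heatSymbol ζ) (n := 2) (by norm_num)
  rw [heatRoot]
  convert this using 3
  push_cast
  norm_num

theorem norm_heatRoot_sq (ζ : SpaceTime n) : ‖heatRoot ζ‖ ^ 2 = ‖heatSymbol ζ‖ := by
  rw [← norm_pow, heatRoot_sq]

/-- The square roots of the heat symbol lie in the sector `|arg| ≤ π/4`. -/
theorem norm_heatRoot_le (ζ : SpaceTime n) : ‖heatRoot ζ‖ ≤ 2 * (heatRoot ζ).re := by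
  have h1 : 0 ≤ (heatRoot ζ).re := by
    rw [heatRoot, Complex.cpow_ofReal_re]
    refine mul_nonneg (by positivity) (Real.cos_nonneg_of_mem_Icc ⟨?_, ?_⟩)
    · linarith [Complex.neg_pi_lt_arg (heatSymbol ζ)]
    · linarith [Complex.arg_le_pi (heatSymbol ζ)]
  have h2 : 0 ≤ (heatRoot ζ).re ^ 2 - (heatRoot ζ).im ^ 2 := by
    have := re_heatSymbol_nonneg ζ
    rw [← heatRoot_sq, sq, Complex.mul_re] at this
    nlinarith
  have h3 := Complex.sq_norm (heatRoot ζ)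
  rw [Complex.normSq_apply] at h3
  refine abs_le_of_sq_le_sq' ?_ (by positivity) |>.2
  nlinarith

theorem heatRoot_cpow (s : ℝ) (ζ : SpaceTime n) :
    heatRoot ζ ^ ((2 * s : ℝ) : ℂ) = heatSymbol ζ ^ (s : ℂ) := by
  have h : (Complex.log (heatSymbol ζ) * ((1 / 2 : ℝ) : ℂ)).im = (heatSymbol ζ).arg * (1 / 2) := by
    rw [Complex.im_mul_ofReal, Complex.log_im]
  rw [heatRoot, ← Complex.cpow_mul]
  · congr 1
    push_cast
    ring
  · rw [h]
    linarith [Complex.neg_pi_lt_arg (heatSymbol ζ), Real.pi_pos]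
  · rw [h]
    linarith [Complex.arg_le_pi (heatSymbol ζ), Real.pi_pos]

theorem heatSymbol_neg (ζ : SpaceTime n) : heatSymbol (-ζ) = starRingEnd ℂ (heatSymbol ζ) := by
  apply Complex.ext
  · rw [Complex.conj_re, re_heatSymbol, re_heatSymbol]
    simp
  · rw [Complex.conj_im, im_heatSymbol, im_heatSymbol]
    simp

theorem heatRoot_neg (ζ : SpaceTime n) : heatRoot (-ζ) = starRingEnd ℂ (heatRoot ζ) := by
  have harg : (heatSymbol ζ).arg ≠ Real.pi := by
    rw [Ne, Complex.arg_eq_pi_iff]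
    intro h
    linarith [h.1, re_heatSymbol_nonneg ζ]
  rw [heatRoot, heatSymbol_neg, Complex.conj_cpow _ _ harg, Complex.conj_ofReal, heatRoot]

theorem heatSymbol_ne_zero {ζ : SpaceTime n} (hζ : ζ ≠ 0) : heatSymbol ζ ≠ 0 := by
  intro h
  apply hζ
  have h1 := re_heatSymbol ζ
  have h2 := im_heatSymbol ζ
  rw [h, Complex.zero_re] at h1
  rw [h, Complex.zero_im] at h2
  have h3 := (Finset.sum_eq_zero_iff_of_nonneg fun j _ => sq_nonneg (ζ (Fin.succ j))).mp h1.symm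
  ext i
  refine Fin.cases ?_ (fun j => ?_) i
  · exact h2.symm
  · exact pow_eq_zero_iff (two_ne_zero) |>.mp (h3 j (Finset.mem_univ j))

theorem ae_heatRoot_ne_zero : ∀ᵐ ζ : SpaceTime n, heatRoot ζ ≠ 0 := by
  have : ({0}ᶜ : Set (SpaceTime n)) ∈ ae volume := by
    rw [compl_mem_ae_iff]
    exact measure_singleton _
  filter_upwards [this] with ζ hζ h
  have h1 := heatRoot_sq ζ
  rw [h, zero_pow two_ne_zero] at h1
  exact heatSymbol_ne_zero hζ h1.symm

/-- The root of the heat symbol has parabolic size: it bounds `|ρ|^{1/2}` and `|ξ_j|`. -/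
theorem abs_time_le (ζ : SpaceTime n) : |ζ 0| ≤ ‖heatRoot ζ‖ ^ 2 := by
  rw [norm_heatRoot_sq, ← im_heatSymbol]
  exact Complex.abs_im_le_norm _

theorem abs_space_le (ζ : SpaceTime n) (j : Fin n) : |ζ j.succ| ≤ ‖heatRoot ζ‖ := by
  refine abs_le_of_sq_le_sq (le_trans ?_ (Complex.re_le_norm (heatSymbol ζ) |>.trans
    (norm_heatRoot_sq ζ).ge)) (norm_nonneg _)
  rw [re_heatSymbol]
  exact Finset.single_le_sum (f := fun j : Fin n => ζ j.succ ^ 2) (fun i _ => sq_nonneg _)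
    (Finset.mem_univ j)

/-- Exponential decay absorbs every power. -/
theorem exists_rpow_mul_exp_le (p : ℝ) (hp : 0 ≤ p) {a : ℝ} (ha : 0 < a) :
    ∃ C, ∀ r, 0 ≤ r → r ^ p * Real.exp (-(a * r)) ≤ C := by
  set m := ⌈p⌉₊
  refine ⟨1 + (m.factorial : ℝ) / a ^ m, fun r hr => ?_⟩
  have h1 : r ^ p ≤ 1 + r ^ m := by
    rcases le_total r 1 with h | h
    · linarith [Real.rpow_le_one hr h hp, pow_nonneg hr m]
    · have := Real.rpow_le_rpow_of_exponent_le h (Nat.le_ceil p)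
      rw [Real.rpow_natCast] at this
      linarith
  have h2 : r ^ m ≤ (m.factorial : ℝ) / a ^ m * Real.exp (a * r) := by
    have := Real.pow_div_factorial_le_exp (a * r) (by positivity) m
    rw [div_le_iff₀ (by positivity), mul_pow] at this
    rw [div_mul_eq_mul_div, le_div_iff₀ (by positivity)]
    linarith
  have h3 : (1 : ℝ) ≤ Real.exp (a * r) := Real.one_le_exp (by positivity)
  rw [Real.exp_neg, ← div_eq_mul_inv, div_le_iff₀ (Real.exp_pos _)]
  linarith

/-- A function `k(η, x)` that decays like `exp(-x |σ|/4)` at high frequencies, up to a power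
of `|σ|`, where `σ = heatRoot (2πη)`. -/
structure HasDecay (k : SpaceTime n → ℝ → ℂ) : Prop where
  measurable : Measurable fun p : SpaceTime n × ℝ => k p.1 p.2
  continuousOn : ∀ η, ContinuousOn (k η) (Ioi 0)
  bound : ∃ B p : ℝ, 0 ≤ B ∧ 0 ≤ p ∧ ∀ η x, 0 < x → ‖k η x‖ ≤
    B * ‖heatRoot ((2 * Real.pi) • η)‖ ^ p * Real.exp (-(x * ‖heatRoot ((2 * Real.pi) • η)‖ / 4))

theorem HasDecay.isSymbol (hk : HasDecay k) : IsSymbol k := by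
  refine ⟨hk.1, hk.2, fun a b ha => ?_⟩
  obtain ⟨B, p, hB, hp, h⟩ := hk.3
  obtain ⟨C, hC⟩ := exists_rpow_mul_exp_le p hp (a := a / 4) (by positivity)
  refine ⟨B * C, fun η x hx => (h η x (ha.trans_le hx.1)).trans ?_⟩
  rw [mul_assoc]
  refine mul_le_mul_of_nonneg_left
    (le_trans ?_ (hC ‖heatRoot ((2 * Real.pi) • η)‖ (norm_nonneg _))) hB
  gcongr
  rw [div_mul_eq_mul_div]
  gcongr
  exact hx.1

theorem HasDecay.mul_freq (hk : HasDecay k) {g : SpaceTime n → ℂ} (hg : Measurable g) (m : ℕ)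
    (hb : ∀ η, ‖g η‖ ≤ ‖heatRoot ((2 * Real.pi) • η)‖ ^ m) : HasDecay fun η x => g η * k η x := by
  refine ⟨(hg.comp measurable_fst).mul hk.1, fun η => continuousOn_const.mul (hk.2 η), ?_⟩
  obtain ⟨B, p, hB, hp, h⟩ := hk.3
  refine ⟨B, m + p, hB, by positivity, fun η x hx => ?_⟩
  rw [norm_mul]
  refine (mul_le_mul (hb η) (h η x hx) (norm_nonneg _) (by positivity)).trans (le_of_eq ?_)
  rw [Real.rpow_add_of_nonneg (norm_nonneg _) (by positivity) hp, Real.rpow_natCast]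
  ring

theorem IsSymbol.mul_left (hk : IsSymbol k) (q : ℝ) :
    IsSymbol fun η x => ((x ^ q : ℝ) : ℂ) * k η x := by
  have hc : ContinuousOn (fun x : ℝ => ((x ^ q : ℝ) : ℂ)) (Ioi 0) := by
    refine Complex.continuous_ofReal.comp_continuousOn ?_
    exact fun x hx => (Real.continuousAt_rpow_const x q (Or.inl (ne_of_gt hx))).continuousWithinAt
  refine ⟨?_, fun η => hc.mul (hk.2 η), fun a b ha => ?_⟩
  · exact (by fun_prop : Measurable fun p : SpaceTime n × ℝ => ((p.2 ^ q : ℝ) : ℂ)).mul hk.1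
  obtain ⟨C, hC⟩ := hk.3 a b ha
  obtain ⟨C', hC'⟩ := (isCompact_Icc (a := a) (b := b)).exists_bound_of_continuousOn
    (hc.mono fun x hx => ha.trans_le hx.1)
  refine ⟨C' * C, fun η x hx => ?_⟩
  rw [norm_mul]
  exact mul_le_mul (hC' x hx) (hC η x hx) (norm_nonneg _) ((norm_nonneg _).trans (hC' x hx))

/-- The symbol `m(x, σ)` of the extension operator, at the frequency `2πη`. -/
noncomputable def extSymbol (s : ℝ) (η : SpaceTime n) (x : ℝ) : ℂ :=
  profile s (heatRoot ((2 * Real.pi) • η)) x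

/-- The symbol `x^{1-2s} ∂ₓm(x, σ)` of the conormal derivative of the extension. -/
noncomputable def conormalSymbol (s : ℝ) (η : SpaceTime n) (x : ℝ) : ℂ :=
  conormal s (heatRoot ((2 * Real.pi) • η)) x

theorem measurable_heatRoot_prod : Measurable fun p : SpaceTime n × ℝ =>
    ((heatRoot ((2 * Real.pi) • p.1), p.2) : ℂ × ℝ) := by
  have h1 : Measurable fun p : SpaceTime n × ℝ => (2 * Real.pi) • p.1 := by fun_prop
  have h2 : Measurable fun p : SpaceTime n × ℝ => heatRoot ((2 * Real.pi) • p.1) :=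
    measurable_heatRoot.comp h1
  exact h2.prodMk measurable_snd

theorem hasDecay_extSymbol (hs : s ∈ Ioo (0 : ℝ) 1) : HasDecay (extSymbol (n := n) s) := by
  have hm : Measurable fun p : SpaceTime n × ℝ => extSymbol s p.1 p.2 := by
    have h := (measurable_profile s).comp (measurable_heatRoot_prod (n := n))
    exact h
  refine ⟨hm, fun η x hx => ?_, 4, 0, by norm_num,
    le_rfl, fun η x hx => ?_⟩
  · exact (hasDerivAt_profile hs (norm_heatRoot_le _) hx).continuousAt.continuousWithinAt
  · rw [Real.rpow_zero, mul_one]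
    exact norm_profile_le hs (norm_heatRoot_le _) x

theorem hasDecay_conormalSymbol (hs : s ∈ Ioo (0 : ℝ) 1) :
    HasDecay (conormalSymbol (n := n) s) := by
  have hm : Measurable fun p : SpaceTime n × ℝ => conormalSymbol s p.1 p.2 := by
    have h := (measurable_conormal s).comp (measurable_heatRoot_prod (n := n))
    exact h
  refine ⟨hm, fun η x hx => ?_, conormalConst s,
    2 * s, (conormalConst_pos hs).le, by linarith [hs.1], fun η x hx => ?_⟩
  · exact (hasDerivAt_conormal hs (norm_heatRoot_le _) hx).continuousAt.continuousWithinAt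
  · exact norm_conormal_le hs (norm_heatRoot_le _) x

/-- The symbols of the components `∂_1, …, ∂_{n+1}` of the gradient of the extension. -/
noncomputable def gradSymbol (s : ℝ) (i : Fin (n + 1)) : SpaceTime n → ℝ → ℂ :=
  Fin.lastCases (motive := fun _ => SpaceTime n → ℝ → ℂ)
    (fun η x => ((x ^ (2 * s - 1) : ℝ) : ℂ) * conormalSymbol s η x)
    (fun j η x => 2 * Real.pi * Complex.I * (η j.succ : ℝ) * extSymbol s η x) i

theorem gradSymbol_castSucc (j : Fin n) : gradSymbol s j.castSucc =
    fun (η : SpaceTime n) x => 2 * Real.pi * Complex.I * (η j.succ : ℝ) * extSymbol s η x := by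
  rw [gradSymbol, Fin.lastCases_castSucc]

theorem gradSymbol_last : gradSymbol s (Fin.last n) =
    fun (η : SpaceTime n) x => ((x ^ (2 * s - 1) : ℝ) : ℂ) * conormalSymbol s η x := by
  rw [gradSymbol, Fin.lastCases_last]

theorem measurable_coord (i : Fin (n + 1)) :
    Measurable fun η : SpaceTime n => 2 * Real.pi * Complex.I * (η i : ℝ) := by
  fun_prop

theorem norm_coord (η : SpaceTime n) (i : Fin (n + 1)) :
    ‖2 * Real.pi * Complex.I * ((η i : ℝ) : ℂ)‖ = |((2 * Real.pi) • η) i| := by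
  rw [PiLp.smul_apply, smul_eq_mul, abs_mul, norm_mul, norm_mul, norm_mul, Complex.norm_I,
    Complex.norm_real, Complex.norm_real, Complex.norm_ofNat, Real.norm_eq_abs, Real.norm_eq_abs,
    abs_mul, abs_two, mul_one]

theorem HasDecay.mul_space (hk : HasDecay k) (j : Fin n) :
    HasDecay fun η x => 2 * Real.pi * Complex.I * (η j.succ : ℝ) * k η x :=
  hk.mul_freq (measurable_coord _) 1 fun η => by
    rw [norm_coord, pow_one]
    exact abs_space_le _ _

theorem HasDecay.mul_time (hk : HasDecay k) :
    HasDecay fun η x => 2 * Real.pi * Complex.I * (η 0 : ℝ) * k η x :=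
  hk.mul_freq (measurable_coord _) 2 fun η => by
    rw [norm_coord]
    exact abs_time_le _

theorem isSymbol_gradSymbol (hs : s ∈ Ioo (0 : ℝ) 1) (i : Fin (n + 1)) :
    IsSymbol (gradSymbol s i) := by
  refine Fin.lastCases ?_ (fun j => ?_) i
  · rw [gradSymbol_last]
    exact (hasDecay_conormalSymbol hs).isSymbol.mul_left _
  · rw [gradSymbol_castSucc]
    exact ((hasDecay_extSymbol hs).mul_space j).isSymbol

theorem inner_single (η : SpaceTime n) (i : Fin (n + 1)) :
    inner ℝ η (EuclideanSpace.single i 1) = η i := by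
  simp [EuclideanSpace.inner_single_right]

/-- The versions of `gradSymbol s i` are the components of the weak gradient of the versions of
`extSymbol s`. -/
theorem isWeakDeriv_gradSymbol (hs : s ∈ Ioo (0 : ℝ) 1) {v : L2 n} {F G : SpaceTime n × ℝ → ℂ}
    (hF : IsVersion (extSymbol s) v F) (i : Fin (n + 1)) (hG : IsVersion (gradSymbol s i) v G) :
    IsWeakDeriv (spaceDir n i) F G := by
  have hk := (hasDecay_extSymbol (n := n) hs).isSymbol
  have hk' := isSymbol_gradSymbol (n := n) hs
  induction i using Fin.lastCases with
  | last =>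
    rw [spaceDir, Fin.snoc_last]
    refine hF.isWeakDeriv_normal hk (hk' _) hG fun x hx η => ?_
    rw [gradSymbol_last]
    exact hasDerivAt_profile hs (norm_heatRoot_le _) hx
  | cast j =>
    rw [spaceDir, Fin.snoc_castSucc]
    refine hF.isWeakDeriv_tangential hk (hk' _) hG fun x hx η => ?_
    rw [gradSymbol_castSucc, inner_single]

end Symbols

/-! ### Parabolic Sobolev norms -/

section SobolevNorms

variable {n : ℕ} {k : SpaceTime n → ℝ → ℂ}

theorem IsFourierTransform.congr {T : 𝓢'(SpaceTime n, ℂ)} {g h : SpaceTime n → ℂ}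
    (hg : IsFourierTransform T g) (e : h =ᵐ[volume] g) : IsFourierTransform T h := by
  refine ⟨hg.1.congr e.symm, fun ψ => ?_⟩
  have e' : (fun η => ψ η * h ((2 * Real.pi) • η)) =ᵐ[volume]
      fun η => ψ η * g ((2 * Real.pi) • η) := by
    filter_upwards [(quasiMeasurePreserving_smul (n := n) two_pi_ne_zero).ae e] with η hη
    rw [hη]
  exact ⟨(hg.2 ψ).1.congr e'.symm, by rw [integral_congr_ae e', (hg.2 ψ).2]⟩

theorem IsSymbol.isFourierTransform_evolve (hk : IsSymbol k) (u : L2 n) {x : ℝ} (hx : 0 < x) :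
    IsFourierTransform (toDist (evolve k (𝓕 u) x))
      fun ζ => k ((2 * Real.pi)⁻¹ • ζ) x * l2Fourier u ζ := by
  refine (isFourierTransform_toDist _).congr ?_
  filter_upwards [(quasiMeasurePreserving_smul (n := n) (inv_ne_zero two_pi_ne_zero)).ae
    (hk.coeFn_freqSlice (𝓕 u) hx)] with ζ hζ
  rw [l2Fourier, l2Fourier, evolve, fourier_fourierInv_eq, hζ]

theorem aestronglyMeasurable_weight (a : ℝ) :
    AEStronglyMeasurable (fun ζ : SpaceTime n => (1 + ‖heatSymbol ζ‖) ^ a) volume :=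
  ((measurable_const.add continuous_heatSymbol.norm.measurable).pow_const _).aestronglyMeasurable

theorem hNorm_add_le {a : ℝ} {T S : 𝓢'(SpaceTime n, ℂ)} {g h : SpaceTime n → ℂ}
    (hT : IsFourierTransform T g) (hS : IsFourierTransform S h) :
    hNorm a (T + S) ≤ hNorm a T + hNorm a S := by
  have hc := aestronglyMeasurable_weight (n := n) (a / 2)
  rw [hNorm_eq hT, hNorm_eq hS, hNorm_eq (hT.add hS)]
  simp only [smul_add]
  exact eLpNorm_add_le (hc.smul hT.1) (hc.smul hS.1) (by norm_num)

theorem IsFourierTransform.neg {T : 𝓢'(SpaceTime n, ℂ)} {g : SpaceTime n → ℂ}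
    (hT : IsFourierTransform T g) : IsFourierTransform (-T) fun ζ => -1 * g ζ := by
  have e : (-1 : ℂ) • T = -T := neg_one_smul ℂ T
  exact e ▸ hT.smul (-1)

theorem hNorm_neg {a : ℝ} {T : 𝓢'(SpaceTime n, ℂ)} {g : SpaceTime n → ℂ}
    (hT : IsFourierTransform T g) : hNorm a (-T) = hNorm a T := by
  rw [hNorm_eq hT, hNorm_eq hT.neg]
  refine eLpNorm_congr_norm_ae (Eventually.of_forall fun ζ => ?_)
  simp

theorem memLp_of_mem_HSpace {a : ℝ} (u : HSpace n a) :
    MemLp (fun ζ => (1 + ‖heatSymbol ζ‖) ^ (a / 2) • l2Fourier u.1 ζ) 2 volume := by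
  obtain ⟨g, hg, hg'⟩ := hNorm_lt_top.mp u.2
  refine (memLp_congr_ae ?_).mpr hg'
  filter_upwards [(isFourierTransform_toDist u.1).ae_eq hg] with ζ hζ
  rw [hζ]

/-- The norms `‖T_x‖_{ℋ^a}` converge if `T_x` converges in `ℋ^a`. -/
theorem tendsto_hNorm {ι : Type*} {l : Filter ι} {a : ℝ} {T : ι → 𝓢'(SpaceTime n, ℂ)}
    {S : 𝓢'(SpaceTime n, ℂ)} (hT : ∀ᶠ i in l, ∃ g, IsFourierTransform (T i) g)
    {h : SpaceTime n → ℂ} (hS : IsFourierTransform S h)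
    (hlim : Tendsto (fun i => hNorm a (T i - S)) l (𝓝 0)) :
    Tendsto (fun i => hNorm a (T i)) l (𝓝 (hNorm a S)) := by
  have h1 : Tendsto (fun i => hNorm a S - hNorm a (T i - S)) l (𝓝 (hNorm a S)) := by
    simpa using ENNReal.Tendsto.sub (tendsto_const_nhds (x := hNorm a S)) hlim (Or.inr (by simp))
  have h2 : Tendsto (fun i => hNorm a S + hNorm a (T i - S)) l (𝓝 (hNorm a S)) := by
    simpa using hlim.const_add (hNorm a S)
  refine tendsto_of_tendsto_of_tendsto_of_le_of_le' h1 h2 ?_ ?_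
  · filter_upwards [hT] with i ⟨g, hg⟩
    rw [tsub_le_iff_right]
    have hd := (hg.add hS.neg).neg
    have := hNorm_add_le (a := a) hg hd
    rw [hNorm_neg (hg.add hS.neg), ← sub_eq_add_neg, ← sub_eq_add_neg,
      sub_sub_cancel] at this
    exact this
  · filter_upwards [hT] with i ⟨g, hg⟩
    have := hNorm_add_le (a := a) hS (hg.add hS.neg)
    rwa [← sub_eq_add_neg, add_sub_cancel] at this

end SobolevNorms

/-! ### Energy estimates -/

section Energy

variable {n : ℕ} {s : ℝ}

theorem lintegral_rpow_mul_exp {a r B : ℝ} (ha : 0 < a) (hr : 0 < r) (hB : 0 ≤ B) :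
    ∫⁻ x in Ioi (0 : ℝ), ENNReal.ofReal (B * (x ^ (a - 1) * Real.exp (-(r * x))))
      = ENNReal.ofReal (B * ((1 / r) ^ a * Real.Gamma a)) := by
  have hint : IntegrableOn (fun x : ℝ => x ^ (a - 1) * Real.exp (-(r * x))) (Ioi 0) := by
    simpa only [mul_comm] using integrableOn_exp_mul_rpow ha hr
  rw [← Real.integral_rpow_mul_exp_neg_mul_Ioi ha hr, ← integral_const_mul,
    ofReal_integral_eq_lintegral_ofReal (hint.const_mul B)]
  filter_upwards [self_mem_ae_restrict measurableSet_Ioi] with x hx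
  have hx : 0 < x := hx
  simp only [Pi.zero_apply]
  positivity

/-- The frequencywise energy estimate: the weighted energy of a symbol component is controlled by
`|σ|^{2s}`. -/
theorem exists_lintegral_gradSymbol_le (hs : s ∈ Ioo (0 : ℝ) 1) (i : Fin (n + 1)) :
    ∃ C : ℝ≥0, ∀ η : SpaceTime n,
      ∫⁻ x in Ioi (0 : ℝ), ‖((x ^ ((1 - 2 * s) / 2) : ℝ) : ℂ) * gradSymbol s i η x‖ₑ ^ 2
        ≤ C * ENNReal.ofReal (‖heatRoot ((2 * Real.pi) • η)‖ ^ (2 * s)) := by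
  have main : ∀ (a : ℝ) (B q : ℝ), 0 < a → 0 ≤ B → q - a = 2 * s → 0 < q →
      (∀ (η : SpaceTime n) (x : ℝ), 0 < x →
        ‖((x ^ ((1 - 2 * s) / 2) : ℝ) : ℂ) * gradSymbol s i η x‖ ^ 2 ≤
          B * ‖heatRoot ((2 * Real.pi) • η)‖ ^ q *
            (x ^ (a - 1) * Real.exp (-(‖heatRoot ((2 * Real.pi) • η)‖ / 2 * x)))) →
      ∃ C : ℝ≥0, ∀ η : SpaceTime n,
        ∫⁻ x in Ioi (0 : ℝ), ‖((x ^ ((1 - 2 * s) / 2) : ℝ) : ℂ) * gradSymbol s i η x‖ₑ ^ 2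
          ≤ C * ENNReal.ofReal (‖heatRoot ((2 * Real.pi) • η)‖ ^ (2 * s)) := by
    intro a B q ha hB hq hq0 hbd
    have hG := Real.Gamma_pos_of_pos ha
    refine ⟨(B * (2 ^ a * Real.Gamma a)).toNNReal, fun η => ?_⟩
    set r := ‖heatRoot ((2 * Real.pi) • η)‖ with hr
    have h1 : ∫⁻ x in Ioi (0 : ℝ), ‖((x ^ ((1 - 2 * s) / 2) : ℝ) : ℂ) * gradSymbol s i η x‖ₑ ^ 2
        ≤ ∫⁻ x in Ioi (0 : ℝ),
          ENNReal.ofReal (B * r ^ q * (x ^ (a - 1) * Real.exp (-(r / 2 * x)))) := by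
      refine setLIntegral_mono_ae' measurableSet_Ioi (Eventually.of_forall fun x hx => ?_)
      rw [← ofReal_norm, ← ENNReal.ofReal_pow (norm_nonneg _)]
      exact ENNReal.ofReal_le_ofReal (hbd η x hx)
    refine h1.trans ?_
    rcases (norm_nonneg (heatRoot ((2 * Real.pi) • η))).eq_or_lt with h0 | h0
    · have : r = 0 := by rw [hr, ← h0]
      simp [this, Real.zero_rpow hq0.ne']
    · rw [lintegral_rpow_mul_exp ha (by positivity) (by positivity)]
      change _ ≤ ENNReal.ofReal _ * _
      rw [← ENNReal.ofReal_mul (by positivity)]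
      refine ENNReal.ofReal_le_ofReal (le_of_eq ?_)
      have h0 : 0 < r := h0
      rw [← hq, Real.rpow_sub h0, one_div_div, Real.div_rpow (by norm_num) h0.le]
      field_simp
  have hsq : ∀ (x : ℝ), 0 < x → ∀ e : ℝ, (x ^ e) ^ 2 = x ^ (2 * e) := fun x hx e => by
    rw [mul_comm, Real.rpow_mul hx.le, Real.rpow_two]
  have hexp : ∀ x r : ℝ, Real.exp (-(x * r / 4)) ^ 2 = Real.exp (-(r / 2 * x)) := fun x r => by
    rw [← Real.exp_nat_mul]
    congr 1
    push_cast
    ring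
  induction i using Fin.lastCases with
  | last =>
    refine main (2 * s) (conormalConst s ^ 2) (4 * s) (by linarith [hs.1]) (by positivity) (by ring)
      (by linarith [hs.1]) fun η x hx => ?_
    set r := ‖heatRoot ((2 * Real.pi) • η)‖ with hr
    have hb := norm_conormal_le hs (norm_heatRoot_le ((2 * Real.pi) • η)) x
    simp only [gradSymbol_last, conormalSymbol]
    rw [← mul_assoc, ← Complex.ofReal_mul, norm_mul,
      Complex.norm_real, Real.norm_of_nonneg (by positivity), mul_pow, ← Real.rpow_add hx,
      hsq x hx]
    calc _ ≤ x ^ (2 * ((1 - 2 * s) / 2 + (2 * s - 1))) *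
          (conormalConst s * r ^ (2 * s) * Real.exp (-(x * r / 4))) ^ 2 := by gcongr
      _ = _ := by
        have e1 : (r ^ (2 * s)) ^ 2 = r ^ (4 * s) := by
          rw [← Real.rpow_mul_natCast (norm_nonneg _)]
          congr 1
          push_cast
          ring
        rw [mul_pow, mul_pow, hexp, e1]
        ring_nf
  | cast j =>
    refine main (2 - 2 * s) 16 2 (by linarith [hs.2]) (by positivity) (by ring)
      (by norm_num) fun η x hx => ?_
    set r := ‖heatRoot ((2 * Real.pi) • η)‖ with hr
    have hb := norm_profile_le hs (norm_heatRoot_le ((2 * Real.pi) • η)) x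
    have hj := abs_space_le ((2 * Real.pi) • η) j
    simp only [gradSymbol_castSucc, extSymbol]
    rw [norm_mul, norm_mul, norm_coord,
      Complex.norm_real, Real.norm_of_nonneg (by positivity), mul_pow, hsq x hx]
    calc _ ≤ x ^ (2 * ((1 - 2 * s) / 2)) *
          (r * (4 * Real.exp (-(x * r / 4)))) ^ 2 := by gcongr
      _ = _ := by
        rw [mul_pow, mul_pow, hexp, Real.rpow_two]
        ring_nf

/-- The energy estimate for one component of the gradient. -/
theorem exists_eLpNorm_gradient_le (hs : s ∈ Ioo (0 : ℝ) 1) (i : Fin (n + 1)) :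
    ∃ C : ℝ≥0, ∀ (u : L2 n) (G : SpaceTime n × ℝ → ℂ), IsVersion (gradSymbol s i) (𝓕 u) G →
      eLpNorm (weighted s G) 2 (volume.restrict (halfSpace n)) ≤ C * hNorm s (toDist u) := by
  obtain ⟨C, hC⟩ := exists_lintegral_gradSymbol_le (n := n) hs i
  refine ⟨NNReal.sqrt C, fun u G hG => ?_⟩
  have hk := isSymbol_gradSymbol (n := n) hs i
  have hk' := hk.mul_left ((1 - 2 * s) / 2)
  have hW : IsVersion (fun η x => ((x ^ ((1 - 2 * s) / 2) : ℝ) : ℂ) * gradSymbol s i η x) (𝓕 u)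
      (weighted s G) :=
    hG.mul_left (c := fun x => x ^ ((1 - 2 * s) / 2)) hk hk' (by fun_prop) fun x hx η => rfl
  rw [← ENNReal.pow_le_pow_left_iff two_ne_zero, mul_pow, eLpNorm_two_sq, halfSpace_eq_prod,
    hW.lintegral_enorm_sq hk' subset_rfl, lintegral_lintegral_swap]
  · have hA : eLpNorm (fun η => (1 + ‖heatSymbol ((2 * Real.pi) • η)‖) ^ (s / 2) • (𝓕 u : L2 n) η) 2
        volume ≤ hNorm s (toDist u) := by
      rw [hNorm_eq (isFourierTransform_toDist u)]
      have hm : AEStronglyMeasurable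
          (fun ζ => (1 + ‖heatSymbol ζ‖) ^ (s / 2) • l2Fourier u ζ) volume :=
        (aestronglyMeasurable_weight _).smul (isFourierTransform_toDist u).1
      refine le_trans (le_of_eq ?_) (eLpNorm_comp_two_pi_smul _ hm)
      simp only [l2Fourier_two_pi]
    have hC2 : ((NNReal.sqrt C : ℝ≥0) : ℝ≥0∞) ^ 2 = C := by
      rw [← ENNReal.coe_pow, NNReal.sq_sqrt]
    rw [hC2]
    calc _ = ∫⁻ η, (∫⁻ x in Ioi (0 : ℝ),
          ‖((x ^ ((1 - 2 * s) / 2) : ℝ) : ℂ) * gradSymbol s i η x‖ₑ ^ 2) *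
            ‖(𝓕 u : L2 n) η‖ₑ ^ 2 := by
          refine lintegral_congr fun η => ?_
          rw [lintegral_mul_const' _ _ (by finiteness)]
      _ ≤ ∫⁻ η, C * ‖(1 + ‖heatSymbol ((2 * Real.pi) • η)‖) ^ (s / 2) • (𝓕 u : L2 n) η‖ₑ ^ 2 := by
          refine lintegral_mono fun η => ?_
          rw [enorm_smul, mul_pow, ← mul_assoc]
          refine mul_le_mul_left ((hC η).trans ?_) _
          refine mul_le_mul_right ?_ _
          rw [← ofReal_norm, ← ENNReal.ofReal_pow (norm_nonneg _), Real.norm_of_nonneg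
            (by positivity)]
          refine ENNReal.ofReal_le_ofReal ?_
          rw [Real.rpow_mul (norm_nonneg _), Real.rpow_two, norm_heatRoot_sq,
            ← Real.rpow_mul_natCast (by positivity)]
          push_cast
          rw [div_mul_cancel₀ _ two_ne_zero]
          refine Real.rpow_le_rpow (norm_nonneg _) (by linarith) hs.1.le
      _ ≤ _ := by
          rw [lintegral_const_mul' _ _ (by finiteness), ← eLpNorm_two_sq]
          gcongr
  · have m1 : Measurable fun p : ℝ × SpaceTime n =>
        ‖((p.1 ^ ((1 - 2 * s) / 2) : ℝ) : ℂ) * gradSymbol s i p.2 p.1‖ₑ ^ 2 :=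
      (hk'.measurable.comp measurable_swap).enorm.pow_const 2
    have m2 : Measurable fun p : ℝ × SpaceTime n => ‖(𝓕 u : L2 n) p.2‖ₑ ^ 2 :=
      ((Lp.stronglyMeasurable (𝓕 u : L2 n)).measurable.comp measurable_snd).enorm.pow_const 2
    exact (m1.mul m2).aemeasurable

/-- The `L²` estimate in strips; `x^{1-2s}` is integrable at `0` as `s < 1`. -/
theorem exists_eLpNorm_strip_le (hs : s ∈ Ioo (0 : ℝ) 1) (M : ℝ) :
    ∃ C : ℝ≥0, ∀ (u : L2 n) (F : SpaceTime n × ℝ → ℂ), IsVersion (extSymbol s) (𝓕 u) F →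
      eLpNorm (weighted s F) 2 (volume.restrict {p | 0 < p.2 ∧ p.2 < M})
        ≤ C * eLpNorm u 2 volume := by
  have hfin : ∫⁻ x in Ioo 0 M, ENNReal.ofReal (16 * x ^ (1 - 2 * s)) ≠ ⊤ := by
    rcases le_or_gt M 0 with hM | hM
    · simp [Ioo_eq_empty_of_le hM]
    have h := intervalIntegral.intervalIntegrable_rpow' (a := 0) (b := M) (r := 1 - 2 * s)
      (by linarith [hs.2])
    rw [intervalIntegrable_iff_integrableOn_Ioo_of_le hM.le] at h
    exact (h.const_mul 16).lintegral_lt_top.ne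
  set c := ∫⁻ x in Ioo 0 M, ENNReal.ofReal (16 * x ^ (1 - 2 * s)) with hc
  refine ⟨NNReal.sqrt c.toNNReal, fun u F hF => ?_⟩
  have hk := (hasDecay_extSymbol (n := n) hs).isSymbol
  have hk' := hk.mul_left ((1 - 2 * s) / 2)
  have hW : IsVersion (fun η x => ((x ^ ((1 - 2 * s) / 2) : ℝ) : ℂ) * extSymbol s η x) (𝓕 u)
      (weighted s F) :=
    hF.mul_left (c := fun x => x ^ ((1 - 2 * s) / 2)) hk hk' (by fun_prop) fun x hx η => rfl
  have hset : {p : SpaceTime n × ℝ | 0 < p.2 ∧ p.2 < M} = univ ×ˢ Ioo 0 M := by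
    ext p
    simp
  have hu : eLpNorm (𝓕 u : L2 n) 2 volume = eLpNorm u 2 volume := by
    rw [← Lp.enorm_def, ← Lp.enorm_def, ← ofReal_norm, Lp.norm_fourier_eq, ofReal_norm]
  rw [← ENNReal.pow_le_pow_left_iff two_ne_zero, mul_pow, eLpNorm_two_sq, hset,
    hW.lintegral_enorm_sq hk' fun x hx => hx.1, ← ENNReal.coe_pow, NNReal.sq_sqrt,
    ENNReal.coe_toNNReal hfin, ← hu, eLpNorm_two_sq, hc, ← lintegral_mul_const]
  · refine setLIntegral_mono_ae' measurableSet_Ioo (Eventually.of_forall fun x hx => ?_)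
    have hx0 : 0 < x := hx.1
    rw [← lintegral_const_mul' _ _ (by finiteness)]
    refine lintegral_mono fun η => mul_le_mul_left ?_ _
    rw [← ofReal_norm, ← ENNReal.ofReal_pow (norm_nonneg _)]
    refine ENNReal.ofReal_le_ofReal ?_
    have hb := norm_profile_le hs (norm_heatRoot_le ((2 * Real.pi) • η)) x
    have he : Real.exp (-(x * ‖heatRoot ((2 * Real.pi) • η)‖ / 4)) ≤ 1 :=
      Real.exp_le_one_iff.mpr (neg_nonpos.mpr (by positivity))
    have hb' : ‖extSymbol s η x‖ ≤ 4 := hb.trans (by linarith)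
    rw [norm_mul, Complex.norm_real, Real.norm_of_nonneg (by positivity), mul_pow,
      ← Real.rpow_mul_natCast hx0.le]
    push_cast
    rw [div_mul_cancel₀ _ two_ne_zero]
    have : ‖extSymbol s η x‖ ^ 2 ≤ 16 := by nlinarith [norm_nonneg (extSymbol s η x)]
    rw [mul_comm (16 : ℝ)]
    gcongr
  · fun_prop

end Energy

/-! ### Boundary values -/

section BoundaryValues

variable {n : ℕ} {s : ℝ}

theorem extSymbol_inv_smul (ζ : SpaceTime n) (x : ℝ) :
    extSymbol s ((2 * Real.pi)⁻¹ • ζ) x = profile s (heatRoot ζ) x := by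
  rw [extSymbol, smul_smul, mul_inv_cancel₀ two_pi_ne_zero, one_smul]

theorem conormalSymbol_inv_smul (ζ : SpaceTime n) (x : ℝ) :
    conormalSymbol s ((2 * Real.pi)⁻¹ • ζ) x = conormal s (heatRoot ζ) x := by
  rw [conormalSymbol, smul_smul, mul_inv_cancel₀ two_pi_ne_zero, one_smul]

theorem measurable_profile_heatRoot (x : ℝ) :
    Measurable fun ζ : SpaceTime n => profile s (heatRoot ζ) x := by
  have h := (measurable_profile s).comp
    ((measurable_heatRoot (n := n)).prodMk (measurable_const (a := x)))
  exact h

theorem measurable_conormal_heatRoot (x : ℝ) :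
    Measurable fun ζ : SpaceTime n => conormal s (heatRoot ζ) x := by
  have h := (measurable_conormal s).comp
    ((measurable_heatRoot (n := n)).prodMk (measurable_const (a := x)))
  exact h

/-- The extension attains its boundary values in `ℋ^s`. -/
theorem tendsto_boundary (hs : s ∈ Ioo (0 : ℝ) 1) (u : HSpace n s) :
    Tendsto (fun x : ℝ => hNorm s (toDist (evolve (extSymbol s) (𝓕 u.1) x - u.1)))
      (𝓝[>] 0) (𝓝 0) := by
  have hk := (hasDecay_extSymbol (n := n) hs).isSymbol
  have hFT : ∀ x : ℝ, 0 < x → IsFourierTransform (toDist (evolve (extSymbol s) (𝓕 u.1) x - u.1))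
      fun ζ => (profile s (heatRoot ζ) x - 1) * l2Fourier u.1 ζ := by
    intro x hx
    have h := (hk.isFourierTransform_evolve u.1 hx).add (isFourierTransform_toDist u.1).neg
    rw [toDist, map_sub, sub_eq_add_neg]
    convert h using 2 with ζ
    rw [extSymbol_inv_smul]
    ring
  have h := tendsto_eLpNorm_two (l := 𝓝[>] (0 : ℝ)) (μ := (volume : Measure (SpaceTime n)))
    (f := fun x ζ => (1 + ‖heatSymbol ζ‖) ^ (s / 2) •
      ((profile s (heatRoot ζ) x - 1) * l2Fourier u.1 ζ))
    (g := fun ζ => (5 : ℝ) • ((1 + ‖heatSymbol ζ‖) ^ (s / 2) • l2Fourier u.1 ζ)) ?_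
    ((memLp_of_mem_HSpace u).const_smul (5 : ℝ)) ?_ ?_
  · refine h.congr' ?_
    filter_upwards [self_mem_nhdsWithin] with x hx
    rw [hNorm_eq (hFT x hx)]
  · refine Eventually.of_forall fun x => ?_
    exact (aestronglyMeasurable_weight _).smul
      (((measurable_profile_heatRoot x).sub_const 1).aestronglyMeasurable.mul
        (isFourierTransform_toDist u.1).1)
  · filter_upwards [self_mem_nhdsWithin] with x hx
    have hx : 0 < x := hx
    refine Eventually.of_forall fun ζ => ?_
    have hb := norm_profile_le hs (norm_heatRoot_le ζ) x
    have he : Real.exp (-(x * ‖heatRoot ζ‖ / 4)) ≤ 1 :=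
      Real.exp_le_one_iff.mpr (neg_nonpos.mpr (by positivity))
    have h5 : ‖profile s (heatRoot ζ) x - 1‖ ≤ 5 := by
      refine (norm_sub_le _ _).trans ?_
      rw [norm_one]
      linarith
    rw [norm_smul, norm_smul, norm_smul, norm_mul, Real.norm_of_nonneg (by norm_num : (0 : ℝ) ≤ 5),
      mul_left_comm]
    gcongr
  · filter_upwards [ae_heatRoot_ne_zero] with ζ hζ
    have h1 := (tendsto_profile hs (norm_heatRoot_le ζ) hζ).sub_const 1
    have h2 := (h1.mul_const (l2Fourier u.1 ζ)).const_smul ((1 + ‖heatSymbol ζ‖) ^ (s / 2))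
    simpa using h2

theorem isFourierTransform_fracHeat (hs : s ∈ Ioo (0 : ℝ) 1) (u : L2 n) :
    IsFourierTransform (fracHeat hs u) fun ζ => heatSymbol ζ ^ (s : ℂ) * l2Fourier u ζ :=
  Classical.choose_spec (exists_fracHeat hs u)

/-- The elementary inequality behind the mapping property `(∂_t - Δ)^s : ℋ^s → ℋ^{-s}`. -/
theorem weight_mul_le (hs : s ∈ Ioo (0 : ℝ) 1) (ζ : SpaceTime n) :
    (1 + ‖heatSymbol ζ‖) ^ (-s / 2) * ‖heatRoot ζ‖ ^ (2 * s) ≤ (1 + ‖heatSymbol ζ‖) ^ (s / 2) := by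
  have h1 : ‖heatRoot ζ‖ ^ (2 * s) ≤ (1 + ‖heatSymbol ζ‖) ^ s := by
    rw [Real.rpow_mul (norm_nonneg _), Real.rpow_two, norm_heatRoot_sq]
    exact Real.rpow_le_rpow (norm_nonneg _) (by linarith) hs.1.le
  calc _ ≤ (1 + ‖heatSymbol ζ‖) ^ (-s / 2) * (1 + ‖heatSymbol ζ‖) ^ s := by gcongr
    _ = _ := by
      rw [← Real.rpow_add (by positivity)]
      congr 1
      ring

/-- `(∂_t - Δ)^s` maps `ℋ^s` to `ℋ^{-s}`. -/
theorem hNorm_fracHeat_le (hs : s ∈ Ioo (0 : ℝ) 1) (c : ℝ) (u : L2 n) :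
    hNorm (-s) ((c : ℂ) • fracHeat hs u) ≤ ‖c‖₊ * hNorm s (toDist u) := by
  rw [hNorm_eq ((isFourierTransform_fracHeat hs u).smul c),
    hNorm_eq (isFourierTransform_toDist u)]
  refine eLpNorm_le_nnreal_smul_eLpNorm_of_ae_le_mul (Eventually.of_forall fun ζ => ?_) 2
  rw [← NNReal.coe_le_coe]
  push_cast
  rw [norm_smul, norm_smul, norm_mul, norm_mul, Complex.norm_real, Complex.norm_cpow_real,
    Real.norm_of_nonneg (show 0 ≤ (1 + ‖heatSymbol ζ‖) ^ (-s / 2) by positivity),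
    Real.norm_of_nonneg (show 0 ≤ (1 + ‖heatSymbol ζ‖) ^ (s / 2) by positivity)]
  have h := weight_mul_le hs ζ
  rw [Real.rpow_mul (norm_nonneg _), Real.rpow_two, norm_heatRoot_sq] at h
  calc _ = ‖c‖ * ((1 + ‖heatSymbol ζ‖) ^ (-s / 2) * ‖heatSymbol ζ‖ ^ s) * ‖l2Fourier u ζ‖ := by ring
    _ ≤ ‖c‖ * (1 + ‖heatSymbol ζ‖) ^ (s / 2) * ‖l2Fourier u ζ‖ := by gcongr
    _ = _ := by ring

theorem isFourierTransform_conormal (hs : s ∈ Ioo (0 : ℝ) 1) (u : L2 n) {x : ℝ} (hx : 0 < x) :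
    IsFourierTransform
      (toDist (((x ^ (1 - 2 * s) : ℝ) : ℂ) • evolve (gradSymbol s (Fin.last n)) (𝓕 u) x))
      fun ζ => conormal s (heatRoot ζ) x * l2Fourier u ζ := by
  have h := ((isSymbol_gradSymbol (n := n) hs (Fin.last n)).isFourierTransform_evolve u hx).smul
    ((x ^ (1 - 2 * s) : ℝ) : ℂ)
  rw [toDist, map_smul]
  convert h using 2 with ζ
  simp only [gradSymbol_last, conormalSymbol_inv_smul]
  rw [← mul_assoc, ← mul_assoc, ← Complex.ofReal_mul,
    ← Real.rpow_add hx]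
  simp

/-- The weighted normal derivative converges to `d_s (∂_t - Δ)^s u` in `ℋ^{-s}`. -/
theorem tendsto_conormal_boundary (hs : s ∈ Ioo (0 : ℝ) 1) (u : HSpace n s) :
    Tendsto (fun x : ℝ => hNorm (-s)
      (toDist (((x ^ (1 - 2 * s) : ℝ) : ℂ) • evolve (gradSymbol s (Fin.last n)) (𝓕 u.1) x)
        - (extensionConst s : ℂ) • fracHeat hs u.1)) (𝓝[>] 0) (𝓝 0) := by
  have hFT : ∀ x : ℝ, 0 < x → IsFourierTransform
      (toDist (((x ^ (1 - 2 * s) : ℝ) : ℂ) • evolve (gradSymbol s (Fin.last n)) (𝓕 u.1) x)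
        - (extensionConst s : ℂ) • fracHeat hs u.1)
      fun ζ => (conormal s (heatRoot ζ) x - extensionConst s * heatSymbol ζ ^ (s : ℂ)) *
        l2Fourier u.1 ζ := by
    intro x hx
    have h := (isFourierTransform_conormal hs u.1 hx).add
      ((isFourierTransform_fracHeat hs u.1).smul (extensionConst s)).neg
    rw [sub_eq_add_neg]
    convert h using 2 with ζ
    ring
  set K : ℝ := conormalConst s + |extensionConst s| with hK
  have hK0 := conormalConst_pos hs
  have h := tendsto_eLpNorm_two (l := 𝓝[>] (0 : ℝ)) (μ := (volume : Measure (SpaceTime n)))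
    (f := fun x ζ => (1 + ‖heatSymbol ζ‖) ^ (-s / 2) •
      ((conormal s (heatRoot ζ) x - extensionConst s * heatSymbol ζ ^ (s : ℂ)) * l2Fourier u.1 ζ))
    (g := fun ζ => K • ((1 + ‖heatSymbol ζ‖) ^ (s / 2) • l2Fourier u.1 ζ)) ?_
    ((memLp_of_mem_HSpace u).const_smul K) ?_ ?_
  · refine h.congr' ?_
    filter_upwards [self_mem_nhdsWithin] with x hx
    rw [hNorm_eq (hFT x hx)]
  · refine Eventually.of_forall fun x => ?_
    have hm : Measurable fun ζ : SpaceTime n => (extensionConst s : ℂ) * heatSymbol ζ ^ (s : ℂ) :=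
      (continuous_heatSymbol.measurable.pow_const _).const_mul _
    exact (aestronglyMeasurable_weight _).smul
      (((measurable_conormal_heatRoot x).sub hm).aestronglyMeasurable.mul
        (isFourierTransform_toDist u.1).1)
  · filter_upwards [self_mem_nhdsWithin] with x hx
    have hx : 0 < x := hx
    refine Eventually.of_forall fun ζ => ?_
    have hb := norm_conormal_le hs (norm_heatRoot_le ζ) x
    have he : Real.exp (-(x * ‖heatRoot ζ‖ / 4)) ≤ 1 :=
      Real.exp_le_one_iff.mpr (neg_nonpos.mpr (by positivity))
    have h1 : ‖conormal s (heatRoot ζ) x‖ ≤ conormalConst s * ‖heatRoot ζ‖ ^ (2 * s) :=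
      hb.trans (mul_le_of_le_one_right (by positivity) he)
    have h2 : ‖(extensionConst s : ℂ) * heatSymbol ζ ^ (s : ℂ)‖
        = |extensionConst s| * ‖heatRoot ζ‖ ^ (2 * s) := by
      rw [← heatRoot_cpow, norm_mul, Complex.norm_cpow_real, Complex.norm_real, Real.norm_eq_abs]
    have h3 : ‖conormal s (heatRoot ζ) x - extensionConst s * heatSymbol ζ ^ (s : ℂ)‖
        ≤ K * ‖heatRoot ζ‖ ^ (2 * s) := by
      refine (norm_sub_le _ _).trans ?_
      rw [h2, hK]
      linarith
    have h4 := weight_mul_le hs ζ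
    have hKn : 0 ≤ K := by positivity
    rw [norm_smul, norm_smul, norm_smul, norm_mul, Real.norm_of_nonneg hKn,
      Real.norm_of_nonneg (by positivity), Real.norm_of_nonneg (by positivity)]
    calc _ ≤ (1 + ‖heatSymbol ζ‖) ^ (-s / 2) *
          (K * ‖heatRoot ζ‖ ^ (2 * s) * ‖l2Fourier u.1 ζ‖) := by gcongr
      _ = K * ((1 + ‖heatSymbol ζ‖) ^ (-s / 2) * ‖heatRoot ζ‖ ^ (2 * s)) * ‖l2Fourier u.1 ζ‖ := by
          ring
      _ ≤ K * (1 + ‖heatSymbol ζ‖) ^ (s / 2) * ‖l2Fourier u.1 ζ‖ := by gcongr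
      _ = _ := by ring
  · filter_upwards [ae_heatRoot_ne_zero] with ζ hζ
    have h1 := (tendsto_conormal hs (norm_heatRoot_le ζ) hζ).sub_const
      (extensionConst s * heatSymbol ζ ^ (s : ℂ))
    rw [heatRoot_cpow, sub_self] at h1
    have h2 := (h1.mul_const (l2Fourier u.1 ζ)).const_smul ((1 + ‖heatSymbol ζ‖) ^ (-s / 2))
    simpa using h2

end BoundaryValues

/-! ### Real-valued extensions -/

section Real

variable {n : ℕ} {s : ℝ}

/-- The Fourier transform of a real function is Hermitian symmetric. -/
theorem fourier_neg_of_real {u : L2 n} (hu : ∀ᵐ y, (u y).im = 0) :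
    ∀ᵐ η, (𝓕 u : L2 n) η = starRingEnd ℂ ((𝓕 u : L2 n) (-η)) := by
  have hmp : MeasurePreserving (fun η : SpaceTime n => -η) volume volume :=
    Measure.measurePreserving_neg volume
  have hm : MemLp (fun η => starRingEnd ℂ ((𝓕 u : L2 n) (-η))) 2 volume :=
    ((Lp.memLp (𝓕 u : L2 n)).comp_measurePreserving hmp).star
  have h := fourierInv_ae_eq_conj (f := 𝓕 u) (g := hm.toLp _) hm.coeFn_toLp
  have h2 : (𝓕⁻ (hm.toLp _) : L2 n) = u := by
    refine Lp.ext ?_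
    filter_upwards [h, hu] with y hy hy'
    rw [hy, fourierInv_fourier_eq, Complex.conj_eq_iff_im.mpr hy']
  have h3 : (𝓕 u : L2 n) = hm.toLp _ := by
    have h4 := congrArg (fun w : L2 n => (𝓕 w : L2 n)) h2
    simp only [fourier_fourierInv_eq] at h4
    exact h4.symm
  filter_upwards [hm.coeFn_toLp] with η hη
  rw [← hη, ← h3]

/-- The symbol is Hermitian symmetric, as the square root is the principal one. -/
theorem extSymbol_neg (η : SpaceTime n) (x : ℝ) :
    extSymbol s (-η) x = starRingEnd ℂ (extSymbol s η x) := by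
  rw [extSymbol, smul_neg, heatRoot_neg, profile_conj (norm_heatRoot_le _), extSymbol]

theorem IsVersion.im_eq_zero (hs : s ∈ Ioo (0 : ℝ) 1) {u : L2 n} (hu : ∀ᵐ y, (u y).im = 0)
    {F : SpaceTime n × ℝ → ℂ} (hF : IsVersion (extSymbol s) (𝓕 u) F) :
    ∀ᵐ p ∂(volume.restrict (halfSpace n)), (F p).im = 0 := by
  have hk := (hasDecay_extSymbol (n := n) hs).isSymbol
  have hm := hF.1
  rw [volume_restrict_halfSpace] at hm ⊢
  have hm' : AEStronglyMeasurable (fun p => ((F p).re : ℂ))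
      ((volume : Measure (SpaceTime n)).prod (volume.restrict (Ioi 0))) :=
    Complex.continuous_ofReal.comp_aestronglyMeasurable
      (Complex.continuous_re.comp_aestronglyMeasurable hm)
  have h := ae_eq_of_ae_slice hm hm' ?_
  · filter_upwards [h] with p hp
    rw [hp, Complex.ofReal_im]
  filter_upwards [hF.2, self_mem_ae_restrict measurableSet_Ioi] with x hx hx0
  have hmp : MeasurePreserving (fun η : SpaceTime n => -η) volume volume :=
    Measure.measurePreserving_neg volume
  have hsl := hk.coeFn_freqSlice (𝓕 u) hx0
  have hherm : ∀ᵐ η, freqSlice (extSymbol s) (𝓕 u) x η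
      = starRingEnd ℂ (freqSlice (extSymbol s) (𝓕 u) x (-η)) := by
    filter_upwards [hsl, hmp.quasiMeasurePreserving.ae hsl, fourier_neg_of_real hu] with η h1 h2 h3
    rw [h1, h2, map_mul, ← h3, extSymbol_neg, Complex.conj_conj]
  filter_upwards [fourierInv_ae_eq_conj hherm, hx] with y hy hy'
  have h4 : (evolve (extSymbol s) (𝓕 u) x y).im = 0 :=
    Complex.conj_eq_iff_im.mp hy.symm
  rw [hy'] at h4
  exact Complex.ext (by simp) (by simpa using h4)

end Real

/-! ### The equation -/

section Equation

variable {n : ℕ} {s : ℝ}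

/-- The versions of the symbol and of its gradient solve the equation: in Fourier variables it reads
`(x^{1-2s} ∂ₓm)' = x^{1-2s} σ² m` with `σ² = iρ + |ξ|²`. -/
theorem isWeakSolution_of_isVersion (hs : s ∈ Ioo (0 : ℝ) 1) {v : L2 n} {F : SpaceTime n × ℝ → ℂ}
    {D : SpaceTime n × ℝ → EuclideanSpace ℂ (Fin (n + 1))}
    (hF : IsVersion (extSymbol s) v F) (hD : ∀ i, IsVersion (gradSymbol s i) v fun p => D p i) :
    IsWeakSolution s F D := by
  intro φ hφ
  have hext := hasDecay_extSymbol (n := n) hs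
  have hcm : Measurable fun x : ℝ => x ^ (1 - 2 * s) := by fun_prop
  -- the weighted functions and their versions
  have k1 := hext.isSymbol.mul_left (1 - 2 * s)
  have hF1 : IsVersion (fun η x => ((x ^ (1 - 2 * s) : ℝ) : ℂ) * extSymbol s η x) v
      fun p => p.2 ^ (1 - 2 * s) • F p := hF.mul_left hext.isSymbol k1 hcm fun _ _ _ => rfl
  have kD := fun i => (isSymbol_gradSymbol (n := n) hs i).mul_left (1 - 2 * s)
  have hD1 : ∀ i, IsVersion (fun η x => ((x ^ (1 - 2 * s) : ℝ) : ℂ) * gradSymbol s i η x) v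
      fun p => p.2 ^ (1 - 2 * s) • D p i := fun i =>
    (hD i).mul_left (isSymbol_gradSymbol hs i) (kD i) hcm fun _ _ _ => rfl
  -- their derivatives
  have k2 := hext.mul_time.isSymbol.mul_left (1 - 2 * s)
  have k3 := fun j : Fin n => ((hext.mul_space j).mul_space j).isSymbol.mul_left (1 - 2 * s)
  have k4 := (hext.mul_freq (g := fun η => heatRoot ((2 * Real.pi) • η) ^ 2)
    (by
      have h1 : Measurable fun η : SpaceTime n => (2 * Real.pi) • η := by fun_prop
      exact (measurable_heatRoot.comp h1).pow_const 2) 2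
    (fun η => (norm_pow _ _).le)).isSymbol.mul_left (1 - 2 * s)
  obtain ⟨F2, hF2⟩ := k2.exists_isVersion v
  obtain ⟨F4, hF4⟩ := k4.exists_isVersion v
  choose F3 hF3 using fun j => (k3 j).exists_isVersion v
  have w2 : IsWeakDeriv (timeDir n) (fun p => p.2 ^ (1 - 2 * s) • F p) F2 :=
    hF1.isWeakDeriv_tangential k1 k2 hF2 fun x hx η => by
      rw [inner_single]
      ring
  have w3 : ∀ j : Fin n, IsWeakDeriv (spaceDir n j.castSucc)
      (fun p => p.2 ^ (1 - 2 * s) • D p j.castSucc) (F3 j) := fun j => by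
    rw [spaceDir, Fin.snoc_castSucc]
    refine (hD1 _).isWeakDeriv_tangential (kD _) (k3 j) (hF3 j) fun x hx η => ?_
    rw [inner_single]
    simp only [gradSymbol_castSucc]
    ring
  have w4 : IsWeakDeriv (spaceDir n (Fin.last n))
      (fun p => p.2 ^ (1 - 2 * s) • D p (Fin.last n)) F4 := by
    rw [spaceDir, Fin.snoc_last]
    refine (hD1 _).isWeakDeriv_normal (kD _) k4 hF4 fun x hx η => ?_
    have h := hasDerivAt_conormal hs (norm_heatRoot_le ((2 * Real.pi) • η)) hx
    refine h.congr_of_eventuallyEq ?_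
    filter_upwards [Ioi_mem_nhds hx] with y hy
    have hy : 0 < y := hy
    simp only [gradSymbol_last]
    rw [← mul_assoc, ← Complex.ofReal_mul, ← Real.rpow_add hy]
    simp [conormalSymbol]
  have e1 : ∫ p in halfSpace n, p.2 ^ (1 - 2 * s) • (F p * fderiv ℝ φ p (timeDir n))
      = -∫ p in halfSpace n, F2 p * φ p := by
    rw [← w2.2.2 φ hφ]
    simp only [smul_mul_assoc]
  have e2 : ∫ p in halfSpace n, p.2 ^ (1 - 2 * s) • ∑ i, D p i * fderiv ℝ φ p (spaceDir n i)
      = -(∑ j, ∫ p in halfSpace n, F3 j p * φ p) - ∫ p in halfSpace n, F4 p * φ p := by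
    have hint : ∀ i, IntegrableOn (fun p => p.2 ^ (1 - 2 * s) • (D p i *
        fderiv ℝ φ p (spaceDir n i))) (halfSpace n) := fun i => by
      obtain ⟨c1, c2, c3⟩ := hφ.fderiv_apply (spaceDir n i)
      simpa only [smul_mul_assoc] using
        integrable_mul_test ((hD1 i).locallyIntegrableOn (kD i)) c1 c2 c3
    simp only [Finset.smul_sum]
    have h3 := fun j => (w3 j).2.2 φ hφ
    have h4 := w4.2.2 φ hφ
    simp only [smul_mul_assoc] at h3 h4
    rw [integral_finsetSum _ fun i _ => hint i, Fin.sum_univ_castSucc, h4,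
      Finset.sum_congr rfl fun j _ => h3 j, Finset.sum_neg_distrib]
    ring
  rw [e1, e2, hF2.integral_mul k2 hφ, hF4.integral_mul k4 hφ]
  simp only [fun j => (hF3 j).integral_mul (k3 j) hφ]
  have cancel : ∀ {f g h : SpaceTime n × ℝ → ℂ} {μ : Measure (SpaceTime n × ℝ)}, Integrable f μ →
      Integrable g μ → Integrable h μ → (∀ p, f p - g p - h p = 0) →
      -(-∫ p, f p ∂μ) + (-(∫ p, g p ∂μ) - ∫ p, h p ∂μ) = 0 := fun {f g h μ} hf hg hh h0 => by
    have h1 := integral_sub' (hf.sub hg) hh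
    rw [integral_sub' hf hg, (funext h0 : f - g - h = 0), Pi.zero_def, integral_zero] at h1
    linear_combination -h1
  have i2 := hφ.integrable_symbol_mul k2 v
  have i3 := fun j => hφ.integrable_symbol_mul (k3 j) v
  have i4 := hφ.integrable_symbol_mul k4 v
  rw [← integral_finsetSum _ fun j _ => i3 j]
  refine cancel i2 (integrable_finsetSum _ fun j _ => i3 j) i4 fun p => ?_
  -- the heat symbol at `2πη` is `2πi η₀ - ∑ (2πi η_j)²`
  have hz : heatRoot ((2 * Real.pi) • p.1) ^ 2 = 2 * Real.pi * Complex.I * (p.1 0 : ℝ)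
      - ∑ j : Fin n, 2 * Real.pi * Complex.I * (p.1 j.succ : ℝ) *
        (2 * Real.pi * Complex.I * (p.1 j.succ : ℝ)) := by
    rw [heatRoot_sq, heatSymbol, sub_eq_add_neg, ← Finset.sum_neg_distrib, Complex.ofReal_sum]
    congr 1
    · simp only [PiLp.smul_apply, smul_eq_mul]
      push_cast
      ring
    · refine Finset.sum_congr rfl fun j _ => ?_
      simp only [PiLp.smul_apply, smul_eq_mul]
      push_cast
      linear_combination (4 * (Real.pi : ℂ) ^ 2 * (p.1 j.succ : ℂ) ^ 2) * Complex.I_sq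
  simp only [hz]
  rw [sub_eq_zero]
  simp only [sub_mul, mul_sub, Finset.sum_mul, Finset.mul_sum]
  congr 1
  exact Finset.sum_congr rfl fun j _ => by ring

end Equation

/-! ### The extension operator -/

section Operator

variable {n : ℕ} {s : ℝ}

/-- The vector field with partial Fourier transform `gradSymbol s i η x · v η`, the gradient of the
extension. -/
theorem exists_isVersion_gradSymbol (hs : s ∈ Ioo (0 : ℝ) 1) (v : L2 n) :
    ∃ D : SpaceTime n × ℝ → EuclideanSpace ℂ (Fin (n + 1)),
      ∀ i, IsVersion (gradSymbol s i) v fun p => D p i := by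
  choose D hD using fun i => (isSymbol_gradSymbol (n := n) hs i).exists_isVersion v
  exact ⟨fun p => WithLp.toLp 2 fun i => D i p, hD⟩

/-- The energy estimate for the whole gradient. -/
theorem exists_eLpNorm_weighted_gradient_le (hs : s ∈ Ioo (0 : ℝ) 1) : ∃ C : ℝ≥0, ∀ (u : L2 n)
    (D : SpaceTime n × ℝ → EuclideanSpace ℂ (Fin (n + 1))),
    (∀ i, IsVersion (gradSymbol s i) (𝓕 u) fun p => D p i) →
      AEStronglyMeasurable (weighted s D) (volume.restrict (halfSpace n)) ∧
      eLpNorm (weighted s D) 2 (volume.restrict (halfSpace n)) ≤ C * hNorm s (toDist u) := by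
  choose C hC using fun i => exists_eLpNorm_gradient_le (n := n) hs i
  refine ⟨∑ i, C i, fun u D hD => ?_⟩
  have hD' : weighted s D = ∑ i, fun p =>
      EuclideanSpace.single (𝕜 := ℂ) i (weighted s (fun p => D p i) p) := by
    funext p
    ext i
    rw [Finset.sum_apply, WithLp.ofLp_sum, Finset.sum_apply]
    simp [weighted, PiLp.single_apply]
  have hm : ∀ i, AEStronglyMeasurable (weighted s fun p => D p i)
      (volume.restrict (halfSpace n)) := fun i =>
    (by fun_prop : Measurable fun p : SpaceTime n × ℝ =>
      p.2 ^ ((1 - 2 * s) / 2)).aestronglyMeasurable.smul (hD i).1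
  have hm' : ∀ i, AEStronglyMeasurable
      (fun p => EuclideanSpace.single (𝕜 := ℂ) i (weighted s (fun p => D p i) p))
      (volume.restrict (halfSpace n)) := fun i => by
    have hc : Continuous fun z : ℂ => EuclideanSpace.single (𝕜 := ℂ) i z := by
      refine (PiLp.continuous_toLp 2 _).comp ?_
      exact continuous_single (A := fun _ => ℂ) i
    exact hc.comp_aestronglyMeasurable (hm i)
  rw [hD']
  refine ⟨Finset.aestronglyMeasurable_sum _ fun i _ => hm' i, ?_⟩
  refine (eLpNorm_sum_le (fun i _ => hm' i) (by norm_num)).trans ?_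
  rw [ENNReal.ofNNReal_finsetSum, Finset.sum_mul]
  refine Finset.sum_le_sum fun i _ => le_trans (le_of_eq ?_) (hC i u _ (hD i))
  exact eLpNorm_congr_norm_ae (Eventually.of_forall fun p => by simp)

theorem isSliceFamily_evolve {k : SpaceTime n → ℝ → ℂ} (hk : IsSymbol k) {v : L2 n}
    {F : SpaceTime n × ℝ → ℂ} (hF : IsVersion k v F) : IsSliceFamily F (evolve k v) :=
  ⟨hk.continuousOn_evolve v, hF.2⟩

/-- Modulo null sets the versions depend linearly on `u`. -/
theorem IsSymbol.exists_linearMap {k : SpaceTime n → ℝ → ℂ} (hk : IsSymbol k) :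
    ∃ T : L2 n →ₗ[ℂ] (SpaceTime n × ℝ) →ₘ[volume.restrict (halfSpace n)] ℂ,
      ∀ u, IsVersion k (𝓕 u) (T u) := by
  choose F hF using fun v : L2 n => hk.exists_isVersion v
  set T : L2 n → (SpaceTime n × ℝ) →ₘ[volume.restrict (halfSpace n)] ℂ :=
    fun v => AEEqFun.mk (F v) (hF v).1
  have hadd : ∀ (c : ℂ) (v v' : L2 n), T (v + c • v') = T v + c • T v' := fun c v v' =>
    AEEqFun.mk_eq_mk.mpr ((hF _).ae_eq ((hF v).add_smul hk (hF v') c))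
  refine ⟨{ toFun := fun u => T (𝓕 u), map_add' := fun u w => ?_, map_smul' := fun c u => ?_ },
    fun u => (hF _).congr (AEEqFun.coeFn_mk _ _)⟩
  · have h := hadd 1 (𝓕 u) (𝓕 w)
    rwa [one_smul, one_smul, ← FourierTransform.fourier_add] at h
  · have h0 := hadd 1 0 0
    rw [one_smul, add_zero, one_smul, left_eq_add] at h0
    have h := hadd c 0 (𝓕 u)
    rwa [h0, zero_add, zero_add, ← FourierTransform.fourier_smul] at h

/-- The linear extension operator. -/
theorem exists_extension (hs : s ∈ Ioo (0 : ℝ) 1) : ∃ E : HSpace n s →ₗ[ℂ] WSpace n s,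
    ∀ u, IsVersion (extSymbol s) (𝓕 u.1) (E u).1 := by
  have hk := (hasDecay_extSymbol (n := n) hs).isSymbol
  obtain ⟨T, hT⟩ := hk.exists_linearMap
  obtain ⟨C, hC⟩ := exists_eLpNorm_weighted_gradient_le (n := n) hs
  refine ⟨(T.comp (HSpace n s).subtype).codRestrict (WSpace n s) fun u => ⟨fun K hK hc => ?_, ?_⟩,
    fun u => hT u.1⟩
  · have hcm : Measurable fun x : ℝ => x ^ ((1 - 2 * s) / 2) := by fun_prop
    have k1 := hk.mul_left ((1 - 2 * s) / 2)
    exact ((hT u.1).mul_left hk k1 hcm fun _ _ _ => rfl).memLp_compact k1 hc hK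
  · obtain ⟨D, hD⟩ := exists_isVersion_gradSymbol hs (𝓕 u.1)
    obtain ⟨h1, h2⟩ := hC u.1 D hD
    exact ⟨D, fun i => isWeakDeriv_gradSymbol hs (hT u.1) i (hD i), h1,
      h2.trans_lt (ENNReal.mul_lt_top ENNReal.coe_lt_top u.2)⟩

end Operator

end ParabolicExtension

theorem proposition4 (n : ℕ) (hn : 1 ≤ n) (s : ℝ) (hs : s ∈ Ioo (0 : ℝ) 1) :
    ∃ (E : ParabolicExtension.HSpace n s →ₗ[ℂ] ParabolicExtension.WSpace n s)
      (C : ℝ≥0) (CM : ℝ → ℝ≥0),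
      ∀ u : ParabolicExtension.HSpace n s,
        -- `D = ∇ũ`, and `G x = ũ(·, x)`, `H x = ∂_{n+1} ũ(·, x)` for `x > 0`
        ∃ (D : ParabolicExtension.SpaceTime n × ℝ → EuclideanSpace ℂ (Fin (n + 1)))
          (G H : ℝ → Lp ℂ 2 (volume : Measure (ParabolicExtension.SpaceTime n))),
          ParabolicExtension.IsWeightedGradient s (E u).1 D ∧
          ParabolicExtension.IsSliceFamily (E u).1 G ∧
          ParabolicExtension.IsSliceFamily (fun p => D p (Fin.last n)) H ∧
          -- the equation
          ParabolicExtension.IsWeakSolution s (E u).1 D ∧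
          -- the boundary values, attained in `ℋ^s`
          Tendsto (fun x : ℝ => ParabolicExtension.hNorm s
            (ParabolicExtension.toDist (G x - u.1))) (𝓝[>] 0) (𝓝 0) ∧
          -- the bound for the weighted normal derivative
          (∃ L : ℝ≥0∞,
            Tendsto (fun x : ℝ => ParabolicExtension.hNorm (-s)
              (ParabolicExtension.toDist (((x ^ (1 - 2 * s) : ℝ) : ℂ) • H x)))
              (𝓝[>] 0) (𝓝 L) ∧
            L ≤ C * ParabolicExtension.hNorm s (ParabolicExtension.toDist u.1)) ∧
          -- the limit of the weighted normal derivative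
          Tendsto (fun x : ℝ => ParabolicExtension.hNorm (-s)
            (ParabolicExtension.toDist (((x ^ (1 - 2 * s) : ℝ) : ℂ) • H x)
              - (ParabolicExtension.extensionConst s : ℂ) •
                ParabolicExtension.fracHeat hs u.1)) (𝓝[>] 0) (𝓝 0) ∧
          -- the energy bound
          eLpNorm (ParabolicExtension.weighted s D) 2
              (volume.restrict (ParabolicExtension.halfSpace n))
            ≤ C * ParabolicExtension.hNorm s (ParabolicExtension.toDist u.1) ∧
          -- the `L²` bound in strips
          (∀ M : ℝ, 0 < M →
            eLpNorm (ParabolicExtension.weighted s (E u).1) 2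
                (volume.restrict {p | 0 < p.2 ∧ p.2 < M})
              ≤ CM M * eLpNorm u.1 2 volume) ∧
          -- real functions have real extensions
          ((∀ᵐ y, (u.1 y).im = 0) →
            ∀ᵐ p ∂(volume.restrict (ParabolicExtension.halfSpace n)), ((E u).1 p).im = 0) := by
  obtain ⟨E, hE⟩ := ParabolicExtension.exists_extension (n := n) hs
  obtain ⟨C, hC⟩ := ParabolicExtension.exists_eLpNorm_weighted_gradient_le (n := n) hs
  choose CM hCM using ParabolicExtension.exists_eLpNorm_strip_le (n := n) hs
  choose D hD using fun u : ParabolicExtension.HSpace n s =>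
    ParabolicExtension.exists_isVersion_gradSymbol hs (𝓕 u.1)
  refine ⟨E, ‖ParabolicExtension.extensionConst s‖₊ + C, CM, fun u => ?_⟩
  have hDC := hC u.1 (D u) (hD u)
  have hcon := ParabolicExtension.tendsto_conormal_boundary hs u
  have hlim := ParabolicExtension.tendsto_hNorm (by
    filter_upwards [self_mem_nhdsWithin] with x hx
    exact ⟨_, ParabolicExtension.isFourierTransform_conormal hs u.1 hx⟩)
    ((ParabolicExtension.isFourierTransform_fracHeat hs u.1).smul _) hcon
  have hL := ParabolicExtension.hNorm_fracHeat_le hs (ParabolicExtension.extensionConst s) u.1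
  have hgrad : ParabolicExtension.IsWeightedGradient s (E u).1 (D u) :=
    ⟨fun i => ParabolicExtension.isWeakDeriv_gradSymbol hs (hE u) i (hD u i), hDC.1,
      hDC.2.trans_lt (ENNReal.mul_lt_top ENNReal.coe_lt_top u.2)⟩
  refine ⟨D u, ParabolicExtension.evolve (ParabolicExtension.extSymbol s) (𝓕 u.1),
    ParabolicExtension.evolve (ParabolicExtension.gradSymbol s (Fin.last n)) (𝓕 u.1), hgrad,
    ?_, ?_, ?_, ?_, ?_, ?_, ?_, ?_, ?_⟩
  · exact ParabolicExtension.isSliceFamily_evolve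
      (ParabolicExtension.hasDecay_extSymbol hs).isSymbol (hE u)
  · exact ParabolicExtension.isSliceFamily_evolve (ParabolicExtension.isSymbol_gradSymbol hs _)
      (hD u _)
  · exact ParabolicExtension.isWeakSolution_of_isVersion hs (hE u) (hD u)
  · exact ParabolicExtension.tendsto_boundary hs u
  · refine ⟨_, hlim, hL.trans ?_⟩
    gcongr
    exact le_self_add
  · exact hcon
  · refine hDC.2.trans ?_
    gcongr
    exact le_add_self
  · exact fun M _ => hCM M u.1 _ (hE u)
  · exact fun hu => (hE u).im_eq_zero hs hu
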